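/- **Conventions.** Let $A$ be an artin algebra, i.e. an algebra over a commutative artinian ring $R$ that is finitely generated as an $R$-module, with Jacobson radical $J(A)$. Let $\operatorname{proj}A$ be the category of finitely generated projective right $A$-modules; for an idempotent $e$, $\operatorname{add}eA$ is its full subcategory of direct summands of finite direct sums of copies of $eA$. A *subcategory* of an additive category is full and closed under isomorphisms, finite direct sums and direct summands. A two-sided ideal $H$ of a ring $B$ is *idempotent* if $H^2=H$, and *heredity* if moreover $H$ is projective as a right $B$-module and $HJ(B)H=0$. Consider a chain of idempotent ideals $$A=H_0>H_1>\cdots>H_n=0. \qquad (*)$$ It is a *heredity chain* if $H_i/H_{i+1}$ is a heredity ideal of $A/H_{i+1}$ for $0\le i\le n-1$. It is a *right-strongly* (resp. *left-strongly*) *heredity chain* if, for $0\le i\le n-1$, $H_i$ is projective as a right (resp. left) $A$-module and $(H_i/H_{i+1})\,J(A/H_{i+1})\,(H_i/H_{i+1})=0$. Let $\mathcal C$ be an additive category. A subcategory $\mathcal C'$ of $\mathcal C$ is *coreflective* (resp. *reflective*) if the inclusion $\mathcal C'\hookrightarrow\mathcal C$ has a right (resp. left) adjoint; *right* (resp. *left*)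 *rejective* if moreover every component of the counit (resp. unit) is a monomorphism (resp. epimorphism) in $\mathcal C$; *rejective* if it is both right and left rejective; *cosemisimple* if the factor category $\mathcal C/[\mathcal C']$ has zero Jacobson radical, where $[\mathcal C']$ is the ideal of morphisms that factor through an object of $\mathcal C'$. A chain of subcategories $\mathcal C=\mathcal C_0\supseteq\mathcal C_1\supseteq\cdots\supseteq\mathcal C_n=0$ in which $\mathcal C_i$ is cosemisimple in $\mathcal C_{i-1}$ for $1\le i\le n$ is * a *total right* (resp. *left*) *rejective chain* of $\mathcal C$ if each $\mathcal C_i$ with $1\le i\le n$ is right (resp. left) rejective in $\mathcal C$; * a *rejective* (resp. *coreflective*, *reflective*) *chain* of $\mathcal C$ if each $\mathcal C_i$ with $1\le i\le n$ is rejective (resp. coreflective, reflective) in $\mathcal C_{i-1}$. Let $S(i)$, $i\in I$, be representatives of the isomorphism classes of simple right $A$-modules, with projective covers $P(i)$. For a partial order $\le$ on $I$, let $\Delta(i)$ be the maximal factor module of $P(i)$ all of whose composition factors are of the form $S(j)$ with $j\le i$, and let $K(i)$ be the kernel of $P(i)\to\Delta(i)$. The algebra $A$ is *right-strongly quasi-hereditary*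 if there is a partial order on $I$ such that, for every $i$, $K(i)$ is projective and has a finite filtration each of whose factors is isomorphic to some $\Delta(j)$ with $j>i$, and $S(i)$ has composition multiplicity one in $\Delta(i)$. It is *left-strongly quasi-hereditary* if $A^{\mathrm{op}}$ is right-strongly quasi-hereditary, and *strongly quasi-hereditary* if it has a heredity chain that is both right-strongly and left-strongly heredity. **Theorem.** Let $A$ be an artin algebra and let $(*)$ be a chain of idempotent ideals of $A$ with $H_i=Ae_iA$ for idempotents $e_i\in A$, $0\le i\le n$ (so $e_n=0$). The following conditions are equivalent: 1. $(*)$ is a right-strongly (resp. left-strongly) heredity chain; 2. $\operatorname{proj}A=\operatorname{add}e_0A\supseteq\operatorname{add}e_1A\supseteq\cdots\supseteq\operatorname{add}e_nA=0$ is a total right (resp. left) rejective chain of $\operatorname{proj}A$; 3. $(*)$ is a heredity chain, and $\operatorname{proj}A=\operatorname{add}e_0A\supseteq\operatorname{add}e_1A\supseteq\cdots\supseteq\operatorname{add}e_nA=0$ is a coreflective (resp. reflective) chain of $\operatorname{proj}A$. In particular, an artin algebra $A$ is strongly (resp. right-strongly, left-strongly) quasi-hereditary if and only if $\operatorname{proj}A$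 has a rejective (resp. total right rejective, total left rejective) chain. -/

import Mathlib

open CategoryTheory CategoryTheory.Limits

namespace StronglyQH

universe v u w

/-! ## Subcategories of additive categories -/

section Categories

variable {𝒞 : Type w} [Category.{v} 𝒞] [Preadditive 𝒞]

/-- A subcategory of an additive category: full, and closed under isomorphisms, finite direct sums
(including the zero object) and direct summands. -/
structure Subcat (𝒞 : Type w) [Category.{v} 𝒞] [Preadditive 𝒞] where
  /-- The objects of the subcategory. -/
  prop : ObjectProperty 𝒞
  iso : ∀ {X Y : 𝒞}, (X ≅ Y) → prop X → prop Y
  zero : ∃ Z : 𝒞, IsZero Z ∧ prop Z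
  sum : ∀ {X Y : 𝒞}, prop X → prop Y →
    ∃ b : BinaryBicone X Y, Nonempty b.IsBilimit ∧ prop b.pt
  summand : ∀ {X Y : 𝒞} (b : BinaryBicone X Y), Nonempty b.IsBilimit → prop b.pt → prop X

/-- The additive category given by the objects of a subcategory. -/
abbrev Subcat.Cat (P : Subcat 𝒞) : Type w := P.prop.FullSubcategory

/-- Right rejective: the inclusion functor has a right adjoint with monic counit. -/
def Subcat.IsRightRejective (P : Subcat 𝒞) : Prop :=
  ∃ (G : 𝒞 ⥤ P.Cat) (adj : P.prop.ι ⊣ G), ∀ X : 𝒞, Mono (adj.counit.app X)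

/-- Left rejective: the inclusion functor has a left adjoint with epic unit. -/
def Subcat.IsLeftRejective (P : Subcat 𝒞) : Prop :=
  ∃ (G : 𝒞 ⥤ P.Cat) (adj : G ⊣ P.prop.ι), ∀ X : 𝒞, Epi (adj.unit.app X)

/-- Rejective: right rejective and left rejective. -/
def Subcat.IsRejective (P : Subcat 𝒞) : Prop :=
  P.IsRightRejective ∧ P.IsLeftRejective

/-- Coreflective: the inclusion functor has a right adjoint. -/
def Subcat.IsCoreflective (P : Subcat 𝒞) : Prop :=
  ∃ G : 𝒞 ⥤ P.Cat, Nonempty (P.prop.ι ⊣ G)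

/-- Reflective: the inclusion functor has a left adjoint. -/
def Subcat.IsReflective (P : Subcat 𝒞) : Prop :=
  ∃ G : 𝒞 ⥤ P.Cat, Nonempty (G ⊣ P.prop.ι)

/-- The ideal `[P]` of morphisms that factor through an object of `P`. -/
def Subcat.ideal (P : Subcat 𝒞) (X Y : 𝒞) : AddSubgroup (X ⟶ Y) where
  carrier := {f | ∃ Z : 𝒞, P.prop Z ∧ ∃ (g : X ⟶ Z) (h : Z ⟶ Y), g ≫ h = f}
  zero_mem' := by
    obtain ⟨Z, -, hZ⟩ := P.zero
    exact ⟨Z, hZ, 0, 0, by simp⟩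
  add_mem' := by
    rintro a b ⟨Z, hZ, g, h, rfl⟩ ⟨Z', hZ', g', h', rfl⟩
    obtain ⟨c, -, hc⟩ := P.sum hZ hZ'
    exact ⟨c.pt, hc, g ≫ c.inl + g' ≫ c.inr, c.fst ≫ h + c.snd ≫ h', by simp⟩
  neg_mem' := by
    rintro a ⟨Z, hZ, g, h, rfl⟩
    exact ⟨Z, hZ, -g, h, by simp⟩

/-- Congruence of morphisms modulo `[P]`. -/
def Subcat.homRel (P : Subcat 𝒞) : HomRel 𝒞 := fun X Y f g => f - g ∈ P.ideal X Y

instance (P : Subcat 𝒞) : Congruence P.homRel where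
  equivalence :=
    { refl := fun f => by simp [Subcat.homRel]
      symm := fun {f g} h => by
        have := (P.ideal _ _).neg_mem h
        rwa [neg_sub] at this
      trans := fun {f g k} h h' => by
        have := (P.ideal _ _).add_mem h h'
        rwa [sub_add_sub_cancel] at this }
  comp_left := by
    rintro X Y Z f g g' ⟨W, hW, a, b, hab⟩
    exact ⟨W, hW, f ≫ a, b, by simp [hab, Preadditive.comp_sub]⟩
  comp_right := by
    rintro X Y Z f f' g ⟨W, hW, a, b, hab⟩
    exact ⟨W, hW, a, b ≫ g, by rw [← Category.assoc, hab, Preadditive.sub_comp]⟩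

/-- The factor category `𝒞/[P]`. -/
abbrev Subcat.FactorCat (P : Subcat 𝒞) : Type w := CategoryTheory.Quotient P.homRel

instance (P : Subcat 𝒞) : Preadditive P.FactorCat :=
  CategoryTheory.Quotient.preadditive P.homRel (by
    intro X Y f₁ f₂ g₁ g₂ h h'
    have := (P.ideal _ _).add_mem h h'
    rwa [sub_add_sub_comm] at this)

/-- A morphism belongs to the Jacobson radical of the category. -/
def InRadical {X Y : 𝒞} (f : X ⟶ Y) : Prop :=
  ∀ g : Y ⟶ X, IsIso (𝟙 X - f ≫ g)

/-- A category whose Jacobson radical is zero. -/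
def IsSemisimpleCat (𝒞 : Type w) [Category.{v} 𝒞] [Preadditive 𝒞] : Prop :=
  ∀ ⦃X Y : 𝒞⦄ (f : X ⟶ Y), InRadical f → f = 0

/-- `P` is cosemisimple in `𝒞`: the factor category `𝒞/[P]` is semisimple. -/
def Subcat.IsCosemisimple (P : Subcat 𝒞) : Prop := IsSemisimpleCat P.FactorCat

/-- `P` regarded as a subcategory of `Q` (its objects are those of `Q` that lie in `P`;
used for `P ⊆ Q`). -/
def Subcat.within (P Q : Subcat 𝒞) : Subcat Q.Cat where
  prop := fun X => P.prop X.obj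
  iso := fun e h => P.iso (Q.prop.ι.mapIso e) h
  zero := by
    obtain ⟨Z, hZ, hP⟩ := P.zero
    obtain ⟨Z', hZ', hQ⟩ := Q.zero
    refine ⟨⟨Z, Q.iso (hZ'.iso hZ) hQ⟩, ?_, hP⟩
    rw [IsZero.iff_id_eq_zero]
    exact ObjectProperty.hom_ext _ (hZ.eq_of_src _ _)
  sum := by
    intro X Y hX hY
    obtain ⟨b, ⟨hb⟩, hbP⟩ := P.sum hX hY
    obtain ⟨c, ⟨hc⟩, hcQ⟩ := Q.sum X.property Y.property
    have hbQ : Q.prop b.pt := Q.iso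
      { hom := c.fst ≫ b.inl + c.snd ≫ b.inr
        inv := b.fst ≫ c.inl + b.snd ≫ c.inr
        hom_inv_id := by
          apply BinaryFan.IsLimit.hom_ext hc.isLimit <;> simp
        inv_hom_id := by
          apply BinaryFan.IsLimit.hom_ext hb.isLimit <;> simp } hcQ
    refine ⟨{ pt := ⟨b.pt, hbQ⟩
              fst := ObjectProperty.homMk b.fst
              snd := ObjectProperty.homMk b.snd
              inl := ObjectProperty.homMk b.inl
              inr := ObjectProperty.homMk b.inr
              inl_fst := ObjectProperty.hom_ext _ b.inl_fst
              inl_snd := ObjectProperty.hom_ext _ b.inl_snd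
              inr_fst := ObjectProperty.hom_ext _ b.inr_fst
              inr_snd := ObjectProperty.hom_ext _ b.inr_snd }, ⟨?_⟩, hbP⟩
    refine isBinaryBilimitOfTotal _ (ObjectProperty.hom_ext _ ?_)
    change b.fst ≫ b.inl + b.snd ≫ b.inr = 𝟙 b.pt
    apply BinaryFan.IsLimit.hom_ext hb.isLimit <;> simp
  summand := by
    rintro X Y b ⟨hb⟩ h
    refine P.summand (X := X.obj) (Y := Y.obj)
      { pt := b.pt.obj
        fst := b.fst.hom
        snd := b.snd.hom
        inl := b.inl.hom
        inr := b.inr.hom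
        inl_fst := congrArg (fun f => f.hom) b.inl_fst
        inl_snd := congrArg (fun f => f.hom) b.inl_snd
        inr_fst := congrArg (fun f => f.hom) b.inr_fst
        inr_snd := congrArg (fun f => f.hom) b.inr_snd } ⟨?_⟩ h
    refine isBinaryBilimitOfTotal _ ?_
    have ht : b.fst ≫ b.inl + b.snd ≫ b.inr = 𝟙 b.pt := by
      apply BinaryFan.IsLimit.hom_ext hb.isLimit <;> simp
    exact congrArg (fun f => f.hom) ht

/-- A chain `𝒞 = 𝒞₀ ⊇ 𝒞₁ ⊇ ⋯ ⊇ 𝒞ₙ = 0` of subcategories of `𝒞`.  (Only the values of `C` at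
`0, …, n` matter.) -/
structure IsSubcatChain (n : ℕ) (C : ℕ → Subcat 𝒞) : Prop where
  whole : ∀ X : 𝒞, (C 0).prop X
  le : ∀ i < n, (C (i + 1)).prop ≤ (C i).prop
  zero : ∀ X : 𝒞, (C n).prop X → IsZero X

/-- Rejective chain. -/
structure IsRejectiveChain (n : ℕ) (C : ℕ → Subcat 𝒞) : Prop where
  chain : IsSubcatChain n C
  rejective : ∀ i < n, ((C (i + 1)).within (C i)).IsRejective
  cosemisimple : ∀ i < n, ((C (i + 1)).within (C i)).IsCosemisimple

/-- Total right rejective chain: each member is right rejective in the whole category. -/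
structure IsTotalRightRejectiveChain (n : ℕ) (C : ℕ → Subcat 𝒞) : Prop where
  chain : IsSubcatChain n C
  rejective : ∀ i < n, (C (i + 1)).IsRightRejective
  cosemisimple : ∀ i < n, ((C (i + 1)).within (C i)).IsCosemisimple

/-- Total left rejective chain: each member is left rejective in the whole category. -/
structure IsTotalLeftRejectiveChain (n : ℕ) (C : ℕ → Subcat 𝒞) : Prop where
  chain : IsSubcatChain n C
  rejective : ∀ i < n, (C (i + 1)).IsLeftRejective
  cosemisimple : ∀ i < n, ((C (i + 1)).within (C i)).IsCosemisimple

/-- Coreflective chain. -/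
structure IsCoreflectiveChain (n : ℕ) (C : ℕ → Subcat 𝒞) : Prop where
  chain : IsSubcatChain n C
  coreflective : ∀ i < n, ((C (i + 1)).within (C i)).IsCoreflective
  cosemisimple : ∀ i < n, ((C (i + 1)).within (C i)).IsCosemisimple

/-- Reflective chain. -/
structure IsReflectiveChain (n : ℕ) (C : ℕ → Subcat 𝒞) : Prop where
  chain : IsSubcatChain n C
  reflective : ∀ i < n, ((C (i + 1)).within (C i)).IsReflective
  cosemisimple : ∀ i < n, ((C (i + 1)).within (C i)).IsCosemisimple

end Categories

/-! ## Projective modules and `add eA`.  Right `A`-modules are modules over `Aᵐᵒᵖ`. -/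

section Proj

/-- The category `proj A` of finitely generated projective right `A`-modules. -/
abbrev ProjCat (A : Type u) [Ring A] : Type (u + 1) :=
  ObjectProperty.FullSubcategory
    (fun M : ModuleCat.{u} Aᵐᵒᵖ => Module.Finite Aᵐᵒᵖ M ∧ Module.Projective Aᵐᵒᵖ M)

/-- `X` belongs to `add M`: it is a direct summand of a finite direct sum of copies of `M`. -/
def InAdd (B : Type u) [Ring B] (M X : Type u) [AddCommGroup M] [Module B M]
    [AddCommGroup X] [Module B X] : Prop :=
  ∃ (k : ℕ) (N : ModuleCat.{u} B), Nonempty ((X × N) ≃ₗ[B] (Fin k → M))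

/-- The right ideal `eA`. -/
abbrev rightIdeal {A : Type u} [Ring A] (e : A) : Submodule Aᵐᵒᵖ A := Submodule.span Aᵐᵒᵖ {e}

/-- The direct sum decomposition of modules given by a direct sum in `proj A`. -/
def bilimitEquiv {A : Type u} [Ring A] {X Y : ProjCat A} (b : BinaryBicone X Y)
    (hb : b.IsBilimit) : b.pt.obj ≃ₗ[Aᵐᵒᵖ] (X.obj × Y.obj) :=
  { LinearMap.prod b.fst.hom.hom b.snd.hom.hom with
    invFun := fun p => b.inl.hom.hom p.1 + b.inr.hom.hom p.2
    left_inv := by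
      have ht : b.fst ≫ b.inl + b.snd ≫ b.inr = 𝟙 b.pt := by
        apply BinaryFan.IsLimit.hom_ext hb.isLimit <;> simp
      intro x
      exact congrArg (fun f : b.pt ⟶ b.pt => f.hom.hom x) ht
    right_inv := by
      rintro ⟨x, y⟩
      have h1 : b.fst.hom.hom (b.inl.hom.hom x) = x :=
        congrArg (fun f : X ⟶ X => f.hom.hom x) b.inl_fst
      have h2 : b.snd.hom.hom (b.inl.hom.hom x) = 0 :=
        congrArg (fun f : X ⟶ Y => f.hom.hom x) b.inl_snd
      have h3 : b.fst.hom.hom (b.inr.hom.hom y) = 0 :=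
        congrArg (fun f : Y ⟶ X => f.hom.hom y) b.inr_fst
      have h4 : b.snd.hom.hom (b.inr.hom.hom y) = y :=
        congrArg (fun f : Y ⟶ Y => f.hom.hom y) b.inr_snd
      change (b.fst.hom.hom (b.inl.hom.hom x + b.inr.hom.hom y),
        b.snd.hom.hom (b.inl.hom.hom x + b.inr.hom.hom y)) = (x, y)
      rw [map_add, map_add, h1, h2, h3, h4, add_zero, zero_add] }

/-- The subcategory `add eA` of `proj A`. -/
def addIdem {A : Type u} [Ring A] (e : A) : Subcat (ProjCat A) where
  prop := fun X => InAdd Aᵐᵒᵖ (rightIdeal e) X.obj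
  iso := by
    rintro X Y f ⟨k, N, ⟨g⟩⟩
    let f' : X.obj ≃ₗ[Aᵐᵒᵖ] Y.obj := ((ObjectProperty.ι _).mapIso f).toLinearEquiv
    exact ⟨k, N, ⟨(f'.symm.prodCongr (LinearEquiv.refl _ _)).trans g⟩⟩
  zero := by
    refine ⟨⟨ModuleCat.of Aᵐᵒᵖ PUnit.{u + 1}, ?_, ?_⟩, ?_, 0, ModuleCat.of Aᵐᵒᵖ PUnit.{u + 1}, ⟨?_⟩⟩
    · change Module.Finite Aᵐᵒᵖ PUnit.{u + 1}
      infer_instance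
    · change Module.Projective Aᵐᵒᵖ PUnit.{u + 1}
      infer_instance
    · rw [IsZero.iff_id_eq_zero]
      apply ObjectProperty.hom_ext
      apply ModuleCat.hom_ext
      apply LinearMap.ext
      intro x
      exact Subsingleton.elim (α := PUnit.{u + 1}) _ _
    · change (PUnit.{u + 1} × PUnit.{u + 1}) ≃ₗ[Aᵐᵒᵖ] (Fin 0 → rightIdeal e)
      exact 0
  sum := by
    rintro X Y ⟨k, N, ⟨f⟩⟩ ⟨l, N', ⟨g⟩⟩
    have hX := X.property
    have hY := Y.property
    have : Module.Finite Aᵐᵒᵖ X.obj := hX.1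
    have : Module.Finite Aᵐᵒᵖ Y.obj := hY.1
    have : Module.Projective Aᵐᵒᵖ X.obj := hX.2
    have : Module.Projective Aᵐᵒᵖ Y.obj := hY.2
    let Z : ProjCat A := ⟨ModuleCat.of Aᵐᵒᵖ (X.obj × Y.obj),
      (inferInstance : Module.Finite Aᵐᵒᵖ (X.obj × Y.obj)),
      (inferInstance : Module.Projective Aᵐᵒᵖ (X.obj × Y.obj))⟩
    refine ⟨{ pt := Z
              fst := ObjectProperty.homMk (ModuleCat.ofHom (LinearMap.fst _ _ _))
              snd := ObjectProperty.homMk (ModuleCat.ofHom (LinearMap.snd _ _ _))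
              inl := ObjectProperty.homMk (ModuleCat.ofHom (LinearMap.inl _ _ _))
              inr := ObjectProperty.homMk (ModuleCat.ofHom (LinearMap.inr _ _ _))
              inl_fst := rfl
              inl_snd := rfl
              inr_fst := rfl
              inr_snd := rfl }, ⟨?_⟩, k + l, ModuleCat.of Aᵐᵒᵖ (N × N'), ⟨?_⟩⟩
    · refine isBinaryBilimitOfTotal _ ?_
      apply ObjectProperty.hom_ext
      apply ModuleCat.hom_ext
      apply LinearMap.ext
      rintro ⟨x, y⟩
      change ((x, 0) : X.obj × Y.obj) + (0, y) = (x, y)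
      simp
    · change ((X.obj × Y.obj) × (N × N')) ≃ₗ[Aᵐᵒᵖ] (Fin (k + l) → rightIdeal e)
      exact (LinearEquiv.prodProdProdComm Aᵐᵒᵖ X.obj Y.obj N N').trans
        ((f.prodCongr g).trans
          ((LinearEquiv.sumArrowLequivProdArrow (Fin k) (Fin l) Aᵐᵒᵖ (rightIdeal e)).symm.trans
            (LinearEquiv.funCongrLeft Aᵐᵒᵖ (rightIdeal e) finSumFinEquiv.symm)))
  summand := by
    rintro X Y b ⟨hb⟩ ⟨k, N, ⟨f⟩⟩
    refine ⟨k, ModuleCat.of Aᵐᵒᵖ (Y.obj × N), ⟨?_⟩⟩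
    change (X.obj × (Y.obj × N)) ≃ₗ[Aᵐᵒᵖ] (Fin k → rightIdeal e)
    exact (LinearEquiv.prodAssoc Aᵐᵒᵖ X.obj Y.obj N).symm.trans
      (((bilimitEquiv b hb).symm.prodCongr (LinearEquiv.refl _ _)).trans f)

end Proj

/-! ## Heredity chains -/

section Heredity

variable {A : Type u} [Ring A]

/-- `H² = H`; here `H²` is the ideal generated by the products of two elements of `H`. -/
def IsIdempotentIdeal (H : TwoSidedIdeal A) : Prop :=
  TwoSidedIdeal.span {z : A | ∃ x ∈ H, ∃ y ∈ H, x * y = z} = H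

/-- `H J(A) H = 0`. -/
def MulJacobsonMulEqZero (H : TwoSidedIdeal A) : Prop :=
  ∀ x ∈ H, ∀ r ∈ Ring.jacobson A, ∀ y ∈ H, x * r * y = 0

/-- A heredity ideal.  Projectivity is that of `H` as a right module. -/
structure IsHeredityIdeal (H : TwoSidedIdeal A) : Prop where
  idem : IsIdempotentIdeal H
  proj : Module.Projective Aᵐᵒᵖ H
  mul_jacobson_mul : MulJacobsonMulEqZero H

/-- The ideal `H/H'` of the factor ring `A/H'` (used for `H' ⊆ H`). -/
def quotIdeal (H H' : TwoSidedIdeal A) : TwoSidedIdeal H'.ringCon.Quotient :=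
  TwoSidedIdeal.map H'.ringCon.mk' H

/-- A chain `A = H₀ > H₁ > ⋯ > Hₙ = 0` of idempotent ideals.  (Only the values of `H` at
`0, …, n` matter.) -/
structure IsIdempotentIdealChain (n : ℕ) (H : ℕ → TwoSidedIdeal A) : Prop where
  whole : H 0 = ⊤
  lt : ∀ i < n, H (i + 1) < H i
  zero : H n = ⊥
  idem : ∀ i ≤ n, IsIdempotentIdeal (H i)

/-- Heredity chain. -/
structure IsHeredityChain (n : ℕ) (H : ℕ → TwoSidedIdeal A) : Prop where
  chain : IsIdempotentIdealChain n H
  heredity : ∀ i < n, IsHeredityIdeal (quotIdeal (H i) (H (i + 1)))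

/-- Right-strongly heredity chain. -/
structure IsRightStronglyHeredityChain (n : ℕ) (H : ℕ → TwoSidedIdeal A) : Prop where
  chain : IsIdempotentIdealChain n H
  proj : ∀ i < n, Module.Projective Aᵐᵒᵖ (H i)
  mul_jacobson_mul : ∀ i < n, MulJacobsonMulEqZero (quotIdeal (H i) (H (i + 1)))

/-- Left-strongly heredity chain. -/
structure IsLeftStronglyHeredityChain (n : ℕ) (H : ℕ → TwoSidedIdeal A) : Prop where
  chain : IsIdempotentIdealChain n H
  proj : ∀ i < n, Module.Projective A (H i)
  mul_jacobson_mul : ∀ i < n, MulJacobsonMulEqZero (quotIdeal (H i) (H (i + 1)))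

end Heredity

/-! ## Strongly quasi-hereditary algebras -/

section QuasiHereditary

/-- The (simple) module `T` is a composition factor of the (finite length) module `M`:
it is isomorphic to a subquotient `V/U` of `M`. -/
def IsCompositionFactor (B : Type u) [Ring B] (T M : Type u) [AddCommGroup T] [Module B T]
    [AddCommGroup M] [Module B M] : Prop :=
  ∃ U V : Submodule B M, U ≤ V ∧ Nonempty ((V ⧸ U.submoduleOf V) ≃ₗ[B] T)

/-- `π : P → M` is a projective cover: `P` is projective and `π` is surjective with superfluous
kernel. -/
structure IsProjectiveCover {B : Type u} [Ring B] {P M : Type u} [AddCommGroup P] [Module B P]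
    [AddCommGroup M] [Module B M] (π : P →ₗ[B] M) : Prop where
  proj : Module.Projective B P
  surj : Function.Surjective π
  superfluous : ∀ N : Submodule B P, N ⊔ LinearMap.ker π = ⊤ → N = ⊤

/-- A complete set of representatives `S i` of the isomorphism classes of simple `B`-modules,
with their projective covers `P i`. -/
structure SimpleSystem (B : Type u) [Ring B] where
  /-- The index set. -/
  I : Type u
  /-- The simple modules. -/
  S : I → ModuleCat.{u} B
  simple : ∀ i, IsSimpleModule B (S i)
  distinct : ∀ i j, Nonempty (S i ≃ₗ[B] S j) → i = j
  complete : ∀ T : ModuleCat.{u} B, IsSimpleModule B T → ∃ i, Nonempty (T ≃ₗ[B] S i)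
  /-- The indecomposable projective modules. -/
  P : I → ModuleCat.{u} B
  /-- The projection of `P i` onto `S i`. -/
  π : ∀ i, P i →ₗ[B] S i
  cover : ∀ i, IsProjectiveCover (π i)

namespace SimpleSystem

variable {B : Type u} [Ring B] (D : SimpleSystem B) [PartialOrder D.I]

/-- The kernel `K i` of `P i → Δ i`: the smallest submodule `U` of `P i` such that all the
composition factors of `P i / U` are of the form `S j` with `j ≤ i`.  (When `P i` has finite
length, the infimum is attained, since `P/(U ⊓ V)` embeds in `P/U × P/V`.) -/
def K (i : D.I) : Submodule B (D.P i) :=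
  sInf {U | ∀ j, IsCompositionFactor B (D.S j) (D.P i ⧸ U) → j ≤ i}

/-- The standard module `Δ i`. -/
abbrev Δ (i : D.I) : Type u := D.P i ⧸ D.K i

/-- `M` has a filtration `M = F₀ ⊇ F₁ ⊇ ⋯ ⊇ F_l = 0` in which each factor is isomorphic to
`Δ j` for some `j ∈ J`; so `M ∈ ℱ(Δ)`, and `(M : Δ j) = 0` for `j ∉ J`. -/
def IsDeltaFiltered (J : Set D.I) (M : Type u) [AddCommGroup M] [Module B M] : Prop :=
  ∃ (l : ℕ) (F : ℕ → Submodule B M), F 0 = ⊤ ∧ F l = ⊥ ∧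
    ∀ k < l, F (k + 1) ≤ F k ∧
      ∃ j ∈ J, Nonempty ((F k ⧸ (F (k + 1)).submoduleOf (F k)) ≃ₗ[B] D.Δ j)

end SimpleSystem

/-- `A` is right-strongly quasi-hereditary: for some partial order on the set of (isomorphism
classes of) simple right modules, and every `i`, the kernel of `P i → Δ i` is projective and
filtered by `Δ j` with `j > i`, and `S i` has multiplicity one in `Δ i`, that is, it does not occur
in the radical of `Δ i`. -/
def IsRightStronglyQuasiHereditary (A : Type u) [Ring A] : Prop :=
  ∃ (D : SimpleSystem Aᵐᵒᵖ) (_ : PartialOrder D.I), ∀ i : D.I,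
    D.IsDeltaFiltered {j | i < j} (D.K i) ∧
    Module.Projective Aᵐᵒᵖ (D.K i) ∧
    ¬ IsCompositionFactor Aᵐᵒᵖ (D.S i) (Module.jacobson Aᵐᵒᵖ (D.Δ i))

/-- `A` is left-strongly quasi-hereditary: the opposite algebra is right-strongly
quasi-hereditary. -/
def IsLeftStronglyQuasiHereditary (A : Type u) [Ring A] : Prop :=
  IsRightStronglyQuasiHereditary Aᵐᵒᵖ

/-- `A` is strongly quasi-hereditary: some heredity chain is both right-strongly and left-strongly
heredity. -/
def IsStronglyQuasiHereditary (A : Type u) [Ring A] : Prop :=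
  ∃ (n : ℕ) (H : ℕ → TwoSidedIdeal A), IsHeredityChain n H ∧
    IsRightStronglyHeredityChain n H ∧ IsLeftStronglyHeredityChain n H

end QuasiHereditary

end StronglyQH

open StronglyQH

/-! Both sides of the theorem reduce to elementwise conditions. On the ring side, `RelProj H H'`
says by a finite dual basis that `H/H'` is a projective right `A/H'`-module, and `RelJac H H'` is
the radical condition. On the categorical side, adjunctions become approximations
(`RightRejectiveIn`, `CoreflectiveIn`, ...). The bridge is the correspondence `IsAdd` between
subcategories of `proj A` and idempotent ideals: a subcategory yields the ideal of endomorphisms of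
the generator `A` that factor through it, and `add eA` yields `AeA`.

Under this correspondence the ideal `H` is the image of the right approximation of `A`, so that `H`
is projective exactly when the approximation is monic (`IsAdd.relProj_iff`), and cosemisimplicity is
`RelJac` (`IsAdd.cosemisimpleIn_iff`). This gives the equivalence of the first two conditions. The
hard implication is from the third: in a heredity chain the coreflection of `A` is automatically
monic, because a morphism that it kills is pushed into `H m` for every `m`, hence into `H n = 0`
(`relProj_bot_of_coreflectiveIn`).

The left version is the right version for the opposite category. This needs the left-right symmetry
of heredity ideals (`RelProj.op_of_relJac`): if `HJH = 0` then `eAe` is semisimple, and a dual basis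
of `eA` over `eAe` becomes one of `AeA` as a left ideal. For strongly quasi-hereditary algebras,
one-sided rejectivity alone does not pass along a chain, but both sides together do
(`RightRejectiveIn.trans`).

For the definition by standard modules, put `B = Aᵐᵒᵖ`. A partial order yields the chain of traces
in `B` of the `P k`, with `k` in shrinking upper sets (`exists_chain_traceIdeal`). Conversely, a
chain orders the simple modules by the first ideal that annihilates them; then `K i` equals `H (lam
i) • P i` (`K_eq_smul_top`), and the required filtration is peeled off one `Δ j` at a time
(`exists_filtration`). -/

open CategoryTheory CategoryTheory.Limits
open StronglyQH
namespace StronglyQH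

universe v u w

/-! ### Projectivity of `H/H'` over `A/H'`, expressed by dual bases in `A`. -/

section RelativeProjectivity

variable {A : Type*} [Ring A]

/-- A finite dual basis of `H`, as a right ideal, modulo `H'`. -/
def RelProj (H H' : TwoSidedIdeal A) : Prop :=
  ∃ (k : ℕ) (x : Fin k → A) (g : Fin k → A → A), (∀ i, x i ∈ H) ∧
    (∀ i, ∀ h ∈ H, ∀ a, g i (h * a) - g i h * a ∈ H') ∧
    (∀ i, ∀ h ∈ H, ∀ h₂ ∈ H, g i (h + h₂) - (g i h + g i h₂) ∈ H') ∧
    (∀ i, ∀ h ∈ H', g i h ∈ H') ∧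
    (∀ h ∈ H, h - ∑ i, x i * g i h ∈ H')

/-- The image of `r` in `A/H'` lies in the Jacobson radical. -/
def RelRad (H' : TwoSidedIdeal A) (r : A) : Prop :=
  ∀ a b, ∃ u, u * (1 - a * r * b) - 1 ∈ H' ∧ (1 - a * r * b) * u - 1 ∈ H'

/-- `H J H ⊆ H'`, where `J` is the preimage of the Jacobson radical of `A/H'`. -/
def RelJac (H H' : TwoSidedIdeal A) : Prop :=
  ∀ x ∈ H, ∀ y ∈ H, ∀ r, RelRad H' r → x * r * y ∈ H'

theorem projective_of_relProj {H : TwoSidedIdeal A} (h : RelProj H ⊥) :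
    Module.Projective Aᵐᵒᵖ H := by
  obtain ⟨k, x, g, hx, hmul, hadd, -, hsum⟩ := h
  simp only [TwoSidedIdeal.mem_bot, sub_eq_zero] at hmul hadd hsum
  let s : H →ₗ[Aᵐᵒᵖ] (Fin k → Aᵐᵒᵖ) :=
    { toFun := fun h i => MulOpposite.op (g i h)
      map_add' := fun a b => by
        funext i
        exact congrArg MulOpposite.op (hadd i a a.2 b b.2)
      map_smul' := fun c a => by
        funext i
        exact congrArg MulOpposite.op (hmul i a a.2 c.unop) }
  refine Module.Projective.of_split s
    (Fintype.linearCombination Aᵐᵒᵖ (fun i => (⟨x i, hx i⟩ : H))) ?_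
  ext h
  have := hsum h h.2
  simp only [LinearMap.comp_apply, Fintype.linearCombination_apply, LinearMap.id_apply]
  rw [this]
  change TwoSidedIdeal.coeAddMonoidHom H (∑ i, _) = _
  rw [map_sum]
  rfl

theorem finite_twoSidedIdeal_right [IsNoetherianRing Aᵐᵒᵖ] (H : TwoSidedIdeal A) :
    Module.Finite Aᵐᵒᵖ H :=
  Module.Finite.of_injective H.subtypeMop H.subtypeMop_injective

theorem relProj_of_projective [IsNoetherianRing Aᵐᵒᵖ] {H : TwoSidedIdeal A}
    (h : Module.Projective Aᵐᵒᵖ H) : RelProj H ⊥ := by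
  classical
  have := finite_twoSidedIdeal_right H
  obtain ⟨k, f, hf⟩ := Module.Finite.exists_fin' Aᵐᵒᵖ H
  obtain ⟨s, hs⟩ := f.exists_rightInverse_of_surjective (LinearMap.range_eq_top.2 hf)
  -- The coordinate functions are extended by `0` outside `H`; no condition constrains them there.
  refine ⟨k, fun i => f (Pi.single i 1),
    fun i a => if h : a ∈ H then (s ⟨a, h⟩ i).unop else 0, fun i => (f _).2, ?_, ?_, ?_, ?_⟩
  · intro i h hh a
    beta_reduce
    have h2 : h * a ∈ H := H.mul_mem_right _ _ hh
    rw [dif_pos h2, dif_pos hh, TwoSidedIdeal.mem_bot, sub_eq_zero]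
    have : (⟨h * a, h2⟩ : H) = MulOpposite.op a • ⟨h, hh⟩ := rfl
    rw [this, map_smul]
    rfl
  · intro i h hh h' hh'
    beta_reduce
    have h2 : h + h' ∈ H := H.add_mem hh hh'
    rw [dif_pos h2, dif_pos hh, dif_pos hh', TwoSidedIdeal.mem_bot, sub_eq_zero]
    have : (⟨h + h', h2⟩ : H) = ⟨h, hh⟩ + ⟨h', hh'⟩ := rfl
    rw [this, map_add]
    rfl
  · intro i h hh
    rw [TwoSidedIdeal.mem_bot] at hh ⊢
    subst hh
    beta_reduce
    rw [dif_pos H.zero_mem]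
    have : (⟨0, H.zero_mem⟩ : H) = 0 := rfl
    rw [this, map_zero]
    rfl
  · intro h hh
    rw [TwoSidedIdeal.mem_bot, sub_eq_zero]
    simp only [dif_pos hh]
    have h1 : f (s ⟨h, hh⟩) = ⟨h, hh⟩ := LinearMap.congr_fun hs _
    have h2 : s ⟨h, hh⟩ = ∑ i, (s ⟨h, hh⟩ i) • (Pi.single i (1 : Aᵐᵒᵖ) : Fin k → Aᵐᵒᵖ) :=
      pi_eq_sum_univ' _
    rw [h2, map_sum] at h1
    have h3 := congrArg (TwoSidedIdeal.coeAddMonoidHom H) h1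
    rw [map_sum] at h3
    simp only [map_smul] at h3
    exact h3.symm

theorem relProj_bot_iff [IsNoetherianRing Aᵐᵒᵖ] {H : TwoSidedIdeal A} :
    RelProj H ⊥ ↔ Module.Projective Aᵐᵒᵖ H :=
  ⟨projective_of_relProj, relProj_of_projective⟩

theorem relProj_bot_bot : RelProj (⊥ : TwoSidedIdeal A) ⊥ := by
  refine ⟨0, Fin.elim0, Fin.elim0, fun i => i.elim0, fun i => i.elim0, fun i => i.elim0,
    fun i => i.elim0, ?_⟩
  intro h hh
  simpa using hh

theorem relProj_top_bot : RelProj (⊤ : TwoSidedIdeal A) ⊥ := by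
  refine ⟨1, fun _ => 1, fun _ a => a, fun _ => trivial, ?_, ?_, ?_, ?_⟩ <;>
    simp [TwoSidedIdeal.mem_bot]

/-- Coordinate functions are transported along a set-theoretic section `σ` of `π`. As `σ` is not
additive, the descent to `B` relies on the condition that `g i` maps `H'` to `H'`: it makes `π ∘ g
i` constant on the fibres of `π` in `H` (`hg`). -/
theorem relProj_map_iff {B : Type*} [Ring B] (π : A →+* B) (hπ : Function.Surjective π)
    {H H' : TwoSidedIdeal A} {K : TwoSidedIdeal B} (hH' : ∀ a, a ∈ H' ↔ π a = 0) (hle : H' ≤ H)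
    (hK : ∀ b, b ∈ K ↔ ∃ a ∈ H, π a = b) : RelProj K ⊥ ↔ RelProj H H' := by
  have hmem : ∀ a, π a ∈ K → a ∈ H := by
    intro a ha
    obtain ⟨a', ha', h⟩ := (hK _).1 ha
    have : a - a' ∈ H' := (hH' _).2 (by rw [map_sub, h, sub_self])
    simpa using H.add_mem (hle this) ha'
  constructor
  · rintro ⟨k, x, g, hx, hmul, hadd, h0, hsum⟩
    choose! y hy hyx using fun b (hb : b ∈ K) => (hK b).1 hb
    choose σ hσ using hπ
    have hKH : ∀ a ∈ H, π a ∈ K := fun a ha => (hK _).2 ⟨a, ha, rfl⟩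
    refine ⟨k, fun i => y (x i), fun i a => σ (g i (π a)), fun i => hy _ (hx i), ?_, ?_, ?_, ?_⟩
    · intro i h hh a
      rw [hH']
      have := hmul i (π h) (hKH h hh) (π a)
      simpa [hσ, TwoSidedIdeal.mem_bot] using this
    · intro i h hh h' hh'
      rw [hH']
      have := hadd i (π h) (hKH h hh) _ (hKH h' hh')
      simpa [hσ, TwoSidedIdeal.mem_bot] using this
    · intro i h hh
      rw [hH'] at hh ⊢
      rw [hσ, hh]
      exact h0 i 0 (TwoSidedIdeal.zero_mem _)
    · intro h hh
      rw [hH']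
      have := hsum (π h) (hKH h hh)
      rw [map_sub, map_sum]
      simp only [map_mul, hσ, fun i => hyx _ (hx i)]
      exact this
  · rintro ⟨k, x, g, hx, hmul, hadd, h0, hsum⟩
    have hπ' := hπ
    choose σ hσ using hπ
    have hσH : ∀ b ∈ K, σ b ∈ H := fun b hb => hmem _ (by rwa [hσ])
    have hg : ∀ i a a', a ∈ H → a' ∈ H → π a = π a' → π (g i a) = π (g i a') := by
      intro i a a' ha ha' h
      have h1 : a - a' ∈ H' := (hH' _).2 (by rw [map_sub, h, sub_self])
      have h2 := hadd i (a - a') (hle h1) a' ha'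
      have h3 := h0 i _ h1
      rw [sub_add_cancel, hH'] at h2
      rw [hH'] at h3
      rw [map_sub, map_add, h3, zero_add, sub_eq_zero] at h2
      exact h2
    refine ⟨k, fun i => π (x i), fun i b => π (g i (σ b)), fun i => (hK _).2 ⟨_, hx i, rfl⟩,
      ?_, ?_, ?_, ?_⟩
    · intro i h hh a
      beta_reduce
      rw [TwoSidedIdeal.mem_bot, sub_eq_zero]
      rw [hg i (σ (h * a)) (σ h * σ a) (hσH _ (K.mul_mem_right _ _ hh))
        (H.mul_mem_right _ _ (hσH _ hh)) (by simp [hσ])]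
      have := hmul i (σ h) (hσH _ hh) (σ a)
      rwa [hH', map_sub, sub_eq_zero, map_mul, hσ] at this
    · intro i h hh h' hh'
      beta_reduce
      rw [TwoSidedIdeal.mem_bot, sub_eq_zero]
      rw [hg i (σ (h + h')) (σ h + σ h') (hσH _ (K.add_mem hh hh'))
        (H.add_mem (hσH _ hh) (hσH _ hh')) (by simp [hσ])]
      have := hadd i (σ h) (hσH _ hh) (σ h') (hσH _ hh')
      rwa [hH', map_sub, sub_eq_zero, map_add] at this
    · intro i h hh
      rw [TwoSidedIdeal.mem_bot] at hh ⊢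
      subst hh
      have := h0 i (σ 0) ((hH' _).2 (hσ 0))
      rwa [hH'] at this
    · intro h hh
      have := hsum (σ h) (hσH h hh)
      rw [hH', map_sub, map_sum] at this
      rw [TwoSidedIdeal.mem_bot]
      simpa only [map_mul, hσ] using this

theorem mem_map_iff_of_surjective {B : Type*} [Ring B] (π : A →+* B)
    (hπ : Function.Surjective π) (H : TwoSidedIdeal A) (b : B) :
    b ∈ TwoSidedIdeal.map π H ↔ ∃ a ∈ H, π a = b := by
  let K : TwoSidedIdeal B := .mk' {b | ∃ a ∈ H, π a = b} ⟨0, H.zero_mem, map_zero _⟩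
    (by rintro _ _ ⟨a, ha, rfl⟩ ⟨b, hb, rfl⟩; exact ⟨a + b, H.add_mem ha hb, map_add _ _ _⟩)
    (by rintro _ ⟨a, ha, rfl⟩; exact ⟨-a, H.neg_mem ha, map_neg _ _⟩)
    (by
      rintro x _ ⟨a, ha, rfl⟩
      obtain ⟨c, rfl⟩ := hπ x
      exact ⟨c * a, H.mul_mem_left _ _ ha, map_mul _ _ _⟩)
    (by
      rintro _ x ⟨a, ha, rfl⟩
      obtain ⟨c, rfl⟩ := hπ x
      exact ⟨a * c, H.mul_mem_right _ _ ha, map_mul _ _ _⟩)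
  constructor
  · intro h
    have : TwoSidedIdeal.map π H ≤ K := TwoSidedIdeal.span_le.2 (by
      rintro _ ⟨a, ha, rfl⟩
      rw [SetLike.mem_coe, TwoSidedIdeal.mem_mk']
      exact ⟨a, ha, rfl⟩)
    simpa [K] using this h
  · rintro ⟨a, ha, rfl⟩
    exact TwoSidedIdeal.subset_span ⟨a, ha, rfl⟩

theorem mem_quotIdeal_iff (H H' : TwoSidedIdeal A) (b : H'.ringCon.Quotient) :
    b ∈ quotIdeal H H' ↔ ∃ a ∈ H, H'.ringCon.mk' a = b :=
  mem_map_iff_of_surjective _ (RingCon.mk'_surjective _) H b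

theorem ringCon_mk'_eq_zero (H' : TwoSidedIdeal A) (a : A) :
    a ∈ H' ↔ H'.ringCon.mk' a = 0 := by
  rw [TwoSidedIdeal.mem_iff]
  exact (RingCon.eq H'.ringCon).symm

theorem relProj_quotIdeal_iff {H H' : TwoSidedIdeal A} (hle : H' ≤ H) :
    RelProj (quotIdeal H H') ⊥ ↔ RelProj H H' :=
  relProj_map_iff H'.ringCon.mk' (RingCon.mk'_surjective _) (ringCon_mk'_eq_zero H') hle
    (mem_quotIdeal_iff H H')

end RelativeProjectivity

/-! ### The Jacobson radical of `A/H'`, expressed in `A`. -/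

section Radical

variable {A : Type*} [Ring A]

theorem mem_jacobson_iff_forall_isUnit (r : A) :
    r ∈ Ring.jacobson A ↔ ∀ a b, IsUnit (1 - a * r * b) := by
  have hleft : ∀ t ∈ Ring.jacobson A, ∃ z, z * (1 - t) = 1 := by
    intro t ht
    rw [← Ideal.jacobson_bot, Ideal.mem_jacobson_iff] at ht
    obtain ⟨z, hz⟩ := ht (-1)
    refine ⟨z, ?_⟩
    rw [Ideal.mem_bot, sub_eq_zero] at hz
    rw [mul_sub, mul_one, ← hz, mul_neg_one, neg_mul, sub_eq_neg_add]
  constructor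
  · intro hr a b
    have ht : a * r * b ∈ Ring.jacobson A :=
      Ideal.mul_mem_right _ _ (Ideal.mul_mem_left _ _ hr)
    generalize a * r * b = t at ht
    obtain ⟨z, hz⟩ := hleft t ht
    -- The left inverse satisfies `z = 1 + z * t`, so it has a left inverse itself and is therefore
    -- a two-sided inverse.
    obtain ⟨w, hw⟩ := hleft (-(z * t)) (neg_mem (Ideal.mul_mem_left _ _ ht))
    have hz' : 1 - -(z * t) = z := by
      rw [← hz]
      noncomm_ring
    rw [hz'] at hw
    have h1 : w = 1 - t := left_inv_eq_right_inv hw hz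
    exact ⟨⟨1 - t, z, by rw [← h1, hw], hz⟩, rfl⟩
  · intro h
    rw [← Ideal.jacobson_bot, Ideal.mem_jacobson_iff]
    intro y
    obtain ⟨⟨x, z, h1, h2⟩, rfl : x = _⟩ := h (-y) 1
    refine ⟨z, ?_⟩
    rw [Ideal.mem_bot, sub_eq_zero, ← h2]
    noncomm_ring

theorem relRad_iff (H' : TwoSidedIdeal A) (r : A) :
    RelRad H' r ↔ H'.ringCon.mk' r ∈ Ring.jacobson H'.ringCon.Quotient := by
  have hs := RingCon.mk'_surjective H'.ringCon
  rw [mem_jacobson_iff_forall_isUnit]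
  simp only [RelRad, ringCon_mk'_eq_zero, map_sub, map_mul, map_one, sub_eq_zero]
  constructor
  · intro h a b
    obtain ⟨a, rfl⟩ := hs a
    obtain ⟨b, rfl⟩ := hs b
    obtain ⟨u, h1, h2⟩ := h a b
    exact ⟨⟨_, _, h2, h1⟩, rfl⟩
  · intro h a b
    obtain ⟨⟨x, y, h1, h2⟩, rfl : x = _⟩ := h (H'.ringCon.mk' a) (H'.ringCon.mk' b)
    obtain ⟨u, rfl⟩ := hs y
    exact ⟨u, h2, h1⟩

theorem relJac_iff (H H' : TwoSidedIdeal A) :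
    RelJac H H' ↔ MulJacobsonMulEqZero (quotIdeal H H') := by
  constructor
  · intro h x hx r hr y hy
    obtain ⟨x, hx', rfl⟩ := (mem_quotIdeal_iff H H' _).1 hx
    obtain ⟨y, hy', rfl⟩ := (mem_quotIdeal_iff H H' _).1 hy
    obtain ⟨r, rfl⟩ := RingCon.mk'_surjective H'.ringCon r
    rw [← map_mul, ← map_mul, ← ringCon_mk'_eq_zero]
    exact h x hx' y hy' r ((relRad_iff H' r).2 hr)
  · intro h x hx y hy r hr
    rw [ringCon_mk'_eq_zero, map_mul, map_mul]
    exact h (H'.ringCon.mk' x) ((mem_quotIdeal_iff H H' _).2 ⟨x, hx, rfl⟩) _ ((relRad_iff H' r).1 hr) _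
      ((mem_quotIdeal_iff H H' _).2 ⟨y, hy, rfl⟩)

theorem RelRad.op {H' : TwoSidedIdeal A} {r : A} (h : RelRad H' r) :
    RelRad H'.op (MulOpposite.op r) := by
  intro a b
  obtain ⟨u, h1, h2⟩ := h b.unop a.unop
  exact ⟨MulOpposite.op u, by simpa [mul_assoc] using h2, by simpa [mul_assoc] using h1⟩

theorem RelRad.unop {H' : TwoSidedIdeal A} {r : Aᵐᵒᵖ} (h : RelRad H'.op r) :
    RelRad H' r.unop := by
  intro a b
  obtain ⟨u, h1, h2⟩ := h (MulOpposite.op b) (MulOpposite.op a)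
  exact ⟨u.unop, by simpa [mul_assoc] using h2, by simpa [mul_assoc] using h1⟩

theorem relJac_op_iff {H H' : TwoSidedIdeal A} : RelJac H.op H'.op ↔ RelJac H H' := by
  constructor
  · intro h x hx y hy r hr
    have := h (.op y) (by simpa using hy) (.op x) (by simpa using hx) _ hr.op
    simpa [mul_assoc] using this
  · intro h x hx y hy r hr
    have := h y.unop (by simpa using hy) x.unop (by simpa using hx) _ hr.unop
    simpa [mul_assoc] using this

end Radical

/-! ### Idempotent ideals. -/

section Idempotent

variable {A : Type*} [Ring A]

/-- The set of products of two elements of `H` absorbs multiplication from either side, so the ideal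
that it generates is just its additive closure. -/
theorem IsIdempotentIdeal.mem_closure {H : TwoSidedIdeal A} (hH : IsIdempotentIdeal H) {h : A}
    (hh : h ∈ H) : h ∈ AddSubgroup.closure {z : A | ∃ x ∈ H, ∃ y ∈ H, x * y = z} := by
  unfold IsIdempotentIdeal at hH
  rw [← hH, TwoSidedIdeal.mem_span_iff_mem_addSubgroup_closure_absorbing] at hh
  · exact hh
  · rintro a _ ⟨x, hx, y, hy, rfl⟩
    exact ⟨a * x, H.mul_mem_left _ _ hx, y, hy, mul_assoc _ _ _⟩
  · rintro _ a ⟨x, hx, y, hy, rfl⟩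
    exact ⟨x, hx, y * a, H.mul_mem_right _ _ hy, (mul_assoc _ _ _).symm⟩

theorem isIdempotentIdeal_of_le {H : TwoSidedIdeal A}
    (h : ∀ x ∈ H, x ∈ AddSubgroup.closure {z : A | ∃ x ∈ H, ∃ y ∈ H, x * y = z}) :
    IsIdempotentIdeal H := by
  apply le_antisymm
  · apply TwoSidedIdeal.span_le.2
    rintro _ ⟨x, hx, y, hy, rfl⟩
    exact H.mul_mem_left _ _ hy
  · intro x hx
    have : AddSubgroup.closure {z : A | ∃ x ∈ H, ∃ y ∈ H, x * y = z} ≤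
        (TwoSidedIdeal.span {z : A | ∃ x ∈ H, ∃ y ∈ H, x * y = z}).asIdeal.toAddSubgroup :=
      (AddSubgroup.closure_le _).2 fun z hz => TwoSidedIdeal.subset_span hz
    exact this (h x hx)

theorem IsIdempotentIdeal.quot {H : TwoSidedIdeal A} (hH : IsIdempotentIdeal H)
    (H' : TwoSidedIdeal A) : IsIdempotentIdeal (quotIdeal H H') := by
  apply isIdempotentIdeal_of_le
  intro x hx
  obtain ⟨a, ha, rfl⟩ := (mem_quotIdeal_iff H H' _).1 hx
  have h1 := AddSubgroup.mem_map_of_mem H'.ringCon.mk'.toAddMonoidHom (hH.mem_closure ha)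
  rw [AddMonoidHom.map_closure] at h1
  refine AddSubgroup.closure_mono ?_ h1
  rintro _ ⟨_, ⟨x, hx, y, hy, rfl⟩, rfl⟩
  exact ⟨_, (mem_quotIdeal_iff H H' _).2 ⟨x, hx, rfl⟩, _,
    (mem_quotIdeal_iff H H' _).2 ⟨y, hy, rfl⟩, (map_mul H'.ringCon.mk' _ _).symm⟩

theorem isIdempotentIdeal_op_iff {H : TwoSidedIdeal A} :
    IsIdempotentIdeal H.op ↔ IsIdempotentIdeal H := by
  constructor
  · intro hH
    apply isIdempotentIdeal_of_le
    intro x hx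
    have h1 := AddSubgroup.mem_map_of_mem (MulOpposite.opAddEquiv (α := A)).symm.toAddMonoidHom
      (hH.mem_closure (h := .op x) (by simpa using hx))
    rw [AddMonoidHom.map_closure] at h1
    refine AddSubgroup.closure_mono ?_ h1
    rintro _ ⟨_, ⟨x, hx, y, hy, rfl⟩, rfl⟩
    exact ⟨y.unop, by simpa using hy, x.unop, by simpa using hx, rfl⟩
  · intro hH
    apply isIdempotentIdeal_of_le
    intro x hx
    have h1 := AddSubgroup.mem_map_of_mem (MulOpposite.opAddEquiv (α := A)).toAddMonoidHom
      (hH.mem_closure (h := x.unop) (by simpa using hx))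
    rw [AddMonoidHom.map_closure] at h1
    refine AddSubgroup.closure_mono ?_ h1
    rintro _ ⟨_, ⟨x, hx, y, hy, rfl⟩, rfl⟩
    exact ⟨.op y, by simpa using hy, .op x, by simpa using hx, rfl⟩

/-- A dual basis of `H` reduces modulo `H'` because `g i (x * y) = g i x * y` lies in `H'` for `x`,
`y` in `H'`, and such products span the idempotent ideal `H'`. -/
theorem RelProj.of_bot {H H' : TwoSidedIdeal A} (h : RelProj H ⊥) (hle : H' ≤ H)
    (hH' : IsIdempotentIdeal H') : RelProj H H' := by
  obtain ⟨k, x, g, hx, hmul, hadd, h0, hsum⟩ := h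
  simp only [TwoSidedIdeal.mem_bot, sub_eq_zero] at hmul hadd hsum h0
  refine ⟨k, x, g, hx, ?_, ?_, ?_, ?_⟩
  · intro i h hh a
    rw [hmul i h hh, sub_self]
    exact H'.zero_mem
  · intro i h hh h₂ hh₂
    rw [hadd i h hh h₂ hh₂, sub_self]
    exact H'.zero_mem
  · intro i h hh
    suffices h ∈ H ∧ g i h ∈ H' from this.2
    refine AddSubgroup.closure_induction (p := fun h _ => h ∈ H ∧ g i h ∈ H') ?_ ?_ ?_ ?_
      (hH'.mem_closure hh)
    · rintro _ ⟨x, hx, y, hy, rfl⟩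
      refine ⟨H.mul_mem_right _ _ (hle hx), ?_⟩
      rw [hmul i x (hle hx)]
      exact H'.mul_mem_left _ _ hy
    · exact ⟨H.zero_mem, by rw [h0 i 0 rfl]; exact H'.zero_mem⟩
    · rintro a b - - ⟨ha, ha'⟩ ⟨hb, hb'⟩
      refine ⟨H.add_mem ha hb, ?_⟩
      rw [hadd i a ha b hb]
      exact H'.add_mem ha' hb'
    · rintro a - ⟨ha, ha'⟩
      refine ⟨H.neg_mem ha, ?_⟩
      rw [← mul_neg_one, hmul i a ha]
      exact H'.mul_mem_right _ _ ha'
  · intro h hh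
    have := hsum h hh
    rw [← this, sub_self]
    exact H'.zero_mem

end Idempotent

/-! ### Idempotent ideals of artinian rings are of the form `AeA`. -/

section IdempotentGenerator

variable {A : Type*} [Ring A]

open scoped Pointwise in
theorem mem_span_singleton_iff_mem_closure {e z : A} :
    z ∈ TwoSidedIdeal.span {e} ↔ z ∈ AddSubgroup.closure {w : A | ∃ a b, a * e * b = w} := by
  rw [TwoSidedIdeal.mem_span_iff_mem_addSubgroup_closure]
  have : (Set.univ : Set A) * {e} * Set.univ = {w : A | ∃ a b, a * e * b = w} := by
    ext w
    simp [Set.mem_mul]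
  rw [this]

theorem mem_span_singleton_iff_exists_sum {e z : A} :
    z ∈ TwoSidedIdeal.span {e} ↔
      ∃ (k : ℕ) (u v : Fin k → A), z = ∑ i, u i * e * v i := by
  constructor
  · intro hz
    rw [mem_span_singleton_iff_mem_closure] at hz
    induction hz using AddSubgroup.closure_induction with
    | mem x hx =>
      obtain ⟨a, b, rfl⟩ := hx
      exact ⟨1, fun _ => a, fun _ => b, by simp⟩
    | zero => exact ⟨0, Fin.elim0, Fin.elim0, by simp⟩
    | add x y _ _ hx hy =>
      obtain ⟨k, u, v, rfl⟩ := hx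
      obtain ⟨l, u', v', rfl⟩ := hy
      refine ⟨k + l, Fin.append u u', Fin.append v v', ?_⟩
      simp [Fin.sum_univ_add]
    | neg x _ hx =>
      obtain ⟨k, u, v, rfl⟩ := hx
      exact ⟨k, fun i => -u i, v, by simp⟩
  · rintro ⟨k, u, v, rfl⟩
    exact sum_mem fun i _ => TwoSidedIdeal.mul_mem_right _ _ _
      (TwoSidedIdeal.mul_mem_left _ _ _ (TwoSidedIdeal.subset_span rfl))

/-- Jacobson's lemma: if `u` inverts `1 - x * y`, then `1 + y * u * x` inverts `1 - y * x`. -/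
theorem isUnit_one_sub_mul_swap {x y : A} (h : IsUnit (1 - x * y)) : IsUnit (1 - y * x) := by
  obtain ⟨⟨a, u, h1, h2⟩, rfl : a = _⟩ := h
  refine ⟨⟨1 - y * x, 1 + y * u * x, ?_, ?_⟩, rfl⟩
  · calc (1 - y * x) * (1 + y * u * x) = 1 - y * x + y * ((1 - x * y) * u) * x := by noncomm_ring
      _ = 1 := by rw [h1]; noncomm_ring
  · calc (1 + y * u * x) * (1 - y * x) = 1 - y * x + y * (u * (1 - x * y)) * x := by noncomm_ring
      _ = 1 := by rw [h2]; noncomm_ring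

theorem relRad_bot_iff {r : A} : RelRad ⊥ r ↔ ∀ a b, IsUnit (1 - a * r * b) := by
  simp only [RelRad, TwoSidedIdeal.mem_bot, sub_eq_zero]
  constructor
  · intro h a b
    obtain ⟨u, h1, h2⟩ := h a b
    exact ⟨⟨_, u, h2, h1⟩, rfl⟩
  · intro h a b
    obtain ⟨⟨x, u, h1, h2⟩, rfl : x = _⟩ := h a b
    exact ⟨u, h2, h1⟩

/-- An idempotent ideal of an artinian ring is generated by an idempotent. -/
theorem exists_isIdempotentElem_span [IsArtinianRing A] {H : TwoSidedIdeal A}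
    (hH : IsIdempotentIdeal H) : ∃ e, IsIdempotentElem e ∧ H = TwoSidedIdeal.span {e} := by
  have hnil : IsNilpotent (Ring.jacobson A) := IsSemiprimaryRing.isNilpotent
  let f := Ideal.Quotient.mk (Ring.jacobson A)
  have hf : Function.Surjective f := Ideal.Quotient.mk_surjective
  have hfJ : ∀ x, f x = 0 ↔ x ∈ Ring.jacobson A := fun x => Ideal.Quotient.eq_zero_iff_mem
  obtain ⟨N, hN⟩ := hnil
  -- Modulo the radical the ring is semisimple, so the image of `H` has an idempotent generator,
  -- which lifts along the nilpotent radical.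
  obtain ⟨e', he', hspan⟩ := IsSemisimpleRing.ideal_eq_span_idempotent (H.asIdeal.map f)
  have he'mem : e' ∈ H.asIdeal.map f := by
    rw [hspan]
    exact Ideal.mem_span_singleton_self e'
  obtain ⟨h, hh, rfl⟩ := (Ideal.mem_map_iff_of_surjective f hf).1 he'mem
  obtain ⟨e, he, hfe⟩ := exists_isIdempotentElem_eq_of_ker_isNilpotent f
    (by
      intro x hx
      rw [RingHom.mem_ker, hfJ] at hx
      refine ⟨N, ?_⟩
      have := Ideal.pow_mem_pow hx N
      rwa [hN] at this) (f h) ⟨h, rfl⟩ he'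
  -- The lift `e` is only congruent to an element `h` of `H`. But `e * h * e = e * (1 - e * (e - h)
  -- * e)` with a unit as second factor, so `e` is a multiple of `e * h * e`.
  have heH : e ∈ H := by
    have hj : e - h ∈ Ring.jacobson A := by rw [← hfJ, map_sub, hfe, sub_self]
    obtain ⟨⟨a, v, h1, h2⟩, rfl : a = _⟩ := (mem_jacobson_iff_forall_isUnit _).1 hj e e
    have h3 : e * h * e = e * (1 - e * (e - h) * e) := by
      have : e * (e - h) * e = e - e * h * e := by
        rw [mul_sub, sub_mul, he.eq, he.eq]
      rw [this, mul_sub, mul_sub, ← mul_assoc e (e * h) e, ← mul_assoc e e h, he.eq, mul_one]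
      abel
    have h4 : e = e * h * e * v := by rw [h3, mul_assoc, h1, mul_one]
    rw [h4]
    exact H.mul_mem_right _ _ (H.mul_mem_right _ _ (H.mul_mem_left _ _ hh))
  refine ⟨e, he, le_antisymm ?_ (TwoSidedIdeal.span_le.2 (by simpa using heH))⟩
  -- `H` lies in `AeA + J ^ (m + 1)` for all `m`: since `H = H²`, the errors of two factors
  -- multiply, as `(x - s) * (y - s')`. Nilpotence of `J` finishes.
  have key : ∀ m : ℕ, ∀ x ∈ H, ∃ s ∈ TwoSidedIdeal.span {e}, x - s ∈ Ring.jacobson A ^ (m + 1) := by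
    intro m
    induction m with
    | zero =>
      intro x hx
      have : f x ∈ H.asIdeal.map f := Ideal.mem_map_of_mem f hx
      rw [hspan, Ideal.mem_span_singleton'] at this
      obtain ⟨a, ha⟩ := this
      obtain ⟨a, rfl⟩ := hf a
      refine ⟨a * e, TwoSidedIdeal.mul_mem_left _ _ _ (TwoSidedIdeal.subset_span rfl), ?_⟩
      rw [zero_add, Submodule.pow_one, ← hfJ, map_sub, map_mul, hfe, ha, sub_self]
    | succ m ih =>
      intro x hx
      have hc := hH.mem_closure hx
      clear hx
      induction hc using AddSubgroup.closure_induction with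
      | mem z hz =>
        obtain ⟨x, hx, y, hy, rfl⟩ := hz
        obtain ⟨s, hs, hxs⟩ := ih x hx
        obtain ⟨s', hs', hys⟩ := ih y hy
        refine ⟨s * y + (x - s) * s', TwoSidedIdeal.add_mem _ (TwoSidedIdeal.mul_mem_right _ _ _ hs)
          (TwoSidedIdeal.mul_mem_left _ _ _ hs'), ?_⟩
        have : x * y - (s * y + (x - s) * s') = (x - s) * (y - s') := by noncomm_ring
        rw [this, Submodule.pow_succ]
        exact Ideal.mul_mem_mul hxs (Ideal.pow_le_self (Nat.succ_ne_zero m) hys)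
      | zero => exact ⟨0, TwoSidedIdeal.zero_mem _, by simp⟩
      | add x y _ _ hx hy =>
        obtain ⟨s, hs, hxs⟩ := hx
        obtain ⟨s', hs', hys⟩ := hy
        refine ⟨s + s', TwoSidedIdeal.add_mem _ hs hs', ?_⟩
        rw [add_sub_add_comm]
        exact add_mem hxs hys
      | neg x _ hx =>
        obtain ⟨s, hs, hxs⟩ := hx
        refine ⟨-s, TwoSidedIdeal.neg_mem _ hs, ?_⟩
        rw [neg_sub_neg, ← neg_sub]
        exact neg_mem hxs
  intro x hx
  obtain ⟨s, hs, hxs⟩ := key N x hx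
  rw [Submodule.pow_succ, hN, zero_mul] at hxs
  have : x = s := sub_eq_zero.1 hxs
  rwa [this]

end IdempotentGenerator

/-! ### The endomorphism ring `eAe` of `eA`. -/

section EndomorphismRing

variable {A : Type*} [Ring A] {e : A}

theorem mem_rightIdeal_iff (he : IsIdempotentElem e) {a : A} : a ∈ rightIdeal e ↔ e * a = a := by
  rw [rightIdeal, Submodule.mem_span_singleton]
  constructor
  · rintro ⟨b, rfl⟩
    rw [MulOpposite.smul_eq_mul_unop, ← mul_assoc, he.eq]
  · intro h
    exact ⟨MulOpposite.op a, h⟩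

/-- The generator of `eA`. -/
def rightIdealGen (e : A) : rightIdeal e := ⟨e, Submodule.mem_span_singleton_self e⟩

/-- With the next two lemmas this identifies `End(eA)` with `eAe` by `f ↦ f(e)`. -/
theorem end_apply_eq (he : IsIdempotentElem e) (f : Module.End Aᵐᵒᵖ (rightIdeal e))
    (m : rightIdeal e) : (f m : A) = f (rightIdealGen e) * m := by
  have h : m = MulOpposite.op (m : A) • rightIdealGen e :=
    Subtype.ext ((mem_rightIdeal_iff he).1 m.2).symm
  conv_lhs => rw [h, map_smul]
  rfl

theorem mul_end_gen (he : IsIdempotentElem e) (f : Module.End Aᵐᵒᵖ (rightIdeal e)) :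
    e * (f (rightIdealGen e) : A) = f (rightIdealGen e) :=
  (mem_rightIdeal_iff he).1 (f (rightIdealGen e)).2

theorem end_gen_mul (he : IsIdempotentElem e) (f : Module.End Aᵐᵒᵖ (rightIdeal e)) :
    (f (rightIdealGen e) : A) * e = f (rightIdealGen e) :=
  (end_apply_eq he f (rightIdealGen e)).symm

/-- Left multiplication by `c ∈ eA` on `eA`. -/
def mulLeftEnd (he : IsIdempotentElem e) (c : A) (hc : e * c = c) :
    Module.End Aᵐᵒᵖ (rightIdeal e) where
  toFun m := ⟨c * m, (mem_rightIdeal_iff he).2 (by rw [← mul_assoc, hc])⟩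
  map_add' m n := Subtype.ext (mul_add _ _ _)
  map_smul' b m := Subtype.ext (mul_assoc _ _ _).symm

/-- The radical of `eAe` lies in that of `A`. Two swaps by Jacobson's lemma replace `1 - a * c * b`
by `1 - t` with `t` in `eAe`; an inverse `z` of `e - t` in `eAe` gives the inverse `z + (1 - e)` in
`A`. -/
theorem relRad_of_mem_jacobson_end (he : IsIdempotentElem e)
    {f : Module.End Aᵐᵒᵖ (rightIdeal e)} (hf : f ∈ Ring.jacobson (Module.End Aᵐᵒᵖ (rightIdeal e))) :
    RelRad ⊥ (f (rightIdealGen e) : A) := by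
  rw [relRad_bot_iff]
  intro a b
  set c : A := (f (rightIdealGen e)).1
  have hec : e * c = c := mul_end_gen he f
  have hce : c * e = c := end_gen_mul he f
  rw [mul_assoc]
  apply isUnit_one_sub_mul_swap
  rw [← hec, mul_assoc, mul_assoc]
  apply isUnit_one_sub_mul_swap
  set t := c * (b * a) * e with ht
  have het : e * t = t := by rw [ht, ← mul_assoc, ← mul_assoc e c, hec]
  have hte : t * e = t := by rw [ht, mul_assoc, he.eq]
  let L := mulLeftEnd he (e * (b * a) * e) (by rw [mul_assoc e, ← mul_assoc e e, he.eq])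
  obtain ⟨⟨x, g, h1, h2⟩, rfl : x = _⟩ := (mem_jacobson_iff_forall_isUnit f).1 hf 1 L
  rw [one_mul] at h1 h2
  set z : A := (g (rightIdealGen e)).1
  have hez : e * z = z := mul_end_gen he g
  have hze : z * e = z := end_gen_mul he g
  have hfL : ∀ m : rightIdeal e, (((1 - f * L) m : rightIdeal e) : A) = m - t * m := by
    intro m
    have : ((f (L m) : rightIdeal e) : A) = c * (e * (b * a) * e * m) := end_apply_eq he f (L m)
    change (m : A) - (f (L m) : rightIdeal e) = _
    rw [this, ht, ← hce]
    simp only [mul_assoc]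
    rw [← mul_assoc e e, he.eq]
  have h3 : z - t * z = e := by
    have := congrArg (fun q : Module.End Aᵐᵒᵖ (rightIdeal e) => (q (rightIdealGen e) : A)) h1
    exact (hfL (g (rightIdealGen e))).symm.trans this
  have h4 : z - z * t = e := by
    have := congrArg (fun q : Module.End Aᵐᵒᵖ (rightIdeal e) => (q (rightIdealGen e) : A)) h2
    change ((g ((1 - f * L) (rightIdealGen e)) : rightIdeal e) : A) = e at this
    rw [end_apply_eq he, hfL] at this
    change z * (e - t * e) = e at this
    rwa [mul_sub, hze, hte] at this
  refine ⟨⟨1 - t, z + (1 - e), ?_, ?_⟩, rfl⟩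
  · have : (1 - t) * (z + (1 - e)) = (z - t * z) + (1 - e) - (t - t * e) := by noncomm_ring
    rw [this, h3, hte]
    abel
  · have : (z + (1 - e)) * (1 - t) = (z - z * t) + (1 - e) - (t - e * t) := by noncomm_ring
    rw [this, h4, het]
    abel

/-- A radical element `c` of `eAe` satisfies `c = e * c * e ∈ HJH = 0`; and `eAe` embeds in `A` over
`R`, hence is artinian. -/
theorem isSemisimpleRing_end_rightIdeal (R : Type*) [CommRing R] [IsArtinianRing R] [Algebra R A]
    [Module.Finite R A] (he : IsIdempotentElem e) (hJ : RelJac (TwoSidedIdeal.span {e}) ⊥) :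
    IsSemisimpleRing (Module.End Aᵐᵒᵖ (rightIdeal e)) := by
  let ev : Module.End Aᵐᵒᵖ (rightIdeal e) →ₗ[R] A :=
    { toFun := fun f => f (rightIdealGen e)
      map_add' := fun _ _ => rfl
      map_smul' := fun _ _ => rfl }
  have hev : Function.Injective ev := by
    intro f g hfg
    ext m
    rw [end_apply_eq he, end_apply_eq he g]
    exact congrArg (· * (m : A)) hfg
  have : Module.Finite R (Module.End Aᵐᵒᵖ (rightIdeal e)) := Module.Finite.of_injective ev hev
  have : IsArtinianRing (Module.End Aᵐᵒᵖ (rightIdeal e)) := IsArtinianRing.of_finite R (Module.End Aᵐᵒᵖ (rightIdeal e))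
  rw [IsArtinianRing.isSemisimpleRing_iff_jacobson, eq_bot_iff]
  intro f hf
  rw [Submodule.mem_bot]
  apply hev
  have h1 := hJ e (TwoSidedIdeal.subset_span rfl) e (TwoSidedIdeal.subset_span rfl) _
    (relRad_of_mem_jacobson_end he hf)
  rw [mul_end_gen he, end_gen_mul he, TwoSidedIdeal.mem_bot] at h1
  exact h1.trans (map_zero ev).symm

theorem finite_end_rightIdeal (R : Type*) [CommRing R] [IsArtinianRing R] [Algebra R A]
    [Module.Finite R A] :
    Module.Finite (Module.End Aᵐᵒᵖ (rightIdeal e)) (rightIdeal e) := by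
  have : Module.Finite R (rightIdeal e) :=
    Module.Finite.of_injective ((rightIdeal e).subtype.restrictScalars R) Subtype.val_injective
  exact Module.Finite.of_restrictScalars_finite R (Module.End Aᵐᵒᵖ (rightIdeal e)) (rightIdeal e)

/-- A dual basis of `eA` over `eAe`, when `eAe` is semisimple. -/
theorem exists_dualBasis_rightIdeal (R : Type*) [CommRing R] [IsArtinianRing R] [Algebra R A]
    [Module.Finite R A] (he : IsIdempotentElem e) (hJ : RelJac (TwoSidedIdeal.span {e}) ⊥) :
    ∃ (l : ℕ) (y : Fin l → A) (γ : Fin l → A →+ A), (∀ i, e * y i = y i) ∧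
      (∀ i c b, γ i (e * c * e * b) = e * c * e * γ i (e * b)) ∧
      (∀ b, e * b = ∑ i, γ i (e * b) * y i) := by
  have := isSemisimpleRing_end_rightIdeal R he hJ
  have := finite_end_rightIdeal (e := e) R
  obtain ⟨l, f, hf⟩ := Module.Finite.exists_fin' (Module.End Aᵐᵒᵖ (rightIdeal e)) (rightIdeal e)
  have := Module.projective_of_isSemisimpleRing (Module.End Aᵐᵒᵖ (rightIdeal e)) (rightIdeal e)
  obtain ⟨s, hs⟩ := f.exists_rightInverse_of_surjective (LinearMap.range_eq_top.2 hf)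
  let p : A →+ rightIdeal e :=
    { toFun := fun b => ⟨e * b, (mem_rightIdeal_iff he).2 (by rw [← mul_assoc, he.eq])⟩
      map_zero' := Subtype.ext (mul_zero e)
      map_add' := fun a b => Subtype.ext (mul_add e a b) }
  -- A coordinate is an endomorphism of `eA`; its value at `e` is the corresponding element of
  -- `eAe`. Precomposing with `b ↦ e * b` defines `γ i` on all of `A`.
  let γ : Fin l → A →+ A := fun i =>
    { toFun := fun b => (s (p b) i) (rightIdealGen e)
      map_zero' := by
        rw [map_zero, map_zero]
        rfl
      map_add' := fun a b => by
        rw [map_add, map_add]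
        rfl }
  have hp : ∀ b, p (e * b) = p b := fun b => Subtype.ext (by
    change e * (e * b) = e * b
    rw [← mul_assoc, he.eq])
  refine ⟨l, fun i => f (Pi.single i 1), γ, ?_, ?_, ?_⟩
  · intro i
    exact (mem_rightIdeal_iff he).1 (f (Pi.single i 1)).2
  · intro i c b
    let L := mulLeftEnd he (e * c * e) (by rw [mul_assoc e, ← mul_assoc e e, he.eq])
    have h : p (e * c * e * b) = L • p b := Subtype.ext (by
      change e * (e * c * e * b) = e * c * e * (e * b)
      simp only [← mul_assoc, he.eq]
      rw [mul_assoc _ e e, he.eq])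
    change ((s (p (e * c * e * b)) i) (rightIdealGen e) : A) = _ * (s (p (e * b)) i)
      (rightIdealGen e)
    rw [h, map_smul, hp]
    rfl
  · intro b
    have h1 : f (s (p b)) = p b := LinearMap.congr_fun hs _
    rw [pi_eq_sum_univ' (s (p b)), map_sum] at h1
    simp only [map_smul] at h1
    have h2 := congrArg (rightIdeal e).subtype h1
    rw [map_sum] at h2
    refine h2.symm.trans (Finset.sum_congr rfl fun i _ => ?_)
    change ((s (p b) i) (f (Pi.single i 1)) : A) = (s (p (e * b)) i) (rightIdealGen e) * _
    rw [hp]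
    exact end_apply_eq he _ _

end EndomorphismRing

/-! ### Heredity ideals are left-right symmetric. -/

section LeftRight

variable {A : Type*} [Ring A] {e : A}

/-- Behind this is the isomorphism of `Ae ⊗ eA`, over `eAe`, with `AeA`. The dual basis `y`, `γ` of
`eA` over the semisimple ring `eAe` should give the left dual basis `a * e * b ↦ a * e * γ j (e *
b)` of `AeA`; projectivity on the right shows that this is well defined. -/
theorem RelProj.op_of_relJac_bot (R : Type*) [CommRing R] [IsArtinianRing R] [Algebra R A]
    [Module.Finite R A] (he : IsIdempotentElem e)
    (hJ : RelJac (TwoSidedIdeal.span {e}) ⊥) (h : RelProj (TwoSidedIdeal.span {e}) ⊥) :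
    RelProj (TwoSidedIdeal.span {e}).op ⊥ := by
  obtain ⟨k, x, g, hx, hmul, hadd, -, hsum⟩ := h
  simp only [TwoSidedIdeal.mem_bot, sub_eq_zero] at hmul hadd hsum
  obtain ⟨l, y, γ, hy, hγ, hsumγ⟩ := exists_dualBasis_rightIdeal R he hJ
  choose N u v huv using fun i => mem_span_singleton_iff_exists_sum.1 (hx i)
  let H := TwoSidedIdeal.span {e}
  have heH : ∀ a b, a * e * b ∈ H := fun a b => H.mul_mem_right _ _
    (H.mul_mem_left _ _ (TwoSidedIdeal.subset_span rfl))
  -- The expected map applied to the expansion `h = ∑ x i * g i h`, with each `x i = ∑ u i t * e * v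
  -- i t`. This formula involves no choice depending on `h`.
  let ψ : Fin l → A → A := fun j h =>
    ∑ i, ∑ t, u i t * e * γ j (e * v i t * g i h)
  have hψadd : ∀ j, ∀ h ∈ H, ∀ h' ∈ H, ψ j (h + h') = ψ j h + ψ j h' := by
    intro j h hh h' hh'
    simp only [ψ, hadd _ h hh h' hh', mul_add, map_add, Finset.sum_add_distrib]
  -- Since `g i (a * e)` ends in `e`, the factor in front of `b` lies in `eAe`, and `γ j` is left
  -- linear over `eAe`; the expansion of `a * e` then reassembles.
  have hψ : ∀ j a b, ψ j (a * e * b) = a * e * γ j (e * b) := by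
    intro j a b
    have hae : a * e ∈ H := by simpa using heH a 1
    have h1 : ∀ i t, u i t * e * γ j (e * v i t * g i (a * e * b)) =
        u i t * e * v i t * g i (a * e) * γ j (e * b) := by
      intro i t
      have h2 : g i (a * e) = g i (a * e) * e := by
        rw [← hmul i _ hae, mul_assoc, he.eq]
      have h3 : e * v i t * g i (a * e * b) = e * (v i t * g i (a * e)) * e * b := by
        rw [hmul i _ hae, mul_assoc e (v i t), mul_assoc e _ e, mul_assoc (v i t) _ e, ← h2]
        simp only [mul_assoc]
      rw [h3, hγ]
      have h4 : e * (v i t * g i (a * e)) * e = e * (v i t * g i (a * e)) := by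
        rw [mul_assoc e, mul_assoc (v i t), ← h2]
      rw [h4, mul_assoc (u i t), ← mul_assoc e (e * _), ← mul_assoc e e, he.eq]
      simp only [mul_assoc]
    simp only [ψ, h1, ← Finset.sum_mul, ← huv]
    rw [← hsum _ hae]
  -- `ψ j` is known to be additive on `H` only, so the induction over sums also records membership
  -- of the partial sums in `H`.
  have hind : ∀ (p : A → Prop), (∀ a b, p (a * e * b)) → p 0 →
      (∀ x ∈ H, ∀ y ∈ H, p x → p y → p (x + y)) → ∀ h ∈ H, p h := by
    intro p h1 h0 h2 h hh
    obtain ⟨n, a, b, rfl⟩ := mem_span_singleton_iff_exists_sum.1 hh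
    suffices ∀ s : Finset (Fin n), ∑ i ∈ s, a i * e * b i ∈ H ∧ p (∑ i ∈ s, a i * e * b i) from
      (this _).2
    intro s
    induction s using Finset.cons_induction with
    | empty => exact ⟨H.zero_mem, h0⟩
    | cons i s hi ih =>
      rw [Finset.sum_cons]
      exact ⟨H.add_mem (heH _ _) ih.1, h2 _ (heH _ _) _ ih.1 (h1 _ _) ih.2⟩
  have hψ0 : ∀ j, ψ j 0 = 0 := by
    intro j
    simpa using hψ j 0 0
  have hψmul : ∀ j c, ∀ h ∈ H, ψ j (c * h) = c * ψ j h := by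
    intro j c
    apply hind
    · intro a b
      rw [hψ, ← mul_assoc, ← mul_assoc, hψ]
      simp only [mul_assoc]
    · rw [mul_zero, hψ0, mul_zero]
    · intro x hx y hy h1 h2
      rw [mul_add, hψadd j _ (H.mul_mem_left _ _ hx) _ (H.mul_mem_left _ _ hy), h1, h2,
        hψadd j x hx y hy, mul_add]
  have hψsum : ∀ h ∈ H, h = ∑ j, ψ j h * y j := by
    apply hind
    · intro a b
      simp only [hψ]
      simp only [mul_assoc, ← Finset.mul_sum]
      rw [← hsumγ, ← mul_assoc e e, he.eq]
    · simp [hψ0]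
    · intro x hx y hy h1 h2
      simp only [hψadd _ x hx y hy, add_mul, Finset.sum_add_distrib, ← h1, ← h2]
  refine ⟨l, fun j => .op (y j), fun j h => .op (ψ j h.unop), ?_, ?_, ?_, ?_, ?_⟩
  · intro j
    rw [TwoSidedIdeal.mem_op_iff]
    have := heH 1 (y j)
    rwa [one_mul, hy] at this
  · intro j h hh a
    rw [TwoSidedIdeal.mem_op_iff] at hh
    rw [TwoSidedIdeal.mem_bot, sub_eq_zero]
    exact congrArg MulOpposite.op (hψmul j a.unop h.unop hh)
  · intro j h hh h' hh'
    rw [TwoSidedIdeal.mem_op_iff] at hh hh'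
    rw [TwoSidedIdeal.mem_bot, sub_eq_zero]
    exact congrArg MulOpposite.op (hψadd j h.unop hh h'.unop hh')
  · intro j h hh
    rw [TwoSidedIdeal.mem_bot] at hh ⊢
    subst hh
    exact congrArg MulOpposite.op (hψ0 j)
  · intro h hh
    rw [TwoSidedIdeal.mem_op_iff] at hh
    rw [TwoSidedIdeal.mem_bot, sub_eq_zero]
    have := congrArg MulOpposite.op (hψsum h.unop hh)
    rw [Finset.op_sum] at this
    exact this

/-- The absolute case is applied to `A/H'`, which is again finite over `R` and where the image of
`e` generates the image of `AeA`. -/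
theorem RelProj.op_of_relJac (R : Type*) [CommRing R] [IsArtinianRing R] [Algebra R A]
    [Module.Finite R A] (he : IsIdempotentElem e) {H' : TwoSidedIdeal A}
    (hle : H' ≤ TwoSidedIdeal.span {e})
    (hJ : RelJac (TwoSidedIdeal.span {e}) H') (h : RelProj (TwoSidedIdeal.span {e}) H') :
    RelProj (TwoSidedIdeal.span {e}).op H'.op := by
  let π := H'.ringCon.mk'
  have hπ : Function.Surjective π := RingCon.mk'_surjective _
  have hspan : quotIdeal (TwoSidedIdeal.span {e}) H' = TwoSidedIdeal.span {π e} := by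
    ext b
    rw [mem_quotIdeal_iff, mem_span_singleton_iff_exists_sum]
    constructor
    · rintro ⟨a, ha, rfl⟩
      obtain ⟨k, u, v, rfl⟩ := mem_span_singleton_iff_exists_sum.1 ha
      exact ⟨k, fun i => π (u i), fun i => π (v i), by simp [π]⟩
    · rintro ⟨k, u, v, rfl⟩
      choose σ hσ using hπ
      refine ⟨∑ i, σ (u i) * e * σ (v i),
        mem_span_singleton_iff_exists_sum.2 ⟨k, _, _, rfl⟩, ?_⟩
      change π _ = _
      rw [map_sum]
      exact Finset.sum_congr rfl fun i _ => by rw [map_mul, map_mul, hσ, hσ]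
  have hfin : Module.Finite R H'.ringCon.Quotient :=
    Module.Finite.of_surjective (RingCon.mkₐ R H'.ringCon).toLinearMap hπ
  rw [← relProj_quotIdeal_iff hle, hspan] at h
  have hJ' : RelJac (TwoSidedIdeal.span {π e}) ⊥ := by
    rw [← hspan]
    intro x hx y hy r hr
    rw [TwoSidedIdeal.mem_bot]
    refine (relJac_iff _ _).1 hJ x hx r ?_ y hy
    rw [mem_jacobson_iff_forall_isUnit]
    exact relRad_bot_iff.1 hr
  have := h.op_of_relJac_bot R (he.map π) hJ'
  rw [← hspan] at this
  refine (relProj_map_iff (RingHom.op π) ?_ ?_ ?_ ?_).1 this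
  · intro b
    obtain ⟨a, ha⟩ := hπ b.unop
    exact ⟨.op a, congrArg MulOpposite.op ha⟩
  · intro a
    rw [TwoSidedIdeal.mem_op_iff, ringCon_mk'_eq_zero]
    exact (MulOpposite.op_eq_zero_iff (π a.unop)).symm
  · intro a ha
    rw [TwoSidedIdeal.mem_op_iff] at ha ⊢
    exact hle ha
  · intro b
    rw [TwoSidedIdeal.mem_op_iff, mem_quotIdeal_iff]
    constructor
    · rintro ⟨a, ha, h⟩
      exact ⟨.op a, by simpa using ha, congrArg MulOpposite.op h⟩
    · rintro ⟨a, ha, rfl⟩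
      exact ⟨a.unop, by simpa using ha, rfl⟩

theorem span_singleton_op (e : A) :
    (TwoSidedIdeal.span {e}).op = TwoSidedIdeal.span {MulOpposite.op e} := by
  ext z
  rw [TwoSidedIdeal.mem_op_iff, mem_span_singleton_iff_exists_sum,
    mem_span_singleton_iff_exists_sum]
  constructor
  · rintro ⟨k, u, v, h⟩
    refine ⟨k, fun i => .op (v i), fun i => .op (u i), ?_⟩
    rw [← MulOpposite.op_unop z, h, Finset.op_sum]
    simp [mul_assoc]
  · rintro ⟨k, u, v, rfl⟩
    refine ⟨k, fun i => (v i).unop, fun i => (u i).unop, ?_⟩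
    rw [Finset.unop_sum]
    simp [mul_assoc]

theorem RelProj.of_op_op {H H' : TwoSidedIdeal A} (h : RelProj H.op.op H'.op.op) :
    RelProj H H' := by
  obtain ⟨k, x, g, hx, hmul, hadd, h0, hsum⟩ := h
  simp only [TwoSidedIdeal.mem_op_iff] at hx hmul hadd h0 hsum
  refine ⟨k, fun i => (x i).unop.unop, fun i a => (g i (.op (.op a))).unop.unop, hx,
    fun i h hh a => hmul i (.op (.op h)) hh (.op (.op a)),
    fun i h hh h' hh' => hadd i (.op (.op h)) hh (.op (.op h')) hh',
    fun i h hh => h0 i (.op (.op h)) hh, fun h hh => ?_⟩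
  have := hsum (.op (.op h)) hh
  simpa using this

theorem RelProj.of_op_of_relJac (R : Type*) [CommRing R] [IsArtinianRing R] [Algebra R A]
    [Module.Finite R A] (he : IsIdempotentElem e) {H' : TwoSidedIdeal A}
    (hle : H' ≤ TwoSidedIdeal.span {e}) (hJ : RelJac (TwoSidedIdeal.span {e}) H')
    (h : RelProj (TwoSidedIdeal.span {e}).op H'.op) :
    RelProj (TwoSidedIdeal.span {e}) H' := by
  apply RelProj.of_op_op
  rw [← relJac_op_iff] at hJ
  rw [span_singleton_op] at h hJ ⊢
  refine h.op_of_relJac R (congrArg MulOpposite.op he) ?_ hJ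
  rw [← span_singleton_op]
  intro z hz
  rw [TwoSidedIdeal.mem_op_iff] at hz ⊢
  exact hle hz

/-- Right modules over `Aᵐᵒᵖ` are modules over `Aᵐᵒᵖᵐᵒᵖ`, so projectivity is compared along an
equivalence semilinear over `A ≃ Aᵐᵒᵖᵐᵒᵖ`. -/
theorem relProj_op_bot_iff [IsNoetherianRing A] {H : TwoSidedIdeal A} :
    RelProj H.op ⊥ ↔ Module.Projective A H := by
  have := isNoetherianRing_of_ringEquiv A (RingEquiv.opOp A)
  rw [relProj_bot_iff]
  let f : A →+* Aᵐᵒᵖᵐᵒᵖ := RingEquiv.opOp A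
  let f' : Aᵐᵒᵖᵐᵒᵖ →+* A := (RingEquiv.opOp A).symm
  have : RingHomInvPair f f' := ⟨RingHom.ext fun _ => rfl, RingHom.ext fun _ => rfl⟩
  have : RingHomInvPair f' f := ⟨RingHom.ext fun _ => rfl, RingHom.ext fun _ => rfl⟩
  let φ : H ≃ₛₗ[f] H.op :=
    { toFun := fun h => ⟨.op h, by simp⟩
      invFun := fun h => ⟨h.1.unop, TwoSidedIdeal.mem_op_iff.1 h.2⟩
      map_add' := fun _ _ => rfl
      map_smul' := fun _ _ => rfl
      left_inv := fun _ => rfl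
      right_inv := fun _ => rfl }
  exact ⟨fun h => Module.Projective.of_equiv φ.symm, fun h => Module.Projective.of_equiv φ⟩

end LeftRight

/-! ### Rejective, coreflective and cosemisimple subcategories in terms of approximations. -/

section Elementary

variable {𝒞 : Type w} [Category.{v} 𝒞] [Preadditive 𝒞]

/-- `f` factors through an object of `P`. -/
def Factors (P : ObjectProperty 𝒞) {X Y : 𝒞} (f : X ⟶ Y) : Prop :=
  ∃ Z, P Z ∧ ∃ (g : X ⟶ Z) (h : Z ⟶ Y), g ≫ h = f

/-- Every object of `Q` has a right `P`-approximation which is monic in `Q`. -/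
def RightRejectiveIn (P Q : ObjectProperty 𝒞) : Prop :=
  ∀ X, Q X → ∃ Z, P Z ∧ ∃ g : Z ⟶ X, (∀ W, P W → ∀ h : W ⟶ X, ∃ h', h' ≫ g = h) ∧
    ∀ W, Q W → ∀ w : W ⟶ Z, w ≫ g = 0 → w = 0

/-- Every object of `Q` has a left `P`-approximation which is epic in `Q`. -/
def LeftRejectiveIn (P Q : ObjectProperty 𝒞) : Prop :=
  ∀ X, Q X → ∃ Z, P Z ∧ ∃ g : X ⟶ Z, (∀ W, P W → ∀ h : X ⟶ W, ∃ h', g ≫ h' = h) ∧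
    ∀ W, Q W → ∀ w : Z ⟶ W, g ≫ w = 0 → w = 0

/-- Every object of `Q` has a coreflection in `P`. -/
def CoreflectiveIn (P Q : ObjectProperty 𝒞) : Prop :=
  ∀ X, Q X → ∃ Z, P Z ∧ ∃ g : Z ⟶ X, ∀ W, P W → ∀ h : W ⟶ X, ∃! h', h' ≫ g = h

/-- Every object of `Q` has a reflection in `P`. -/
def ReflectiveIn (P Q : ObjectProperty 𝒞) : Prop :=
  ∀ X, Q X → ∃ Z, P Z ∧ ∃ g : X ⟶ Z, ∀ W, P W → ∀ h : X ⟶ W, ∃! h', g ≫ h' = h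

/-- The radical of `Q/[P]` vanishes. -/
def CosemisimpleIn (P Q : ObjectProperty 𝒞) : Prop :=
  ∀ X Y, Q X → Q Y → ∀ f : X ⟶ Y,
    (∀ g : Y ⟶ X, ∃ u : X ⟶ X, Factors P (u ≫ (𝟙 X - f ≫ g) - 𝟙 X) ∧
      Factors P ((𝟙 X - f ≫ g) ≫ u - 𝟙 X)) → Factors P f

theorem RightRejectiveIn.mono {P Q Q' : ObjectProperty 𝒞} (h : RightRejectiveIn P Q)
    (hle : Q' ≤ Q) : RightRejectiveIn P Q' := by
  intro X hX
  obtain ⟨Z, hZ, g, h1, h2⟩ := h X (hle X hX)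
  exact ⟨Z, hZ, g, h1, fun W hW => h2 W (hle W hW)⟩

theorem RightRejectiveIn.coreflectiveIn {P Q : ObjectProperty 𝒞} (h : RightRejectiveIn P Q)
    (hle : P ≤ Q) : CoreflectiveIn P Q := by
  intro X hX
  obtain ⟨Z, hZ, g, h1, h2⟩ := h X hX
  refine ⟨Z, hZ, g, fun W hW k => ?_⟩
  obtain ⟨h', hh'⟩ := h1 W hW k
  refine ⟨h', hh', fun y hy => ?_⟩
  rw [← sub_eq_zero]
  exact h2 W (hle W hW) _ (by rw [Preadditive.sub_comp, hy, hh', sub_self])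

omit [Preadditive 𝒞] in
theorem CoreflectiveIn.trans {P Q Q' : ObjectProperty 𝒞} (h : CoreflectiveIn P Q)
    (h' : CoreflectiveIn Q Q') (hle : P ≤ Q) : CoreflectiveIn P Q' := by
  intro X hX
  obtain ⟨Y, hY, g, hg⟩ := h' X hX
  obtain ⟨Z, hZ, k, hk⟩ := h Y hY
  refine ⟨Z, hZ, k ≫ g, fun W hW a => ?_⟩
  obtain ⟨b, hb, hb'⟩ := hg W (hle W hW) a
  obtain ⟨c, hc, hc'⟩ := hk W hW b
  refine ⟨c, ?_, fun y hy => hc' y (hb' _ ?_)⟩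
  · change c ≫ k ≫ g = a
    rw [← Category.assoc, hc, hb]
  · simpa using hy

/-- The approximation `k` is monic only against objects of `Q`. A test morphism `w` from `W` in `Q'`
is replaced by one from the left `Q`-approximation of `W`, which is epic; this is where left
rejectivity of `Q` enters. -/
theorem RightRejectiveIn.trans {P Q Q' : ObjectProperty 𝒞} (h : RightRejectiveIn P Q)
    (h' : RightRejectiveIn Q Q') (hl : LeftRejectiveIn Q Q') (hPQ : P ≤ Q)
    (hQ : Q ≤ Q') : RightRejectiveIn P Q' := by
  intro X hX
  obtain ⟨Y, hY, g, hg, hg'⟩ := h' X hX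
  obtain ⟨Z, hZ, k, hk, hk'⟩ := h Y hY
  refine ⟨Z, hZ, k ≫ g, fun W hW a => ?_, fun W hW w hw => ?_⟩
  · obtain ⟨b, hb⟩ := hg W (hPQ W hW) a
    obtain ⟨c, hc⟩ := hk W hW b
    exact ⟨c, by rw [← Category.assoc, hc, hb]⟩
  · have h1 : w ≫ k = 0 := hg' W hW _ (by rw [Category.assoc, hw])
    obtain ⟨V, hV, r, hr, hr'⟩ := hl W hW
    obtain ⟨w', rfl⟩ := hr Z (hPQ Z hZ) w
    have h2 : w' ≫ k = 0 := hr' Y (hQ Y hY) _ (by rw [← Category.assoc, h1])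
    rw [hk' V hV w' h2, comp_zero]

end Elementary

/-! ### Categories with a projective generator: subcategories versus ideals of `A`. -/

section ProjGenerator

/-- `𝒞` is the idempotent completion of the category of free modules of finite rank over the
endomorphism ring `A` of an object `T`. -/
structure ProjGenerator (A : Type u) [Ring A] (𝒞 : Type w) [Category.{v} 𝒞] [Preadditive 𝒞] where
  /-- The generator. -/
  T : 𝒞
  /-- The identification of `A` with the endomorphisms of the generator. -/
  θ : A ≃+ (T ⟶ T)
  θ_mul : ∀ a b, θ (a * b) = θ b ≫ θ a
  gen : ∀ X, ∃ (k : ℕ) (p : Fin k → (X ⟶ T)) (q : Fin k → (T ⟶ X)), ∑ i, p i ≫ q i = 𝟙 X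
  split : ∀ (ι : Type) [Fintype ι] (E : ι → ι → (T ⟶ T)),
    (∀ i j, ∑ l, E i l ≫ E l j = E i j) →
    ∃ (Z : 𝒞) (p : ι → (Z ⟶ T)) (q : ι → (T ⟶ Z)),
      ∑ i, p i ≫ q i = 𝟙 Z ∧ ∀ i j, q i ≫ p j = E i j

namespace ProjGenerator

variable {A : Type u} [Ring A] {𝒞 : Type w} [Category.{v} 𝒞] [Preadditive 𝒞]
  (G : ProjGenerator A 𝒞)

theorem symm_comp (f g : G.T ⟶ G.T) : G.θ.symm (f ≫ g) = G.θ.symm g * G.θ.symm f := by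
  rw [AddEquiv.symm_apply_eq, G.θ_mul, AddEquiv.apply_symm_apply, AddEquiv.apply_symm_apply]

theorem θ_one : G.θ 1 = 𝟙 G.T := by
  have h : G.θ (G.θ.symm (𝟙 G.T) * 1) = G.θ 1 ≫ 𝟙 _ := by
    rw [G.θ_mul, AddEquiv.apply_symm_apply]
  rw [mul_one, AddEquiv.apply_symm_apply, Category.comp_id] at h
  exact h.symm

/-- The ideal of `𝒞` which corresponds to an ideal of `A`. -/
def ideal (H : TwoSidedIdeal A) (X Y : 𝒞) : AddSubgroup (X ⟶ Y) where
  carrier := {f | ∀ (q : G.T ⟶ X) (p : Y ⟶ G.T), G.θ.symm (q ≫ f ≫ p) ∈ H}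
  zero_mem' q p := by simp [H.zero_mem]
  add_mem' {f g} hf hg q p := by
    rw [Preadditive.add_comp, Preadditive.comp_add, map_add]
    exact H.add_mem (hf q p) (hg q p)
  neg_mem' {f} hf q p := by
    rw [Preadditive.neg_comp, Preadditive.comp_neg, map_neg]
    exact H.neg_mem (hf q p)

variable {G} {H H' : TwoSidedIdeal A} {X Y Z : 𝒞}

theorem comp_mem_ideal_left {f : X ⟶ Y} (hf : f ∈ G.ideal H X Y) (g : Z ⟶ X) :
    g ≫ f ∈ G.ideal H Z Y := by
  intro q p
  have := hf (q ≫ g) p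
  simpa using this

theorem comp_mem_ideal_right {f : X ⟶ Y} (hf : f ∈ G.ideal H X Y) (g : Y ⟶ Z) :
    f ≫ g ∈ G.ideal H X Z := by
  intro q p
  have := hf q (g ≫ p)
  simpa using this

theorem mem_ideal_self {f : G.T ⟶ G.T} : f ∈ G.ideal H G.T G.T ↔ G.θ.symm f ∈ H := by
  constructor
  · intro h
    simpa using h (𝟙 _) (𝟙 _)
  · intro h q p
    rw [symm_comp, symm_comp]
    exact H.mul_mem_right _ _ (H.mul_mem_left _ _ h)

theorem θ_mem_ideal {a : A} : G.θ a ∈ G.ideal H G.T G.T ↔ a ∈ H := by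
  rw [mem_ideal_self, AddEquiv.symm_apply_apply]

theorem ideal_mono (h : H ≤ H') : G.ideal H X Y ≤ G.ideal H' X Y :=
  fun _ hf q p => h (hf q p)

theorem eq_zero_of_forall (G : ProjGenerator A 𝒞) {f : X ⟶ Y} (h : ∀ q : G.T ⟶ X, q ≫ f = 0) :
    f = 0 := by
  obtain ⟨k, p, q, hpq⟩ := G.gen X
  rw [← Category.id_comp f, ← hpq, Preadditive.sum_comp]
  exact Finset.sum_eq_zero fun i _ => by rw [Category.assoc, h, comp_zero]

theorem mem_ideal_bot {f : X ⟶ Y} : f ∈ G.ideal ⊥ X Y ↔ f = 0 := by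
  constructor
  · intro h
    obtain ⟨l, p', q', hpq'⟩ := G.gen Y
    refine eq_zero_of_forall G fun q => ?_
    rw [← Category.comp_id (q ≫ f), ← hpq', Preadditive.comp_sum]
    refine Finset.sum_eq_zero fun i _ => ?_
    have := h q (p' i)
    rw [TwoSidedIdeal.mem_bot, EmbeddingLike.map_eq_zero_iff] at this
    rw [← Category.assoc, Category.assoc q, this, zero_comp]
  · rintro rfl
    exact AddSubgroup.zero_mem _

variable (G) in
/-- `P` consists of the objects whose identity lies in the ideal of `𝒞` given by `H`, and this is
the ideal of the morphisms that factor through `P`. -/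
structure IsAdd (P : ObjectProperty 𝒞) (H : TwoSidedIdeal A) : Prop where
  prop_iff : ∀ X, P X ↔ 𝟙 X ∈ G.ideal H X X
  factors : ∀ {X Y} (f : X ⟶ Y), f ∈ G.ideal H X Y → Factors P f

variable {P P' : ObjectProperty 𝒞}

theorem IsAdd.mem_ideal_of_source (h : G.IsAdd P H) (hX : P X) (f : X ⟶ Y) :
    f ∈ G.ideal H X Y := by
  have := comp_mem_ideal_right ((h.prop_iff X).1 hX) f
  rwa [Category.id_comp] at this

theorem IsAdd.mem_ideal_of_target (h : G.IsAdd P H) (hX : P Y) (f : X ⟶ Y) :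
    f ∈ G.ideal H X Y := by
  have := comp_mem_ideal_left ((h.prop_iff Y).1 hX) f
  rwa [Category.comp_id] at this

theorem IsAdd.factors_iff (h : G.IsAdd P H) {f : X ⟶ Y} :
    Factors P f ↔ f ∈ G.ideal H X Y := by
  refine ⟨?_, h.factors f⟩
  rintro ⟨Z, hZ, a, b, rfl⟩
  exact comp_mem_ideal_left (h.mem_ideal_of_source hZ b) a

theorem IsAdd.mono (h : G.IsAdd P H) (h' : G.IsAdd P' H') (hle : H' ≤ H) : P' ≤ P := by
  intro X hX
  rw [h.prop_iff]
  exact ideal_mono hle ((h'.prop_iff X).1 hX)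

theorem IsAdd.le_of_le (h : G.IsAdd P H) (h' : G.IsAdd P' H') (hle : P' ≤ P) : H' ≤ H := by
  intro a ha
  rw [← θ_mem_ideal (G := G), ← h.factors_iff]
  obtain ⟨Z, hZ, x⟩ := h'.factors _ (θ_mem_ideal.2 ha)
  exact ⟨Z, hle Z hZ, x⟩

/-- Factor an element of `H` through `Z` in `P` and insert `𝟙 Z = ∑ p i ≫ q i`: every summand is a
product of two endomorphisms of the generator that factor through `Z`. -/
theorem IsAdd.isIdempotentIdeal (h : G.IsAdd P H) : IsIdempotentIdeal H := by
  apply isIdempotentIdeal_of_le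
  intro x hx
  obtain ⟨Z, hZ, a, b, hab⟩ := h.factors _ (θ_mem_ideal.2 hx)
  obtain ⟨k, p, q, hpq⟩ := G.gen Z
  have hx' : x = ∑ i, G.θ.symm (q i ≫ b) * G.θ.symm (a ≫ p i) := by
    conv_lhs => rw [← AddEquiv.symm_apply_apply G.θ x, ← hab, ← Category.comp_id a, ← hpq,
      Preadditive.comp_sum, Preadditive.sum_comp, map_sum]
    refine Finset.sum_congr rfl fun i _ => ?_
    rw [← symm_comp]
    simp
  rw [hx']
  exact sum_mem fun i _ => AddSubgroup.subset_closure
    ⟨_, mem_ideal_self.1 (comp_mem_ideal_left (h.mem_ideal_of_source hZ b) _), _,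
      mem_ideal_self.1 (comp_mem_ideal_right (h.mem_ideal_of_target hZ a) _), rfl⟩

/-- Composition with `g` is a bijection from `Hom(T, Z)` onto `H`, and `Hom(T, Z)` has a dual basis
because `Z` is a summand of a power of `T`. Uniqueness of the lifts `L` makes the coordinates
linear. -/
theorem IsAdd.relProj_of_rightApproximation (h : G.IsAdd P H) (hZ : P Z) (g : Z ⟶ G.T)
    (hg : ∀ W, P W → ∀ k : W ⟶ G.T, ∃ k', k' ≫ g = k)
    (hm : ∀ w : G.T ⟶ Z, w ≫ g = 0 → w = 0) : RelProj H ⊥ := by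
  have hlift : ∀ a : A, ∃ k : G.T ⟶ Z, a ∈ H → k ≫ g = G.θ a := by
    intro a
    by_cases ha : a ∈ H
    · obtain ⟨W, hW, c, d, hcd⟩ := h.factors _ (θ_mem_ideal.2 ha)
      obtain ⟨d', rfl⟩ := hg W hW d
      exact ⟨c ≫ d', fun _ => by rw [← hcd, Category.assoc]⟩
    · exact ⟨0, fun h => absurd h ha⟩
  choose L hL using hlift
  have huniq : ∀ w w' : G.T ⟶ Z, w ≫ g = w' ≫ g → w = w' := by
    intro w w' hw
    rw [← sub_eq_zero]
    exact hm _ (by rw [Preadditive.sub_comp, hw, sub_self])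
  obtain ⟨k, p, q, hpq⟩ := G.gen Z
  refine ⟨k, fun i => G.θ.symm (q i ≫ g), fun i a => G.θ.symm (L a ≫ p i), ?_, ?_, ?_, ?_, ?_⟩
  · intro i
    exact mem_ideal_self.1 (comp_mem_ideal_left (h.mem_ideal_of_source hZ g) _)
  · intro i x hx a
    have h1 : L (x * a) = G.θ a ≫ L x := huniq _ _ (by
      rw [hL _ (H.mul_mem_right _ _ hx), Category.assoc, hL _ hx, G.θ_mul])
    beta_reduce
    rw [TwoSidedIdeal.mem_bot, sub_eq_zero, h1, Category.assoc, symm_comp,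
      AddEquiv.symm_apply_apply]
  · intro i x hx y hy
    have h1 : L (x + y) = L x + L y := huniq _ _ (by
      rw [hL _ (H.add_mem hx hy), Preadditive.add_comp, hL _ hx, hL _ hy, map_add])
    beta_reduce
    rw [TwoSidedIdeal.mem_bot, sub_eq_zero, h1, Preadditive.add_comp, map_add]
  · intro i x hx
    rw [TwoSidedIdeal.mem_bot] at hx ⊢
    subst hx
    have h1 : L 0 = 0 := hm _ (by rw [hL _ H.zero_mem, map_zero])
    beta_reduce
    rw [h1, zero_comp, map_zero]
  · intro x hx
    rw [TwoSidedIdeal.mem_bot, sub_eq_zero]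
    have h1 : G.θ x = ∑ i, (L x ≫ p i) ≫ (q i ≫ g) := by
      rw [← hL x hx]
      conv_lhs => rw [← Category.comp_id (L x), ← hpq, Preadditive.comp_sum, Preadditive.sum_comp]
      exact Finset.sum_congr rfl fun i _ => by simp
    have h2 := congrArg G.θ.symm h1
    rw [AddEquiv.symm_apply_apply, map_sum] at h2
    simpa only [symm_comp] using h2

/-- This puts the entries of the idempotent matrix of the dual basis into `H`, so that the object
split off by the matrix belongs to `P`. -/
theorem RelProj.map_mem {k : ℕ} {g : Fin k → A → A} (hidem : IsIdempotentIdeal H)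
    (hmul : ∀ i, ∀ h ∈ H, ∀ a, g i (h * a) = g i h * a)
    (hadd : ∀ i, ∀ h ∈ H, ∀ h₂ ∈ H, g i (h + h₂) = g i h + g i h₂) (i : Fin k) {h : A}
    (hh : h ∈ H) : g i h ∈ H := by
  suffices h ∈ H ∧ g i h ∈ H from this.2
  refine AddSubgroup.closure_induction (p := fun h _ => h ∈ H ∧ g i h ∈ H) ?_ ?_ ?_ ?_
    (hidem.mem_closure hh)
  · rintro _ ⟨x, hx, y, hy, rfl⟩
    refine ⟨H.mul_mem_right _ _ hx, ?_⟩
    rw [hmul i x hx]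
    exact H.mul_mem_left _ _ hy
  · refine ⟨H.zero_mem, ?_⟩
    rw [← mul_zero (0 : A), hmul i 0 H.zero_mem, mul_zero]
    exact H.zero_mem
  · rintro a b - - ⟨ha, ha'⟩ ⟨hb, hb'⟩
    refine ⟨H.add_mem ha hb, ?_⟩
    rw [hadd i a ha b hb]
    exact H.add_mem ha' hb'
  · rintro a - ⟨ha, ha'⟩
    refine ⟨H.neg_mem ha, ?_⟩
    rw [← mul_neg_one, hmul i a ha]
    exact H.mul_mem_right _ _ ha'

/-- The morphisms `T ⟶ X` in the ideal of `H` have a dual basis `x'`, `F` induced by that of `H`.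
The matrix `F j (x' i)` is idempotent; the object `Z` that splits it represents the submodule `HX`
of `X`, and `g` is its inclusion. -/
theorem IsAdd.rightRejectiveIn_top (h : G.IsAdd P H) (hp : RelProj H ⊥) :
    RightRejectiveIn P ⊤ := by
  intro X _
  obtain ⟨k, x, f, hx, hmul, hadd, -, hsum⟩ := hp
  simp only [TwoSidedIdeal.mem_bot, sub_eq_zero] at hmul hadd hsum
  have hfH := fun i {a} => RelProj.map_mem h.isIdempotentIdeal hmul hadd i (h := a)
  obtain ⟨m, PX, QX, hPQ⟩ := G.gen X
  let F : Fin k × Fin m → (G.T ⟶ X) → (G.T ⟶ G.T) := fun j t =>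
    G.θ (f j.1 (G.θ.symm (t ≫ PX j.2)))
  let x' : Fin k × Fin m → (G.T ⟶ X) := fun j => G.θ (x j.1) ≫ QX j.2
  have hmem : ∀ {t : G.T ⟶ X}, t ∈ G.ideal H G.T X → ∀ s, G.θ.symm (t ≫ PX s) ∈ H :=
    fun ht s => mem_ideal_self.1 (comp_mem_ideal_right ht _)
  have hx' : ∀ j, x' j ∈ G.ideal H G.T X := fun j =>
    comp_mem_ideal_right (θ_mem_ideal.2 (hx _)) _
  have hFx : ∀ t ∈ G.ideal H G.T X, ∑ j, F j t ≫ x' j = t := by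
    intro t ht
    rw [Fintype.sum_prod_type_right]
    conv_rhs => rw [← Category.comp_id t, ← hPQ, Preadditive.comp_sum]
    refine Finset.sum_congr rfl fun s _ => ?_
    simp only [F, x', ← Category.assoc, ← G.θ_mul]
    rw [← Preadditive.sum_comp, ← map_sum, ← hsum _ (hmem ht s), AddEquiv.apply_symm_apply]
  have hFadd : ∀ j, ∀ t ∈ G.ideal H G.T X, ∀ t' ∈ G.ideal H G.T X,
      F j (t + t') = F j t + F j t' := by
    intro j t ht t' ht'
    simp only [F]
    rw [Preadditive.add_comp, map_add, hadd _ _ (hmem ht _) _ (hmem ht' _), map_add]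
  have hFcomp : ∀ j a, ∀ t ∈ G.ideal H G.T X, F j (a ≫ t) = a ≫ F j t := by
    intro j a t ht
    simp only [F]
    rw [Category.assoc, symm_comp, hmul _ _ (hmem ht _), G.θ_mul, AddEquiv.apply_symm_apply]
  have hF0 : ∀ j, F j 0 = 0 := by
    intro j
    have := hFcomp j 0 0 (AddSubgroup.zero_mem _)
    rwa [zero_comp, zero_comp] at this
  have hFsum : ∀ j (a : Fin k × Fin m → (G.T ⟶ G.T)),
      F j (∑ l, a l ≫ x' l) = ∑ l, a l ≫ F j (x' l) := by
    intro j a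
    have hin : ∀ s : Finset (Fin k × Fin m), ∑ l ∈ s, a l ≫ x' l ∈ G.ideal H G.T X :=
      fun s => sum_mem fun l _ => comp_mem_ideal_left (hx' l) _
    suffices ∀ s : Finset (Fin k × Fin m),
      F j (∑ l ∈ s, a l ≫ x' l) = ∑ l ∈ s, a l ≫ F j (x' l) from this _
    intro s
    induction s using Finset.cons_induction with
    | empty => simp [hF0]
    | cons i s hi ih =>
      rw [Finset.sum_cons, Finset.sum_cons, hFadd j _ (comp_mem_ideal_left (hx' i) _) _ (hin s),
        ih, hFcomp j _ _ (hx' i)]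
  obtain ⟨Z, p, q, hpq, hE⟩ := G.split (Fin k × Fin m) (fun i j => F j (x' i)) (by
    intro i j
    rw [← hFsum, hFx _ (hx' i)])
  have hZ : P Z := by
    rw [h.prop_iff]
    have h1 : 𝟙 Z = ∑ i, ∑ j, p i ≫ (q i ≫ p j) ≫ q j := by
      conv_lhs => rw [← Category.comp_id (𝟙 Z), ← hpq, Preadditive.sum_comp]
      refine Finset.sum_congr rfl fun i _ => ?_
      rw [Preadditive.comp_sum]
      exact Finset.sum_congr rfl fun j _ => by simp
    rw [h1]
    refine sum_mem fun i _ => sum_mem fun j _ =>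
      comp_mem_ideal_left (comp_mem_ideal_right ?_ _) _
    rw [hE, θ_mem_ideal]
    exact hfH _ (hmem (hx' i) _)
  let g : Z ⟶ X := ∑ l, p l ≫ x' l
  -- The coordinates of `t` provide its lift along `g`. Arbitrary `W` in `P` are then handled by
  -- decomposing `𝟙 W` through `T`.
  have hqg : ∀ t ∈ G.ideal H G.T X, (∑ l, F l t ≫ q l) ≫ g = t := by
    intro t ht
    conv_rhs => rw [← hFx t ht]
    simp only [g, Preadditive.comp_sum]
    refine Finset.sum_congr rfl fun j _ => ?_
    conv_rhs => rw [← hFx t ht, hFsum]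
    simp only [Preadditive.sum_comp, ← Category.assoc]
    refine Finset.sum_congr rfl fun l _ => ?_
    rw [Category.assoc (F l t), hE]
  refine ⟨Z, hZ, g, fun W hW t => ?_, fun W _ w hw => ?_⟩
  · obtain ⟨n, α, β, hαβ⟩ := G.gen W
    refine ⟨∑ s, α s ≫ ∑ l, F l (β s ≫ t) ≫ q l, ?_⟩
    rw [Preadditive.sum_comp]
    conv_rhs => rw [← Category.id_comp t, ← hαβ, Preadditive.sum_comp]
    refine Finset.sum_congr rfl fun s _ => ?_
    rw [Category.assoc, Category.assoc,
      hqg _ (comp_mem_ideal_left (h.mem_ideal_of_source hW t) _)]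
  · refine eq_zero_of_forall G fun a => ?_
    have h1 : (a ≫ w) ≫ g = 0 := by rw [Category.assoc, hw, comp_zero]
    generalize a ≫ w = v at h1
    -- The coordinates of `v` are recovered from its image: `v ≫ p j = F j (v ≫ g)`.
    have h2 : ∀ j, v ≫ p j = 0 := by
      intro j
      have h3 : v ≫ p j = ∑ l, (v ≫ p l) ≫ F j (x' l) := by
        conv_lhs => rw [← Category.comp_id v, ← hpq, Preadditive.comp_sum, Preadditive.sum_comp]
        exact Finset.sum_congr rfl fun l _ => by rw [← hE]; simp
      rw [h3, ← hFsum]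
      have h4 : ∑ l, (v ≫ p l) ≫ x' l = v ≫ g := by
        simp [g, Preadditive.comp_sum]
      rw [h4, h1, hF0]
    rw [← Category.comp_id v, ← hpq, Preadditive.comp_sum]
    exact Finset.sum_eq_zero fun j _ => by rw [← Category.assoc, h2, zero_comp]

theorem IsAdd.relProj_iff (h : G.IsAdd P H) : RelProj H ⊥ ↔ RightRejectiveIn P ⊤ := by
  refine ⟨h.rightRejectiveIn_top, fun hr => ?_⟩
  obtain ⟨Z, hZ, g, h1, h2⟩ := hr G.T trivial
  exact h.relProj_of_rightApproximation hZ g h1 (h2 _ trivial)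

variable (G) in
/-- `t` is invertible modulo the ideal given by `H`. -/
def InvMod (H : TwoSidedIdeal A) (t : X ⟶ X) : Prop :=
  ∃ u : X ⟶ X, u ≫ t - 𝟙 X ∈ G.ideal H X X ∧ t ≫ u - 𝟙 X ∈ G.ideal H X X

/-- Jacobson's lemma between different objects, modulo an ideal. It moves radical conditions between
the generator and an arbitrary object. -/
theorem InvMod.swap {a : X ⟶ Y} {b : Y ⟶ X} (h : G.InvMod H (𝟙 X - a ≫ b)) :
    G.InvMod H (𝟙 Y - b ≫ a) := by
  obtain ⟨u, h1, h2⟩ := h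
  refine ⟨𝟙 Y + b ≫ u ≫ a, ?_, ?_⟩
  · have : (𝟙 Y + b ≫ u ≫ a) ≫ (𝟙 Y - b ≫ a) - 𝟙 Y = b ≫ (u ≫ (𝟙 X - a ≫ b) - 𝟙 X) ≫ a := by
      simp only [Preadditive.add_comp, Preadditive.comp_sub, Preadditive.sub_comp, Category.id_comp,
        Category.comp_id, Category.assoc]
      abel
    rw [this]
    exact comp_mem_ideal_left (comp_mem_ideal_right h1 _) _
  · have : (𝟙 Y - b ≫ a) ≫ (𝟙 Y + b ≫ u ≫ a) - 𝟙 Y = b ≫ ((𝟙 X - a ≫ b) ≫ u - 𝟙 X) ≫ a := by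
      simp only [Preadditive.comp_add, Preadditive.comp_sub, Preadditive.sub_comp, Category.id_comp,
        Category.comp_id, Category.assoc]
      abel
    rw [this]
    exact comp_mem_ideal_left (comp_mem_ideal_right h2 _) _

theorem relRad_iff_forall_invMod {r : A} :
    RelRad H r ↔ ∀ a b, G.InvMod H (𝟙 G.T - b ≫ G.θ r ≫ a) := by
  have key : ∀ a b : A, G.InvMod H (𝟙 G.T - G.θ b ≫ G.θ r ≫ G.θ a) ↔
      ∃ u, u * (1 - a * r * b) - 1 ∈ H ∧ (1 - a * r * b) * u - 1 ∈ H := by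
    intro a b
    have h1 : 𝟙 G.T - G.θ b ≫ G.θ r ≫ G.θ a = G.θ (1 - a * r * b) := by
      rw [map_sub, G.θ_one, G.θ_mul, G.θ_mul]
    have h2 : ∀ u, G.θ u ≫ G.θ (1 - a * r * b) - 𝟙 G.T ∈ G.ideal H G.T G.T ↔
        (1 - a * r * b) * u - 1 ∈ H := by
      intro u
      rw [← G.θ_mul, ← G.θ_one, ← map_sub, θ_mem_ideal]
    have h3 : ∀ u, G.θ (1 - a * r * b) ≫ G.θ u - 𝟙 G.T ∈ G.ideal H G.T G.T ↔
        u * (1 - a * r * b) - 1 ∈ H := by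
      intro u
      rw [← G.θ_mul, ← G.θ_one, ← map_sub, θ_mem_ideal]
    rw [h1]
    constructor
    · rintro ⟨u, hu1, hu2⟩
      obtain ⟨u, rfl⟩ := G.θ.surjective u
      exact ⟨u, (h3 u).1 hu2, (h2 u).1 hu1⟩
    · rintro ⟨u, hu1, hu2⟩
      exact ⟨G.θ u, (h2 u).2 hu2, (h3 u).2 hu1⟩
  constructor
  · intro h a b
    obtain ⟨a, rfl⟩ := G.θ.surjective a
    obtain ⟨b, rfl⟩ := G.θ.surjective b
    exact (key a b).2 (h a b)
  · intro h a b
    exact (key a b).1 (h _ _)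

/-- If `x` and `y` in `H` factor through `P`, then the middle part of `x * r * y` is a morphism
between objects of `P` that is radical modulo `P'`. Conversely, inserting the identities of `X` and
`Y` writes `q ≫ f ≫ p`, for a radical `f`, as a sum of products from `HJH`. -/
theorem IsAdd.cosemisimpleIn_iff (h : G.IsAdd P H) (h' : G.IsAdd P' H') :
    CosemisimpleIn P' P ↔ RelJac H H' := by
  constructor
  · intro hc x hx y hy r hr
    rw [← θ_mem_ideal (G := G), G.θ_mul, G.θ_mul]
    obtain ⟨X, hX, x₁, x₂, hx'⟩ := h.factors _ (θ_mem_ideal.2 hx)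
    obtain ⟨Y, hY, y₁, y₂, hy'⟩ := h.factors _ (θ_mem_ideal.2 hy)
    have hf := hc Y X hY hX (y₂ ≫ G.θ r ≫ x₁) (by
      intro g
      have h1 : G.InvMod H' (𝟙 G.T - (G.θ r ≫ x₁ ≫ g) ≫ y₂) := by
        have := relRad_iff_forall_invMod.1 hr (x₁ ≫ g ≫ y₂) (𝟙 _)
        simpa using this
      obtain ⟨u, hu, hu'⟩ := h1.swap
      rw [← h'.factors_iff] at hu hu'
      exact ⟨u, by simpa using hu, by simpa using hu'⟩)
    rw [h'.factors_iff] at hf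
    have := comp_mem_ideal_left (comp_mem_ideal_right hf x₂) y₁
    rw [← hx', ← hy']
    simpa using this
  · intro hJ X Y hX hY f hf
    rw [h'.factors_iff]
    have hrad : ∀ (q : G.T ⟶ X) (p : Y ⟶ G.T), RelRad H' (G.θ.symm (q ≫ f ≫ p)) := by
      intro q p
      rw [relRad_iff_forall_invMod (G := G)]
      intro a b
      rw [AddEquiv.apply_symm_apply]
      obtain ⟨u, hu, hu'⟩ := hf (p ≫ a ≫ b ≫ q)
      rw [h'.factors_iff] at hu hu'
      have h1 : G.InvMod H' (𝟙 X - (f ≫ p ≫ a) ≫ (b ≫ q)) :=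
        ⟨u, by simpa using hu, by simpa using hu'⟩
      simpa using h1.swap
    intro q p
    obtain ⟨k, PX, QX, hPX⟩ := G.gen X
    obtain ⟨l, PY, QY, hPY⟩ := G.gen Y
    have h1 : q ≫ f ≫ p =
        ∑ s, ∑ t, (q ≫ PX s) ≫ (QX s ≫ f ≫ PY t) ≫ (QY t ≫ p) := by
      conv_lhs => rw [← Category.id_comp (f ≫ p), ← hPX, ← Category.id_comp p, ← hPY]
      simp only [Preadditive.sum_comp, Preadditive.comp_sum, Category.assoc]
      rw [Finset.sum_comm]
    rw [h1, map_sum]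
    refine sum_mem fun s _ => ?_
    rw [map_sum]
    refine sum_mem fun t _ => ?_
    rw [symm_comp, symm_comp]
    exact hJ _ (mem_ideal_self.1 (comp_mem_ideal_left (h.mem_ideal_of_source hY p) _)) _
      (mem_ideal_self.1 (comp_mem_ideal_right (h.mem_ideal_of_target hX q) _)) _ (hrad _ _)

theorem le_of_forall_succ_le {α : Type*} [Preorder α] {n : ℕ} {H : ℕ → α}
    (hle : ∀ i < n, H (i + 1) ≤ H i) {i m : ℕ} (him : i ≤ m) (hm : m ≤ n) : H m ≤ H i := by
  induction m, him using Nat.le_induction with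
  | base => exact le_rfl
  | succ k hk ih => exact (hle k hm).trans (ih (Nat.le_of_succ_le hm))

/-- A coreflection `g : Z ⟶ T` is monic against objects of `C i` only; the heredity chain upgrades
this to monicity against `T`, after which `H i` is projective by
`IsAdd.relProj_of_rightApproximation`. -/
theorem relProj_bot_of_coreflectiveIn {n : ℕ} {C : ℕ → ObjectProperty 𝒞}
    {H : ℕ → TwoSidedIdeal A} (hadd : ∀ i ≤ n, G.IsAdd (C i) (H i))
    (hle : ∀ i < n, H (i + 1) ≤ H i) (hn : H n = ⊥)
    (hproj : ∀ i < n, RelProj (H i) (H (i + 1))) {i : ℕ} (hi : i ≤ n)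
    (hcor : CoreflectiveIn (C i) ⊤) : RelProj (H i) ⊥ := by
  obtain ⟨Z, hZ, g, hg⟩ := hcor G.T trivial
  -- A morphism in the ideal of `H l` factors through `C l`, which is contained in `C i`, so it
  -- lifts along `g` inside the same ideal.
  have hlift : ∀ l, i ≤ l → l ≤ n → ∀ (Y : 𝒞) (k : Y ⟶ G.T), k ∈ G.ideal (H l) Y G.T →
      ∃ k' ∈ G.ideal (H l) Y Z, k' ≫ g = k := by
    intro l hil hln Y k hk
    obtain ⟨W, hW, a, b, rfl⟩ := (hadd l hln).factors _ hk
    obtain ⟨b', rfl, -⟩ := hg W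
      ((hadd i hi).mono (hadd l hln) (le_of_forall_succ_le hle hil hln) W hW) b
    exact ⟨a ≫ b', comp_mem_ideal_left ((hadd l hln).mem_ideal_of_source hW b') a,
      Category.assoc _ _ _⟩
  -- A morphism killed by `g` descends through all ideals of the chain. In the step, `v = d ≫ q`
  -- through `W` in `C m`, and `u = q ≫ g` is expanded in the dual basis of `H m` modulo `H (m +
  -- 1)`.
  have key : ∀ m, i ≤ m → m ≤ n → ∀ v : G.T ⟶ Z, v ≫ g = 0 → v ∈ G.ideal (H m) G.T Z := by
    intro m him
    induction m, him using Nat.le_induction with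
    | base =>
      intro _ v _
      exact (hadd i hi).mem_ideal_of_target hZ v
    | succ m him ih =>
      intro hmn v hv
      have hm : m ≤ n := Nat.le_of_succ_le hmn
      obtain ⟨W, hW, d, q, hdq⟩ := (hadd m hm).factors _ (ih hm v hv)
      obtain ⟨k, x, f, hx, hmul, hadd', h0, hsum⟩ := hproj m hmn
      obtain ⟨l, α, β, hαβ⟩ := G.gen W
      set u : W ⟶ G.T := q ≫ g with hu
      have hβ : ∀ t, G.θ.symm (β t ≫ u) ∈ H m := fun t =>
        mem_ideal_self.1 (comp_mem_ideal_left ((hadd m hm).mem_ideal_of_source hW u) _)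
      let F : Fin k → (W ⟶ G.T) := fun s => ∑ t, α t ≫ G.θ (f s (G.θ.symm (β t ≫ u)))
      have hF1 : u - ∑ s, F s ≫ G.θ (x s) ∈ G.ideal (H (m + 1)) W G.T := by
        have h1 : u - ∑ s, F s ≫ G.θ (x s) = ∑ t, α t ≫ G.θ (G.θ.symm (β t ≫ u) -
            ∑ s, x s * f s (G.θ.symm (β t ≫ u))) := by
          simp only [map_sub, AddEquiv.apply_symm_apply, map_sum, G.θ_mul, Preadditive.comp_sub,
            Finset.sum_sub_distrib, F, Preadditive.sum_comp, Preadditive.comp_sum]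
          rw [Finset.sum_comm]
          simp only [← Category.assoc, ← Preadditive.sum_comp]
          rw [hαβ, Category.id_comp]
        rw [h1]
        exact sum_mem fun t _ => comp_mem_ideal_left (θ_mem_ideal.2 (hsum _ (hβ t))) _
      -- Modulo `H (m + 1)`, `d ≫ F s` is the `s`-th coordinate of `d ≫ u = v ≫ g = 0`.
      have hF2 : ∀ s, d ≫ F s ∈ G.ideal (H (m + 1)) G.T G.T := by
        intro s
        have h1 : ∀ S : Finset (Fin l), (∑ t ∈ S, G.θ.symm (β t ≫ u) * G.θ.symm (d ≫ α t) ∈ H m) ∧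
            f s (∑ t ∈ S, G.θ.symm (β t ≫ u) * G.θ.symm (d ≫ α t)) -
            ∑ t ∈ S, f s (G.θ.symm (β t ≫ u)) * G.θ.symm (d ≫ α t) ∈ H (m + 1) := by
          intro S
          induction S using Finset.cons_induction with
          | empty =>
            rw [Finset.sum_empty, Finset.sum_empty, sub_zero]
            exact ⟨(H m).zero_mem, h0 s 0 (TwoSidedIdeal.zero_mem _)⟩
          | cons t S ht ihS =>
            have h2 := (H m).mul_mem_right _ (G.θ.symm (d ≫ α t)) (hβ t)
            rw [Finset.sum_cons, Finset.sum_cons]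
            refine ⟨(H m).add_mem h2 ihS.1, ?_⟩
            have h3 := hadd' s _ h2 _ ihS.1
            have h4 := hmul s _ (hβ t) (G.θ.symm (d ≫ α t))
            have h5 := (H (m + 1)).add_mem h3 ((H (m + 1)).add_mem h4 ihS.2)
            convert h5 using 1
            abel
        have h2 : ∑ t, G.θ.symm (β t ≫ u) * G.θ.symm (d ≫ α t) = 0 := by
          simp only [← symm_comp, ← map_sum]
          rw [EmbeddingLike.map_eq_zero_iff]
          have : ∀ t, (d ≫ α t) ≫ β t ≫ u = d ≫ (α t ≫ β t) ≫ u := fun t => by simp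
          simp only [this]
          rw [← Preadditive.comp_sum, ← Preadditive.sum_comp, hαβ, Category.id_comp, hu,
            ← Category.assoc, hdq, hv]
        have h3 := (h1 Finset.univ).2
        rw [h2] at h3
        have h4 := (H (m + 1)).sub_mem (h0 s 0 (TwoSidedIdeal.zero_mem _)) h3
        rw [sub_sub_cancel] at h4
        have h5 : d ≫ F s = G.θ (∑ t, f s (G.θ.symm (β t ≫ u)) * G.θ.symm (d ≫ α t)) := by
          simp only [F, Preadditive.comp_sum, map_sum, G.θ_mul, AddEquiv.apply_symm_apply,
            Category.assoc]
        rw [h5, θ_mem_ideal]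
        exact h4
      choose z hz hzg using fun s => hlift m him hm G.T (G.θ (x s)) (θ_mem_ideal.2 (hx s))
      obtain ⟨q₂, hq₂, hq₂g⟩ := hlift (m + 1) (Nat.le_succ_of_le him) hmn W _ hF1
      -- Both sides lift the same morphism `W ⟶ T`, and lifts from `W` are unique because `W` lies
      -- in `C i`.
      have hq : q - ∑ s, F s ≫ z s = q₂ := by
        obtain ⟨_, -, huniq⟩ := hg W
          ((hadd i hi).mono (hadd m hm) (le_of_forall_succ_le hle him hm) W hW) (q₂ ≫ g)
        refine (huniq _ ?_).trans (huniq _ rfl).symm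
        beta_reduce
        rw [hq₂g, Preadditive.sub_comp, Preadditive.sum_comp, ← hu]
        simp only [Category.assoc, hzg]
      have hv' : v = d ≫ q₂ + ∑ s, (d ≫ F s) ≫ z s := by
        rw [← hq, ← hdq, Preadditive.comp_sub, Preadditive.comp_sum]
        simp only [Category.assoc, sub_add_cancel]
      rw [hv']
      exact AddSubgroup.add_mem _ (comp_mem_ideal_left hq₂ _)
        (sum_mem fun s _ => comp_mem_ideal_right (hF2 s) _)
  refine (hadd i hi).relProj_of_rightApproximation hZ g (fun W hW k => (hg W hW k).exists)
    fun w hw => ?_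
  have := key n hi le_rfl w hw
  rwa [hn, mem_ideal_bot] at this

theorem tfae_right {n : ℕ} {C : ℕ → ObjectProperty 𝒞}
    {H : ℕ → TwoSidedIdeal A} (hadd : ∀ i ≤ n, G.IsAdd (C i) (H i)) (h0 : H 0 = ⊤)
    (hle : ∀ i < n, H (i + 1) ≤ H i) (hn : H n = ⊥) :
    List.TFAE
      [(∀ i < n, RelProj (H i) ⊥) ∧ ∀ i < n, RelJac (H i) (H (i + 1)),
        (∀ i < n, RightRejectiveIn (C (i + 1)) ⊤) ∧ ∀ i < n, CosemisimpleIn (C (i + 1)) (C i),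
        ((∀ i < n, RelProj (H i) (H (i + 1))) ∧ ∀ i < n, RelJac (H i) (H (i + 1))) ∧
          (∀ i < n, CoreflectiveIn (C (i + 1)) (C i)) ∧
          ∀ i < n, CosemisimpleIn (C (i + 1)) (C i)] := by
  have hcos : (∀ i < n, CosemisimpleIn (C (i + 1)) (C i)) ↔ ∀ i < n, RelJac (H i) (H (i + 1)) :=
    forall₂_congr fun i hi => (hadd i hi.le).cosemisimpleIn_iff (hadd (i + 1) hi)
  -- The index ranges differ by one: `1, …, n` on the left and `0, …, n - 1` on the right. Both
  -- extra cases are trivial, as `H 0 = ⊤` and `H n = ⊥`.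
  have hrej : (∀ i < n, RightRejectiveIn (C (i + 1)) ⊤) ↔ ∀ i < n, RelProj (H i) ⊥ := by
    constructor
    · intro h i hi
      cases i with
      | zero =>
        rw [h0]
        exact relProj_top_bot
      | succ i => exact (hadd _ hi.le).relProj_iff.2 (h i (Nat.lt_of_succ_lt hi))
    · intro h i hi
      refine (hadd _ hi).relProj_iff.1 ?_
      rcases Nat.lt_or_eq_of_le (Nat.succ_le_of_lt hi) with hi' | hi'
      · exact h _ hi'
      · rw [hi', hn]
        exact relProj_bot_bot
  have hC : ∀ i < n, C (i + 1) ≤ C i := fun i hi =>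
    (hadd i hi.le).mono (hadd (i + 1) hi) (hle i hi)
  rw [hcos, hrej]
  tfae_have 1 ↔ 2 := Iff.rfl
  tfae_have 1 → 3 := by
    rintro ⟨h1, h2⟩
    refine ⟨⟨fun i hi => (h1 i hi).of_bot (hle i hi) (hadd _ hi).isIdempotentIdeal, h2⟩,
      fun i hi => ?_, h2⟩
    exact ((hrej.2 h1 i hi).mono le_top).coreflectiveIn (hC i hi)
  tfae_have 3 → 1 := by
    rintro ⟨⟨h1, h2⟩, h3, -⟩
    refine ⟨fun i hi => relProj_bot_of_coreflectiveIn hadd hle hn h1 hi.le ?_, h2⟩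
    -- Coreflections compose without further hypotheses, unlike monic approximations.
    have : ∀ i, i ≤ n → CoreflectiveIn (C i) ⊤ := by
      intro i
      induction i with
      | zero =>
        intro _ X _
        refine ⟨X, ?_, 𝟙 X, fun W _ h => ⟨h, Category.comp_id h, fun y hy => ?_⟩⟩
        · rw [(hadd 0 (Nat.zero_le _)).prop_iff, h0]
          exact fun _ _ => trivial
        · rw [← hy, Category.comp_id]
      | succ i ih =>
        intro hi
        exact (h3 i hi).trans (ih (Nat.le_of_succ_le hi)) (hC i hi)
    exact this i hi.le
  tfae_finish

/-! ### Passage to the opposite category. -/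

section Opposite

open Opposite

variable (G) in
/-- The opposite category, with the opposite algebra. -/
def op : ProjGenerator Aᵐᵒᵖ 𝒞ᵒᵖ where
  T := Opposite.op G.T
  θ :=
    { toFun := fun a => (G.θ a.unop).op
      invFun := fun f => .op (G.θ.symm f.unop)
      left_inv := fun a => by simp
      right_inv := fun f => by simp
      map_add' := fun a b => by simp }
  θ_mul a b := by
    change (G.θ (b.unop * a.unop)).op = _
    rw [G.θ_mul]
    rfl
  gen X := by
    obtain ⟨k, p, q, h⟩ := G.gen X.unop
    refine ⟨k, fun i => (q i).op, fun i => (p i).op, ?_⟩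
    simp only [← op_comp]
    rw [← CategoryTheory.op_sum, h]
    rfl
  split ι _ E hE := by
    -- The matrix is transposed, since composition is reversed.
    obtain ⟨Z, p, q, h, h'⟩ := G.split ι (fun i j => (E j i).unop) (fun i j => by
      have := congrArg Quiver.Hom.unop (hE j i)
      rw [CategoryTheory.unop_sum] at this
      exact this)
    refine ⟨Opposite.op Z, fun i => (q i).op, fun i => (p i).op, ?_, fun i j => ?_⟩
    · simp only [← op_comp]
      rw [← CategoryTheory.op_sum, h]
      rfl
    · exact congrArg Quiver.Hom.op (h' j i)

theorem op_mem_ideal_iff {f : X ⟶ Y} :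
    f.op ∈ G.op.ideal H.op (Opposite.op Y) (Opposite.op X) ↔ f ∈ G.ideal H X Y := by
  constructor
  · intro h q p
    have := h p.op q.op
    rw [TwoSidedIdeal.mem_op_iff] at this
    have h2 : G.θ.symm ((q ≫ f) ≫ p) ∈ H := this
    rwa [Category.assoc] at h2
  · intro h q p
    rw [TwoSidedIdeal.mem_op_iff]
    have key : ∀ (q : G.T ⟶ X) (p : Y ⟶ G.T), G.θ.symm ((q ≫ f) ≫ p) ∈ H := by
      intro q p
      rw [Category.assoc]
      exact h q p
    exact key p.unop q.unop

omit [Preadditive 𝒞] in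
theorem factors_op_iff {f : X ⟶ Y} : Factors P.op f.op ↔ Factors P f := by
  constructor
  · rintro ⟨Z, hZ, a, b, hab⟩
    exact ⟨Z.unop, hZ, b.unop, a.unop, congrArg Quiver.Hom.unop hab⟩
  · rintro ⟨Z, hZ, a, b, rfl⟩
    exact ⟨Opposite.op Z, hZ, b.op, a.op, rfl⟩

theorem IsAdd.op (h : G.IsAdd P H) : G.op.IsAdd P.op H.op where
  prop_iff X := (h.prop_iff X.unop).trans op_mem_ideal_iff.symm
  factors f hf := factors_op_iff.2 (h.factors f.unop (op_mem_ideal_iff.1 hf))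

theorem rightRejectiveIn_op_iff : RightRejectiveIn P.op P'.op ↔ LeftRejectiveIn P P' := by
  constructor
  · intro h X hX
    obtain ⟨Z, hZ, g, h1, h2⟩ := h (Opposite.op X) hX
    refine ⟨Z.unop, hZ, g.unop, fun W hW k => ?_, fun W hW w hw => ?_⟩
    · obtain ⟨k', hk'⟩ := h1 (Opposite.op W) hW k.op
      exact ⟨k'.unop, congrArg Quiver.Hom.unop hk'⟩
    · exact congrArg Quiver.Hom.unop (h2 (Opposite.op W) hW w.op (congrArg Quiver.Hom.op hw))
  · intro h X hX
    obtain ⟨Z, hZ, g, h1, h2⟩ := h X.unop hX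
    refine ⟨Opposite.op Z, hZ, g.op, fun W hW k => ?_, fun W hW w hw => ?_⟩
    · obtain ⟨k', hk'⟩ := h1 W.unop hW k.unop
      exact ⟨k'.op, congrArg Quiver.Hom.op hk'⟩
    · exact congrArg Quiver.Hom.op (h2 W.unop hW w.unop (congrArg Quiver.Hom.unop hw))

theorem leftRejectiveIn_op_iff : LeftRejectiveIn P.op P'.op ↔ RightRejectiveIn P P' := by
  constructor
  · intro h X hX
    obtain ⟨Z, hZ, g, h1, h2⟩ := h (Opposite.op X) hX
    refine ⟨Z.unop, hZ, g.unop, fun W hW k => ?_, fun W hW w hw => ?_⟩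
    · obtain ⟨k', hk'⟩ := h1 (Opposite.op W) hW k.op
      exact ⟨k'.unop, congrArg Quiver.Hom.unop hk'⟩
    · exact congrArg Quiver.Hom.unop (h2 (Opposite.op W) hW w.op (congrArg Quiver.Hom.op hw))
  · intro h X hX
    obtain ⟨Z, hZ, g, h1, h2⟩ := h X.unop hX
    refine ⟨Opposite.op Z, hZ, g.op, fun W hW k => ?_, fun W hW w hw => ?_⟩
    · obtain ⟨k', hk'⟩ := h1 W.unop hW k.unop
      exact ⟨k'.op, congrArg Quiver.Hom.op hk'⟩
    · exact congrArg Quiver.Hom.op (h2 W.unop hW w.unop (congrArg Quiver.Hom.unop hw))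

omit [Preadditive 𝒞] in
theorem coreflectiveIn_op_iff : CoreflectiveIn P.op P'.op ↔ ReflectiveIn P P' := by
  constructor
  · intro h X hX
    obtain ⟨Z, hZ, g, h1⟩ := h (Opposite.op X) hX
    refine ⟨Z.unop, hZ, g.unop, fun W hW k => ?_⟩
    obtain ⟨k', hk', hu⟩ := h1 (Opposite.op W) hW k.op
    exact ⟨k'.unop, congrArg Quiver.Hom.unop hk', fun y hy =>
      congrArg Quiver.Hom.unop (hu y.op (congrArg Quiver.Hom.op hy))⟩
  · intro h X hX
    obtain ⟨Z, hZ, g, h1⟩ := h X.unop hX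
    refine ⟨Opposite.op Z, hZ, g.op, fun W hW k => ?_⟩
    obtain ⟨k', hk', hu⟩ := h1 W.unop hW k.unop
    exact ⟨k'.op, congrArg Quiver.Hom.op hk', fun y hy =>
      congrArg Quiver.Hom.op (hu y.unop (congrArg Quiver.Hom.unop hy))⟩

/-- This is `tfae_right` for the opposite generator. Its third condition contains projectivity of `H
i / H (i + 1)` on the left; replacing this by the right-handed heredity condition takes the symmetry
of heredity ideals. -/
theorem tfae_left {n : ℕ} {C : ℕ → ObjectProperty 𝒞}
    {H : ℕ → TwoSidedIdeal A} (hadd : ∀ i ≤ n, G.IsAdd (C i) (H i)) (h0 : H 0 = ⊤)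
    (hle : ∀ i < n, H (i + 1) ≤ H i) (hn : H n = ⊥) :
    List.TFAE
      [(∀ i < n, RelProj (H i).op ⊥) ∧ ∀ i < n, RelJac (H i) (H (i + 1)),
        (∀ i < n, LeftRejectiveIn (C (i + 1)) ⊤) ∧ ∀ i < n, CosemisimpleIn (C (i + 1)) (C i),
        ((∀ i < n, RelProj (H i).op (H (i + 1)).op) ∧ ∀ i < n, RelJac (H i) (H (i + 1))) ∧
          (∀ i < n, ReflectiveIn (C (i + 1)) (C i)) ∧
          ∀ i < n, CosemisimpleIn (C (i + 1)) (C i)] := by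
  have hcos : (∀ i < n, CosemisimpleIn (C (i + 1)) (C i)) ↔
      ∀ i < n, CosemisimpleIn (C (i + 1)).op (C i).op :=
    forall₂_congr fun i hi => by
      rw [(hadd i hi.le).cosemisimpleIn_iff (hadd (i + 1) hi),
        (hadd i hi.le).op.cosemisimpleIn_iff (hadd (i + 1) hi).op, relJac_op_iff]
  have := tfae_right (G := G.op) (C := fun i => (C i).op) (H := fun i => (H i).op) (n := n)
    (fun i hi => (hadd i hi).op)
    (by
      rw [h0]
      ext x
      exact ⟨fun _ => trivial, fun _ => TwoSidedIdeal.mem_op_iff.2 trivial⟩)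
    (fun i hi x hx => by
      rw [TwoSidedIdeal.mem_op_iff] at hx ⊢
      exact hle i hi hx)
    (by
      rw [hn]
      ext x
      rw [TwoSidedIdeal.mem_op_iff, TwoSidedIdeal.mem_bot, TwoSidedIdeal.mem_bot,
        MulOpposite.unop_eq_zero_iff])
  have htop : (⊤ : ObjectProperty 𝒞ᵒᵖ) = (⊤ : ObjectProperty 𝒞).op := rfl
  simp only [relJac_op_iff, htop, rightRejectiveIn_op_iff, coreflectiveIn_op_iff, ← hcos] at this
  exact this

end Opposite

end ProjGenerator

end ProjGenerator

/-! ### Adjoints of inclusion functors versus approximations. -/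

section Adjunctions

variable {𝒞 : Type w} [Category.{v} 𝒞] [Preadditive 𝒞]

omit [Preadditive 𝒞] in
-- The counit of the adjunction built from the universal properties is `g X` itself, so monicity
-- carries over.
theorem exists_adjunction_of_coreflections (P : ObjectProperty 𝒞) (Z : 𝒞 → P.FullSubcategory)
    (g : ∀ X, (Z X).obj ⟶ X) (hg : ∀ X W, P W → ∀ h : W ⟶ X, ∃! h', h' ≫ g X = h) :
    ∃ (G : 𝒞 ⥤ P.FullSubcategory) (adj : P.ι ⊣ G),
      ∀ X, Mono (g X) → Mono (adj.counit.app X) := by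
  choose L hL hL' using hg
  let e : ∀ (W : P.FullSubcategory) (X : 𝒞), (P.ι.obj W ⟶ X) ≃ (W ⟶ Z X) := fun W X =>
    { toFun := fun h => ObjectProperty.homMk (L X W.obj W.property h)
      invFun := fun k => k.hom ≫ g X
      left_inv := fun h => hL X W.obj W.property h
      right_inv := fun k => ObjectProperty.hom_ext _ (hL' X W.obj W.property _ k.hom rfl).symm }
  have he : ∀ (W' W : P.FullSubcategory) (X : 𝒞) (f : W' ⟶ W) (h : P.ι.obj W ⟶ X),
      e W' X (P.ι.map f ≫ h) = f ≫ e W X h := by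
    intro W' W X f h
    rw [← Equiv.eq_symm_apply]
    change f.hom ≫ h = (f.hom ≫ L X W.obj W.property h) ≫ g X
    rw [Category.assoc]
    exact congrArg (f.hom ≫ ·) (hL X W.obj W.property h).symm
  refine ⟨_, Adjunction.adjunctionOfEquivRight e he, fun X hX => ?_⟩
  have : (Adjunction.adjunctionOfEquivRight e he).counit.app X = g X := by
    simp [e]
  rw [this]
  exact hX

omit [Preadditive 𝒞] in
theorem exists_adjunction_of_reflections (P : ObjectProperty 𝒞) (Z : 𝒞 → P.FullSubcategory)
    (g : ∀ X, X ⟶ (Z X).obj) (hg : ∀ X W, P W → ∀ h : X ⟶ W, ∃! h', g X ≫ h' = h) :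
    ∃ (G : 𝒞 ⥤ P.FullSubcategory) (adj : G ⊣ P.ι),
      ∀ X, Epi (g X) → Epi (adj.unit.app X) := by
  choose L hL hL' using hg
  let e : ∀ (X : 𝒞) (W : P.FullSubcategory), (Z X ⟶ W) ≃ (X ⟶ P.ι.obj W) := fun X W =>
    { toFun := fun k => g X ≫ k.hom
      invFun := fun h => ObjectProperty.homMk (L X W.obj W.property h)
      left_inv := fun k => ObjectProperty.hom_ext _ (hL' X W.obj W.property _ k.hom rfl).symm
      right_inv := fun h => hL X W.obj W.property h }
  have he : ∀ (X : 𝒞) (W W' : P.FullSubcategory) (f : W ⟶ W') (h : Z X ⟶ W),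
      e X W' (h ≫ f) = e X W h ≫ P.ι.map f :=
    fun X W W' f h => (Category.assoc (g X) h.hom f.hom).symm
  refine ⟨_, Adjunction.adjunctionOfEquivLeft e he, fun X hX => ?_⟩
  have : (Adjunction.adjunctionOfEquivLeft e he).unit.app X = g X := by
    simp [e]
  rw [this]
  exact hX

omit [Preadditive 𝒞] in
theorem existsUnique_of_mono {Z X W : 𝒞} {g : Z ⟶ X} [Mono g] {h : W ⟶ X}
    (hh : ∃ h', h' ≫ g = h) : ∃! h', h' ≫ g = h := by
  obtain ⟨h', rfl⟩ := hh
  exact ⟨h', rfl, fun y hy => (cancel_mono g).1 hy⟩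

omit [Preadditive 𝒞] in
theorem exists_factor_counit {P : ObjectProperty 𝒞} {G : 𝒞 ⥤ P.FullSubcategory}
    (adj : P.ι ⊣ G) {X W : 𝒞} (hW : P W) (h : W ⟶ X) :
    ∃! h', h' ≫ adj.counit.app X = h := by
  refine ⟨(adj.homEquiv ⟨W, hW⟩ X h).hom, ?_, fun y hy => ?_⟩
  · exact (adj.homEquiv_counit (g := adj.homEquiv ⟨W, hW⟩ X h)).symm.trans
      ((adj.homEquiv ⟨W, hW⟩ X).symm_apply_apply h)
  · let y' : (⟨W, hW⟩ : P.FullSubcategory) ⟶ G.obj X := ObjectProperty.homMk y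
    have h1 : (adj.homEquiv ⟨W, hW⟩ X).symm y' = h := (adj.homEquiv_counit _ _ _).trans hy
    rw [← h1, Equiv.apply_symm_apply]
    rfl

omit [Preadditive 𝒞] in
theorem exists_factor_unit {P : ObjectProperty 𝒞} {G : 𝒞 ⥤ P.FullSubcategory}
    (adj : G ⊣ P.ι) {X W : 𝒞} (hW : P W) (h : X ⟶ W) :
    ∃! h', adj.unit.app X ≫ h' = h := by
  refine ⟨((adj.homEquiv X ⟨W, hW⟩).symm h).hom, ?_, fun y hy => ?_⟩
  · exact (adj.homEquiv_unit (f := (adj.homEquiv X ⟨W, hW⟩).symm h)).symm.trans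
      ((adj.homEquiv X ⟨W, hW⟩).apply_symm_apply h)
  · let y' : G.obj X ⟶ (⟨W, hW⟩ : P.FullSubcategory) := ObjectProperty.homMk y
    have h1 : adj.homEquiv X ⟨W, hW⟩ y' = h := (adj.homEquiv_unit _ _ _).trans hy
    rw [← h1, Equiv.symm_apply_apply]
    rfl

theorem Subcat.isRightRejective_iff (P : Subcat 𝒞) :
    P.IsRightRejective ↔ RightRejectiveIn P.prop ⊤ := by
  constructor
  · rintro ⟨G, adj, hmono⟩ X -
    have := hmono X
    exact ⟨(G.obj X).obj, (G.obj X).property, adj.counit.app X,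
      fun W hW h => (exists_factor_counit adj hW h).exists,
      fun W _ w hw => (cancel_mono (adj.counit.app X)).1 (by rw [hw, zero_comp])⟩
  · intro h
    choose Z hZ g hg hg' using fun X => h X trivial
    have hm : ∀ X, Mono (g X) := fun X => Preadditive.mono_of_cancel_zero _ fun w hw =>
      hg' X _ trivial w hw
    obtain ⟨G, adj, hadj⟩ := exists_adjunction_of_coreflections P.prop (fun X => ⟨Z X, hZ X⟩) g
      (fun X W hW h => existsUnique_of_mono (hg X W hW h))
    exact ⟨G, adj, fun X => hadj X (hm X)⟩

theorem Subcat.isLeftRejective_iff (P : Subcat 𝒞) :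
    P.IsLeftRejective ↔ LeftRejectiveIn P.prop ⊤ := by
  constructor
  · rintro ⟨G, adj, hepi⟩ X -
    have := hepi X
    exact ⟨(G.obj X).obj, (G.obj X).property, adj.unit.app X,
      fun W hW h => (exists_factor_unit adj hW h).exists,
      fun W _ w hw => (cancel_epi (adj.unit.app X)).1 (by rw [hw, comp_zero])⟩
  · intro h
    choose Z hZ g hg hg' using fun X => h X trivial
    have hm : ∀ X, Epi (g X) := fun X => Preadditive.epi_of_cancel_zero _ fun w hw =>
      hg' X _ trivial w hw
    obtain ⟨G, adj, hadj⟩ := exists_adjunction_of_reflections P.prop (fun X => ⟨Z X, hZ X⟩) g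
      (fun X W hW h => by
        obtain ⟨h', rfl⟩ := hg X W hW h
        exact ⟨h', rfl, fun y hy => (cancel_epi (g X)).1 hy⟩)
    exact ⟨G, adj, fun X => hadj X (hm X)⟩

theorem Subcat.isCoreflective_iff (P : Subcat 𝒞) :
    P.IsCoreflective ↔ CoreflectiveIn P.prop ⊤ := by
  constructor
  · rintro ⟨G, ⟨adj⟩⟩ X -
    exact ⟨(G.obj X).obj, (G.obj X).property, adj.counit.app X,
      fun W hW h => exists_factor_counit adj hW h⟩
  · intro h
    choose Z hZ g hg using fun X => h X trivial
    obtain ⟨G, adj, -⟩ := exists_adjunction_of_coreflections P.prop (fun X => ⟨Z X, hZ X⟩) g hg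
    exact ⟨G, ⟨adj⟩⟩

theorem Subcat.isReflective_iff (P : Subcat 𝒞) :
    P.IsReflective ↔ ReflectiveIn P.prop ⊤ := by
  constructor
  · rintro ⟨G, ⟨adj⟩⟩ X -
    exact ⟨(G.obj X).obj, (G.obj X).property, adj.unit.app X,
      fun W hW h => exists_factor_unit adj hW h⟩
  · intro h
    choose Z hZ g hg using fun X => h X trivial
    obtain ⟨G, adj, -⟩ := exists_adjunction_of_reflections P.prop (fun X => ⟨Z X, hZ X⟩) g hg
    exact ⟨G, ⟨adj⟩⟩

/-- The quotient functor is full and bijective on objects, so inverses and test morphisms lift from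
the factor category. -/
theorem Subcat.isCosemisimple_iff (P : Subcat 𝒞) :
    P.IsCosemisimple ↔ CosemisimpleIn P.prop ⊤ := by
  let F := Quotient.functor P.homRel
  have hF : ∀ {X Y : 𝒞} (f g : X ⟶ Y), F.map f = F.map g ↔ Factors P.prop (f - g) :=
    fun f g => Quotient.functor_map_eq_iff P.homRel f g
  have hadd : ∀ {X Y : 𝒞} (f g : X ⟶ Y), F.map (f - g) = F.map f - F.map g := by
    intro X Y f g
    have : F.Additive := Quotient.functor_additive _ _
    exact F.map_sub
  have hzero : ∀ {X Y : 𝒞} (f : X ⟶ Y), F.map f = 0 ↔ Factors P.prop f := by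
    intro X Y f
    have : F.map (0 : X ⟶ Y) = 0 := by rw [← sub_self (0 : X ⟶ Y), hadd, sub_self]
    rw [← this, hF, sub_zero]
  have hiso : ∀ {X Y : 𝒞} (f : X ⟶ Y) (g : Y ⟶ X), IsIso (𝟙 (F.obj X) - F.map f ≫ F.map g) ↔
      ∃ u : X ⟶ X, Factors P.prop (u ≫ (𝟙 X - f ≫ g) - 𝟙 X) ∧
        Factors P.prop ((𝟙 X - f ≫ g) ≫ u - 𝟙 X) := by
    intro X Y f g
    have h1 : 𝟙 (F.obj X) - F.map f ≫ F.map g = F.map (𝟙 X - f ≫ g) := by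
      rw [hadd, F.map_id, F.map_comp]
    rw [h1]
    constructor
    · rintro ⟨u, hu, hu'⟩
      obtain ⟨u, rfl⟩ := F.map_surjective u
      rw [← F.map_comp, ← F.map_id, hF] at hu hu'
      exact ⟨u, hu', hu⟩
    · rintro ⟨u, hu, hu'⟩
      rw [← hF, F.map_comp, F.map_id] at hu hu'
      exact ⟨F.map u, hu', hu⟩
  constructor
  · intro h X Y _ _ f hf
    rw [← hzero]
    refine h (F.map f) fun g => ?_
    obtain ⟨g, rfl⟩ := F.map_surjective g
    exact (hiso f g).2 (hf g)
  · rintro h ⟨X⟩ ⟨Y⟩ f hf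
    obtain ⟨f, rfl⟩ := F.map_surjective (X := X) (Y := Y) f
    exact (hzero f).2 (h X Y trivial trivial f fun g => (hiso f g).1 (hf (F.map g)))

variable {P Q : Subcat 𝒞}

theorem Subcat.within_isRightRejective_iff (hle : P.prop ≤ Q.prop) :
    (P.within Q).IsRightRejective ↔ RightRejectiveIn P.prop Q.prop := by
  rw [Subcat.isRightRejective_iff]
  constructor
  · intro h X hX
    obtain ⟨Z, hZ, g, h1, h2⟩ := h ⟨X, hX⟩ trivial
    refine ⟨Z.obj, hZ, g.hom, fun W hW k => ?_, fun W hW w hw => ?_⟩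
    · obtain ⟨k', hk'⟩ := h1 ⟨W, hle W hW⟩ hW (ObjectProperty.homMk k)
      exact ⟨k'.hom, congrArg (·.hom) hk'⟩
    · exact congrArg (·.hom) (h2 ⟨W, hW⟩ trivial (ObjectProperty.homMk w)
        (ObjectProperty.hom_ext _ hw))
  · intro h X _
    obtain ⟨Z, hZ, g, h1, h2⟩ := h X.obj X.property
    refine ⟨⟨Z, hle Z hZ⟩, hZ, ObjectProperty.homMk g, fun W hW k => ?_, fun W hW w hw => ?_⟩
    · obtain ⟨k', hk'⟩ := h1 W.obj hW k.hom
      exact ⟨ObjectProperty.homMk k', ObjectProperty.hom_ext _ hk'⟩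
    · exact ObjectProperty.hom_ext _ (h2 W.obj W.property w.hom (congrArg (·.hom) hw))

theorem Subcat.within_isLeftRejective_iff (hle : P.prop ≤ Q.prop) :
    (P.within Q).IsLeftRejective ↔ LeftRejectiveIn P.prop Q.prop := by
  rw [Subcat.isLeftRejective_iff]
  constructor
  · intro h X hX
    obtain ⟨Z, hZ, g, h1, h2⟩ := h ⟨X, hX⟩ trivial
    refine ⟨Z.obj, hZ, g.hom, fun W hW k => ?_, fun W hW w hw => ?_⟩
    · obtain ⟨k', hk'⟩ := h1 ⟨W, hle W hW⟩ hW (ObjectProperty.homMk k)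
      exact ⟨k'.hom, congrArg (·.hom) hk'⟩
    · exact congrArg (·.hom) (h2 ⟨W, hW⟩ trivial (ObjectProperty.homMk w)
        (ObjectProperty.hom_ext _ hw))
  · intro h X _
    obtain ⟨Z, hZ, g, h1, h2⟩ := h X.obj X.property
    refine ⟨⟨Z, hle Z hZ⟩, hZ, ObjectProperty.homMk g, fun W hW k => ?_, fun W hW w hw => ?_⟩
    · obtain ⟨k', hk'⟩ := h1 W.obj hW k.hom
      exact ⟨ObjectProperty.homMk k', ObjectProperty.hom_ext _ hk'⟩
    · exact ObjectProperty.hom_ext _ (h2 W.obj W.property w.hom (congrArg (·.hom) hw))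

theorem Subcat.within_isCoreflective_iff (hle : P.prop ≤ Q.prop) :
    (P.within Q).IsCoreflective ↔ CoreflectiveIn P.prop Q.prop := by
  rw [Subcat.isCoreflective_iff]
  constructor
  · intro h X hX
    obtain ⟨Z, hZ, g, h1⟩ := h ⟨X, hX⟩ trivial
    refine ⟨Z.obj, hZ, g.hom, fun W hW k => ?_⟩
    obtain ⟨k', hk', hu⟩ := h1 ⟨W, hle W hW⟩ hW (ObjectProperty.homMk k)
    exact ⟨k'.hom, congrArg (·.hom) hk', fun y hy =>
      congrArg (·.hom) (hu (ObjectProperty.homMk y) (ObjectProperty.hom_ext _ hy))⟩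
  · intro h X _
    obtain ⟨Z, hZ, g, h1⟩ := h X.obj X.property
    refine ⟨⟨Z, hle Z hZ⟩, hZ, ObjectProperty.homMk g, fun W hW k => ?_⟩
    obtain ⟨k', hk', hu⟩ := h1 W.obj hW k.hom
    exact ⟨ObjectProperty.homMk k', ObjectProperty.hom_ext _ hk', fun y hy =>
      ObjectProperty.hom_ext _ (hu y.hom (congrArg (·.hom) hy))⟩

theorem Subcat.within_isReflective_iff (hle : P.prop ≤ Q.prop) :
    (P.within Q).IsReflective ↔ ReflectiveIn P.prop Q.prop := by
  rw [Subcat.isReflective_iff]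
  constructor
  · intro h X hX
    obtain ⟨Z, hZ, g, h1⟩ := h ⟨X, hX⟩ trivial
    refine ⟨Z.obj, hZ, g.hom, fun W hW k => ?_⟩
    obtain ⟨k', hk', hu⟩ := h1 ⟨W, hle W hW⟩ hW (ObjectProperty.homMk k)
    exact ⟨k'.hom, congrArg (·.hom) hk', fun y hy =>
      congrArg (·.hom) (hu (ObjectProperty.homMk y) (ObjectProperty.hom_ext _ hy))⟩
  · intro h X _
    obtain ⟨Z, hZ, g, h1⟩ := h X.obj X.property
    refine ⟨⟨Z, hle Z hZ⟩, hZ, ObjectProperty.homMk g, fun W hW k => ?_⟩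
    obtain ⟨k', hk', hu⟩ := h1 W.obj hW k.hom
    exact ⟨ObjectProperty.homMk k', ObjectProperty.hom_ext _ hk', fun y hy =>
      ObjectProperty.hom_ext _ (hu y.hom (congrArg (·.hom) hy))⟩

theorem Subcat.within_factors_iff (hle : P.prop ≤ Q.prop) {X Y : Q.Cat} (f : X ⟶ Y) :
    Factors (P.within Q).prop f ↔ Factors P.prop f.hom := by
  constructor
  · rintro ⟨Z, hZ, a, b, rfl⟩
    exact ⟨Z.obj, hZ, a.hom, b.hom, rfl⟩
  · rintro ⟨Z, hZ, a, b, hab⟩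
    exact ⟨⟨Z, hle Z hZ⟩, hZ, ObjectProperty.homMk a, ObjectProperty.homMk b,
      ObjectProperty.hom_ext _ hab⟩

theorem Subcat.within_isCosemisimple_iff (hle : P.prop ≤ Q.prop) :
    (P.within Q).IsCosemisimple ↔ CosemisimpleIn P.prop Q.prop := by
  rw [Subcat.isCosemisimple_iff]
  constructor
  · intro h X Y hX hY f hf
    refine (within_factors_iff hle (X := ⟨X, hX⟩) (Y := ⟨Y, hY⟩) (ObjectProperty.homMk f)).1
      (h ⟨X, hX⟩ ⟨Y, hY⟩ trivial trivial (ObjectProperty.homMk f) fun g => ?_)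
    obtain ⟨u, hu, hu'⟩ := hf g.hom
    exact ⟨ObjectProperty.homMk u, (within_factors_iff hle _).2 hu,
      (within_factors_iff hle _).2 hu'⟩
  · intro h X Y _ _ f hf
    refine (within_factors_iff hle f).2 (h X.obj Y.obj X.property Y.property f.hom fun g => ?_)
    obtain ⟨u, hu, hu'⟩ := hf (ObjectProperty.homMk g)
    exact ⟨u.hom, (within_factors_iff hle _).1 hu, (within_factors_iff hle _).1 hu'⟩

theorem Subcat.ext_of_prop (h : P.prop = Q.prop) : P = Q := by
  cases P
  cases Q
  cases h
  rfl

end Adjunctions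

/-! ### Every subcategory corresponds to its trace ideal. -/

namespace ProjGenerator

variable {A : Type u} [Ring A] {𝒞 : Type w} [Category.{v} 𝒞] [Preadditive 𝒞]
  (G : ProjGenerator A 𝒞)

/-- Idempotents split in a category with a generator as in `ProjGenerator`. -/
theorem exists_split_idempotent (G : ProjGenerator A 𝒞) {X : 𝒞} (e : X ⟶ X) (he : e ≫ e = e) :
    ∃ (Y : 𝒞) (s : Y ⟶ X) (r : X ⟶ Y), s ≫ r = 𝟙 Y ∧ r ≫ s = e := by
  obtain ⟨k, p, q, h⟩ := G.gen X
  have hX : ∀ {Z W : 𝒞} (a : Z ⟶ X) (b : X ⟶ W), ∑ i, a ≫ p i ≫ q i ≫ b = a ≫ b := by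
    intro Z W a b
    calc ∑ i, a ≫ p i ≫ q i ≫ b = a ≫ (∑ i, p i ≫ q i) ≫ b := by
          simp [Preadditive.comp_sum, Preadditive.sum_comp]
      _ = a ≫ b := by rw [h, Category.id_comp]
  -- The matrix of `e` with respect to the presentation of `X` as a summand of a power of `T`.
  obtain ⟨Y, p', q', h', hE⟩ := G.split (Fin k) (fun i j => q i ≫ e ≫ p j) (fun i j => by
    have := hX (q i ≫ e) (e ≫ p j)
    simp only [Category.assoc] at this ⊢
    rw [this, reassoc_of% he])
  have hq : ∀ j, q' j = ∑ l, q j ≫ e ≫ p l ≫ q' l := by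
    intro j
    calc q' j = q' j ≫ ∑ l, p' l ≫ q' l := by rw [h', Category.comp_id]
      _ = ∑ l, (q' j ≫ p' l) ≫ q' l := by simp [Preadditive.comp_sum]
      _ = _ := by simp [hE]
  refine ⟨Y, ∑ i, p' i ≫ q i, ∑ i, p i ≫ q' i, ?_, ?_⟩
  · have hr : ∑ j, p j ≫ q' j = ∑ l, e ≫ p l ≫ q' l := by
      calc ∑ j, p j ≫ q' j = ∑ j, ∑ l, 𝟙 X ≫ p j ≫ q j ≫ e ≫ p l ≫ q' l := by
            refine Finset.sum_congr rfl fun j _ => ?_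
            conv_lhs => rw [hq j]
            simp [Preadditive.comp_sum]
        _ = ∑ l, e ≫ p l ≫ q' l := by
            rw [Finset.sum_comm]
            refine Finset.sum_congr rfl fun l _ => ?_
            rw [hX (𝟙 X), Category.id_comp]
    rw [hr]
    calc (∑ i, p' i ≫ q i) ≫ ∑ l, e ≫ p l ≫ q' l
        = ∑ i, ∑ l, p' i ≫ (q i ≫ e ≫ p l) ≫ q' l := by
          simp [Preadditive.comp_sum, Preadditive.sum_comp]
          rw [Finset.sum_comm]
      _ = ∑ i, ∑ l, (p' i ≫ q' i) ≫ (p' l ≫ q' l) := by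
          simp [← hE]
      _ = (∑ i, p' i ≫ q' i) ≫ ∑ l, p' l ≫ q' l := by
          simp only [Preadditive.comp_sum, Preadditive.sum_comp]
          rw [Finset.sum_comm]
      _ = 𝟙 Y := by rw [h', Category.comp_id]
  · calc (∑ i, p i ≫ q' i) ≫ ∑ l, p' l ≫ q l
        = ∑ l, ∑ i, p i ≫ (q' i ≫ p' l) ≫ q l := by
          simp [Preadditive.comp_sum, Preadditive.sum_comp]
      _ = ∑ l, ∑ i, 𝟙 X ≫ p i ≫ q i ≫ (e ≫ p l ≫ q l) := by simp [hE]
      _ = ∑ l, e ≫ p l ≫ q l :=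
          Finset.sum_congr rfl fun l _ => by rw [hX (𝟙 X), Category.id_comp]
      _ = e := by simpa using hX e (𝟙 X)

/-- A subcategory is closed under retracts. -/
theorem prop_of_retract (P : Subcat 𝒞) {X Z : 𝒞} (hZ : P.prop Z) (g : X ⟶ Z) (h : Z ⟶ X)
    (hgh : g ≫ h = 𝟙 X) (G : ProjGenerator A 𝒞) : P.prop X := by
  have hid : h ≫ g ≫ h ≫ g = h ≫ g := by rw [reassoc_of% hgh]
  -- Closure under summands asks for a biproduct, so the retract needs a complement: the image of
  -- the complementary idempotent.
  obtain ⟨Y, s, r, hsr, hrs⟩ := G.exists_split_idempotent (𝟙 Z - h ≫ g) (by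
    simp [Preadditive.comp_sub, Preadditive.sub_comp, hid])
  have hsh : s ≫ h = 0 := by
    calc s ≫ h = (s ≫ r) ≫ s ≫ h := by rw [hsr, Category.id_comp]
      _ = s ≫ (r ≫ s) ≫ h := by simp
      _ = 0 := by simp [hrs, Preadditive.sub_comp, hgh]
  have hgr : g ≫ r = 0 := by
    calc g ≫ r = g ≫ r ≫ s ≫ r := by rw [hsr, Category.comp_id]
      _ = g ≫ (r ≫ s) ≫ r := by simp
      _ = 0 := by simp [hrs, Preadditive.sub_comp, reassoc_of% hgh]
  refine P.summand (Y := Y)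
    { pt := Z, fst := h, snd := r, inl := g, inr := s,
      inl_fst := hgh, inl_snd := hgr, inr_fst := hsh, inr_snd := hsr } ⟨?_⟩ hZ
  refine isBinaryBilimitOfTotal _ ?_
  change h ≫ g + r ≫ s = 𝟙 Z
  rw [hrs]
  abel

theorem comp_mem_subcat_ideal (P : Subcat 𝒞) {X Y Z W : 𝒞} (a : X ⟶ Y) {f : Y ⟶ Z} (b : Z ⟶ W)
    (hf : f ∈ P.ideal Y Z) : a ≫ f ≫ b ∈ P.ideal X W := by
  obtain ⟨V, hV, g, h, rfl⟩ := hf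
  exact ⟨V, hV, a ≫ g, h ≫ b, by simp⟩

/-- The trace ideal of a subcategory. -/
def trace (P : Subcat 𝒞) : TwoSidedIdeal A :=
  TwoSidedIdeal.mk' {a | G.θ a ∈ P.ideal G.T G.T}
    (by simp)
    (fun {a b} ha hb => by simpa using (P.ideal _ _).add_mem ha hb)
    (fun {a} ha => by simpa using (P.ideal _ _).neg_mem ha)
    (fun {a b} hb => by
      simpa [G.θ_mul] using comp_mem_subcat_ideal P (𝟙 _) (G.θ a) hb)
    (fun {a b} ha => by
      simpa [G.θ_mul] using comp_mem_subcat_ideal P (G.θ b) (𝟙 _) ha)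

theorem mem_trace_iff {P : Subcat 𝒞} {a : A} : a ∈ G.trace P ↔ G.θ a ∈ P.ideal G.T G.T := by
  simp [trace]

theorem mem_ideal_trace_iff {P : Subcat 𝒞} {X Y : 𝒞} {f : X ⟶ Y} :
    f ∈ G.ideal (G.trace P) X Y ↔ f ∈ P.ideal X Y := by
  constructor
  · intro hf
    obtain ⟨k, p, q, h⟩ := G.gen X
    obtain ⟨k', p', q', h'⟩ := G.gen Y
    have : f = ∑ i, ∑ j, p i ≫ (q i ≫ f ≫ p' j) ≫ q' j := by
      calc f = (∑ i, p i ≫ q i) ≫ f ≫ ∑ j, p' j ≫ q' j := by simp [h, h']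
        _ = _ := by
          simp [Preadditive.comp_sum, Preadditive.sum_comp]
          rw [Finset.sum_comm]
    rw [this]
    refine (P.ideal _ _).sum_mem fun i _ => (P.ideal _ _).sum_mem fun j _ =>
      comp_mem_subcat_ideal P _ _ ?_
    have := G.mem_trace_iff.1 (hf (q i) (p' j))
    rwa [AddEquiv.apply_symm_apply] at this
  · intro hf q p
    rw [mem_trace_iff, AddEquiv.apply_symm_apply]
    exact comp_mem_subcat_ideal P q p hf

theorem isAdd_trace (P : Subcat 𝒞) : G.IsAdd P.prop (G.trace P) where
  prop_iff X := by
    rw [mem_ideal_trace_iff]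
    constructor
    · intro hX
      exact ⟨X, hX, 𝟙 X, 𝟙 X, by simp⟩
    · rintro ⟨Z, hZ, g, h, hgh⟩
      exact prop_of_retract P hZ g h hgh G
  factors f hf := by
    obtain ⟨Z, hZ, g, h, hgh⟩ := G.mem_ideal_trace_iff.1 hf
    exact ⟨Z, hZ, g, h, hgh⟩

end ProjGenerator

/-! ### The category `proj A` and its generator `A`. -/

section ProjCat

variable {A : Type u} [Ring A]

/-- The right regular module of `A` is free of rank one. -/
def opEquiv (A : Type u) [Ring A] : A ≃ₗ[Aᵐᵒᵖ] Aᵐᵒᵖ :=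
  { MulOpposite.opAddEquiv with map_smul' := fun _ _ => rfl }

instance : Module.Finite Aᵐᵒᵖ A := Module.Finite.equiv (opEquiv A).symm

instance : Module.Free Aᵐᵒᵖ A := Module.Free.of_equiv (opEquiv A).symm

/-- The finitely generated projective module `M` as an object of `proj A`. -/
abbrev projObj (M : Type u) [AddCommGroup M] [Module Aᵐᵒᵖ M] [h : Module.Finite Aᵐᵒᵖ M]
    [h' : Module.Projective Aᵐᵒᵖ M] : ProjCat A := ⟨ModuleCat.of Aᵐᵒᵖ M, h, h'⟩

/-- A linear map as a morphism of `proj A`. -/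
abbrev projHom {X Y : ProjCat A} (f : X.obj →ₗ[Aᵐᵒᵖ] Y.obj) : X ⟶ Y :=
  ObjectProperty.homMk (ModuleCat.ofHom f)

theorem projHom_ext {X Y : ProjCat A} {f g : X ⟶ Y} (h : ∀ x, f.hom.hom x = g.hom.hom x) :
    f = g :=
  ObjectProperty.hom_ext _ (ModuleCat.hom_ext (LinearMap.ext h))

/-- The underlying linear map, additively. -/
def projHomLinear (X Y : ProjCat A) : (X ⟶ Y) →+ (X.obj →ₗ[Aᵐᵒᵖ] Y.obj) where
  toFun f := f.hom.hom
  map_zero' := rfl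
  map_add' _ _ := rfl

theorem sum_hom_apply {ι : Type*} (s : Finset ι) {X Y : ProjCat A} (f : ι → (X ⟶ Y)) (x : X.obj) :
    (∑ i ∈ s, f i).hom.hom x = ∑ i ∈ s, (f i).hom.hom x := by
  have := congrArg (fun g => g x) (map_sum (projHomLinear X Y) f s)
  rwa [LinearMap.sum_apply] at this

/-- Left multiplication as an endomorphism of the right regular module. -/
def leftMul (a : A) : A →ₗ[Aᵐᵒᵖ] A where
  toFun x := a * x
  map_add' := mul_add a
  map_smul' r x := (mul_assoc a x r.unop).symm

theorem apply_eq_mul (f : A →ₗ[Aᵐᵒᵖ] A) (x : A) : f x = f 1 * x := by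
  have := f.map_smul (MulOpposite.op x) 1
  simpa using this

/-- The right regular module generates `proj A`. -/
def projGenerator (A : Type u) [Ring A] : ProjGenerator A (ProjCat A) where
  T := projObj A
  θ :=
    { toFun := fun a => projHom (X := projObj A) (Y := projObj A) (leftMul a)
      invFun := fun f => f.hom.hom (1 : A)
      left_inv := fun a => mul_one a
      right_inv := fun f => projHom_ext fun x => (apply_eq_mul f.hom.hom x).symm
      map_add' := fun a b => projHom_ext fun x => add_mul a b x }
  θ_mul a b := projHom_ext fun x => mul_assoc a b x
  gen X := by
    have h1 : Module.Finite Aᵐᵒᵖ X.obj := X.property.1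
    have h2 : Module.Projective Aᵐᵒᵖ X.obj := X.property.2
    obtain ⟨k, f, hf⟩ := Module.Finite.exists_fin' Aᵐᵒᵖ X.obj
    obtain ⟨s, hs⟩ := Module.projective_lifting_property f LinearMap.id hf
    refine ⟨k, fun i => projHom (Y := projObj A)
      ((opEquiv A).symm.toLinearMap ∘ₗ LinearMap.proj i ∘ₗ s),
      fun i => projHom (X := projObj A)
        (f ∘ₗ LinearMap.single Aᵐᵒᵖ (fun _ => Aᵐᵒᵖ) i ∘ₗ (opEquiv A).toLinearMap),
      projHom_ext fun x => ?_⟩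
    rw [sum_hom_apply]
    change ∑ i, f (Pi.single i ((opEquiv A) ((opEquiv A).symm (s x i)))) = x
    simp only [LinearEquiv.apply_symm_apply]
    rw [← map_sum, Finset.univ_sum_single]
    exact congrArg (fun g => g x) hs
  split ι _ E hE := by
    classical
    -- The matrix acts as an idempotent on `A^ι`, and its image is the object sought.
    let e : (ι → A) →ₗ[Aᵐᵒᵖ] (ι → A) := LinearMap.pi fun j =>
      ∑ i, (E i j).hom.hom ∘ₗ LinearMap.proj i
    have he : ∀ x j, e x j = ∑ i, (E i j).hom.hom (x i) := fun x j => by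
      simp only [e, LinearMap.pi_apply, LinearMap.sum_apply]
      rfl
    have hee : ∀ x, e (e x) = e x := fun x => by
      ext j
      rw [he, he]
      simp only [he, map_sum]
      rw [Finset.sum_comm]
      refine Finset.sum_congr rfl fun i _ => ?_
      rw [← hE i j, sum_hom_apply]
      rfl
    have hfix : ∀ z : LinearMap.range e, e z = z := by
      rintro ⟨_, x, rfl⟩
      exact hee x
    have : Module.Projective Aᵐᵒᵖ (LinearMap.range e) :=
      Module.Projective.of_split (LinearMap.range e).subtype e.rangeRestrict
        (LinearMap.ext fun z => Subtype.ext (hfix z))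
    refine ⟨projObj (LinearMap.range e),
      fun i => projHom (Y := projObj A) (LinearMap.proj i ∘ₗ (LinearMap.range e).subtype),
      fun i => projHom (X := projObj A) (e.rangeRestrict ∘ₗ LinearMap.single Aᵐᵒᵖ (fun _ => A) i),
      projHom_ext fun z => ?_, fun i j => projHom_ext fun a => ?_⟩
    · rw [sum_hom_apply]
      change ∑ i, e.rangeRestrict (Pi.single i ((z : LinearMap.range e).1 i)) = z
      rw [← map_sum, Finset.univ_sum_single]
      exact Subtype.ext (hfix z)
    · change e (Pi.single i (a : A)) j = (E i j).hom.hom a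
      rw [he]
      refine (Finset.sum_eq_single i (fun l _ hl => ?_) (by simp)).trans ?_
      · rw [Pi.single_eq_of_ne hl, map_zero]
      · rw [Pi.single_eq_same]

/-- A map `ψ : eA → A` takes `y` to `ψ(e) * e * y`, so whatever factors through `add eA` lies in
`AeA`. Conversely, left multiplication by `e` factors through `eA`. -/
theorem trace_addIdem {e : A} (he : IsIdempotentElem e) :
    (projGenerator A).trace (addIdem e) = TwoSidedIdeal.span {e} := by
  apply le_antisymm
  · intro a ha
    obtain ⟨X, ⟨k, N, ⟨φ⟩⟩, g, h, hgh⟩ := (projGenerator A).mem_trace_iff.1 ha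
    let ψ : Fin k → (rightIdeal e →ₗ[Aᵐᵒᵖ] A) := fun i =>
      h.hom.hom ∘ₗ LinearMap.fst Aᵐᵒᵖ X.obj N ∘ₗ φ.symm.toLinearMap ∘ₗ
        LinearMap.single Aᵐᵒᵖ (fun _ => rightIdeal e) i
    let e' : rightIdeal e := ⟨e, Submodule.mem_span_singleton_self e⟩
    have hψ : ∀ i y, ψ i y ∈ TwoSidedIdeal.span {e} := by
      intro i y
      have hy : MulOpposite.op (e * (y : A)) • e' = y :=
        Subtype.ext (by
          change e * (e * (y : A)) = y
          rw [(mem_rightIdeal_iff he).1 y.2, (mem_rightIdeal_iff he).1 y.2])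
      rw [← hy, map_smul]
      change ψ i e' * (e * (y : A)) ∈ _
      exact TwoSidedIdeal.mul_mem_left _ _ _ (TwoSidedIdeal.mul_mem_right _ _ _
        (TwoSidedIdeal.subset_span rfl))
    let x : X.obj := g.hom.hom (1 : A)
    have h1 : h.hom.hom x = a :=
      (congrArg (fun k : (projGenerator A).T ⟶ (projGenerator A).T => k.hom.hom (1 : A)) hgh).trans
        (mul_one a)
    have h2 : a = ∑ i, ψ i (φ (x, 0) i) := by
      have h3 : φ.symm (∑ i, Pi.single i (φ (x, 0) i)) = (x, 0) := by
        rw [Finset.univ_sum_single, LinearEquiv.symm_apply_apply]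
      rw [map_sum] at h3
      have h4 := congrArg (fun z => h.hom.hom (LinearMap.fst Aᵐᵒᵖ X.obj N z)) h3
      simp only [map_sum] at h4
      exact (h4.trans h1).symm
    rw [h2]
    exact sum_mem fun i _ => hψ i _
  · rw [TwoSidedIdeal.span_le]
    intro b hb
    rw [Set.mem_singleton_iff] at hb
    subst b
    rw [SetLike.mem_coe, ProjGenerator.mem_trace_iff]
    have hr : ∀ y : rightIdeal e, e * (y : A) = y := fun y => (mem_rightIdeal_iff he).1 y.2
    let r : A →ₗ[Aᵐᵒᵖ] rightIdeal e := (leftMul e).codRestrict (rightIdeal e) fun x =>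
      (mem_rightIdeal_iff he).2 (by
        change e * (e * x) = e * x
        rw [← mul_assoc, he.eq])
    have hrs : r ∘ₗ (rightIdeal e).subtype = LinearMap.id :=
      LinearMap.ext fun y => Subtype.ext (hr y)
    have : Module.Projective Aᵐᵒᵖ (rightIdeal e) :=
      Module.Projective.of_split (rightIdeal e).subtype r hrs
    refine ⟨projObj (rightIdeal e), ⟨1, ModuleCat.of Aᵐᵒᵖ PUnit.{u + 1}, ⟨?_⟩⟩,
      projHom (X := projObj A) r, projHom (Y := projObj A) (rightIdeal e).subtype, ?_⟩
    · change (rightIdeal e × PUnit.{u + 1}) ≃ₗ[Aᵐᵒᵖ] (Fin 1 → rightIdeal e)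
      exact LinearEquiv.prodUnique.trans (LinearEquiv.funUnique (Fin 1) Aᵐᵒᵖ _).symm
    · exact projHom_ext fun x => rfl

theorem isAdd_addIdem {e : A} (he : IsIdempotentElem e) :
    (projGenerator A).IsAdd (addIdem e).prop (TwoSidedIdeal.span {e}) :=
  trace_addIdem he ▸ (projGenerator A).isAdd_trace (addIdem e)

end ProjCat

/-! ### Chains of subcategories. -/

section Chains

variable {𝒞 : Type w} [Category.{v} 𝒞] [Preadditive 𝒞] {n : ℕ} {C : ℕ → Subcat 𝒞}

theorem IsSubcatChain.isTotalRightRejectiveChain_iff (h : IsSubcatChain n C) :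
    IsTotalRightRejectiveChain n C ↔ (∀ i < n, RightRejectiveIn (C (i + 1)).prop ⊤) ∧
      ∀ i < n, CosemisimpleIn (C (i + 1)).prop (C i).prop :=
  ⟨fun H => ⟨fun i hi => (C (i + 1)).isRightRejective_iff.1 (H.rejective i hi),
      fun i hi => (Subcat.within_isCosemisimple_iff (h.le i hi)).1 (H.cosemisimple i hi)⟩,
    fun H => ⟨h, fun i hi => (C (i + 1)).isRightRejective_iff.2 (H.1 i hi),
      fun i hi => (Subcat.within_isCosemisimple_iff (h.le i hi)).2 (H.2 i hi)⟩⟩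

theorem IsSubcatChain.isTotalLeftRejectiveChain_iff (h : IsSubcatChain n C) :
    IsTotalLeftRejectiveChain n C ↔ (∀ i < n, LeftRejectiveIn (C (i + 1)).prop ⊤) ∧
      ∀ i < n, CosemisimpleIn (C (i + 1)).prop (C i).prop :=
  ⟨fun H => ⟨fun i hi => (C (i + 1)).isLeftRejective_iff.1 (H.rejective i hi),
      fun i hi => (Subcat.within_isCosemisimple_iff (h.le i hi)).1 (H.cosemisimple i hi)⟩,
    fun H => ⟨h, fun i hi => (C (i + 1)).isLeftRejective_iff.2 (H.1 i hi),
      fun i hi => (Subcat.within_isCosemisimple_iff (h.le i hi)).2 (H.2 i hi)⟩⟩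

theorem IsSubcatChain.isCoreflectiveChain_iff (h : IsSubcatChain n C) :
    IsCoreflectiveChain n C ↔ (∀ i < n, CoreflectiveIn (C (i + 1)).prop (C i).prop) ∧
      ∀ i < n, CosemisimpleIn (C (i + 1)).prop (C i).prop :=
  ⟨fun H =>
    ⟨fun i hi => (Subcat.within_isCoreflective_iff (h.le i hi)).1 (H.coreflective i hi),
      fun i hi => (Subcat.within_isCosemisimple_iff (h.le i hi)).1 (H.cosemisimple i hi)⟩,
    fun H => ⟨h, fun i hi => (Subcat.within_isCoreflective_iff (h.le i hi)).2 (H.1 i hi),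
      fun i hi => (Subcat.within_isCosemisimple_iff (h.le i hi)).2 (H.2 i hi)⟩⟩

theorem IsSubcatChain.isReflectiveChain_iff (h : IsSubcatChain n C) :
    IsReflectiveChain n C ↔ (∀ i < n, ReflectiveIn (C (i + 1)).prop (C i).prop) ∧
      ∀ i < n, CosemisimpleIn (C (i + 1)).prop (C i).prop :=
  ⟨fun H => ⟨fun i hi => (Subcat.within_isReflective_iff (h.le i hi)).1 (H.reflective i hi),
      fun i hi => (Subcat.within_isCosemisimple_iff (h.le i hi)).1 (H.cosemisimple i hi)⟩,
    fun H => ⟨h, fun i hi => (Subcat.within_isReflective_iff (h.le i hi)).2 (H.1 i hi),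
      fun i hi => (Subcat.within_isCosemisimple_iff (h.le i hi)).2 (H.2 i hi)⟩⟩

theorem IsSubcatChain.isRejectiveChain_iff (h : IsSubcatChain n C) :
    IsRejectiveChain n C ↔ (∀ i < n, RightRejectiveIn (C (i + 1)).prop (C i).prop ∧
        LeftRejectiveIn (C (i + 1)).prop (C i).prop) ∧
      ∀ i < n, CosemisimpleIn (C (i + 1)).prop (C i).prop :=
  ⟨fun H => ⟨fun i hi => ⟨(Subcat.within_isRightRejective_iff (h.le i hi)).1 (H.rejective i hi).1,
        (Subcat.within_isLeftRejective_iff (h.le i hi)).1 (H.rejective i hi).2⟩,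
      fun i hi => (Subcat.within_isCosemisimple_iff (h.le i hi)).1 (H.cosemisimple i hi)⟩,
    fun H => ⟨h, fun i hi => ⟨(Subcat.within_isRightRejective_iff (h.le i hi)).2 (H.1 i hi).1,
        (Subcat.within_isLeftRejective_iff (h.le i hi)).2 (H.1 i hi).2⟩,
      fun i hi => (Subcat.within_isCosemisimple_iff (h.le i hi)).2 (H.2 i hi)⟩⟩

theorem LeftRejectiveIn.mono {P Q Q' : ObjectProperty 𝒞} (h : LeftRejectiveIn P Q)
    (hle : Q' ≤ Q) : LeftRejectiveIn P Q' := by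
  intro X hX
  obtain ⟨Z, hZ, g, h1, h2⟩ := h X (hle X hX)
  exact ⟨Z, hZ, g, h1, fun W hW => h2 W (hle W hW)⟩

theorem LeftRejectiveIn.trans {P Q Q' : ObjectProperty 𝒞} (h : LeftRejectiveIn P Q)
    (h' : LeftRejectiveIn Q Q') (hr : RightRejectiveIn Q Q') (hPQ : P ≤ Q) (hQ : Q ≤ Q') :
    LeftRejectiveIn P Q' :=
  ProjGenerator.rightRejectiveIn_op_iff.1
    ((ProjGenerator.rightRejectiveIn_op_iff.2 h).trans (ProjGenerator.rightRejectiveIn_op_iff.2 h')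
      (ProjGenerator.leftRejectiveIn_op_iff.2 hr) (fun _ hX => hPQ _ hX) fun _ hX => hQ _ hX)

/-- Removal of the repetitions in a chain. -/
theorem exists_chain_ne {α : Type*} (r : α → α → Prop) (n : ℕ) (C : ℕ → α)
    (h : ∀ i < n, r (C (i + 1)) (C i)) :
    ∃ (m : ℕ) (D : ℕ → α), D 0 = C 0 ∧ D m = C n ∧
      ∀ i < m, r (D (i + 1)) (D i) ∧ D (i + 1) ≠ D i := by
  induction n generalizing C with
  | zero => exact ⟨0, C, rfl, rfl, fun i hi => absurd hi (Nat.not_lt_zero i)⟩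
  | succ n ih =>
    obtain ⟨m, D, h0, hm, hD⟩ := ih (fun i => C (i + 1)) fun i hi => h (i + 1) (by omega)
    by_cases heq : C 1 = C 0
    · exact ⟨m, D, h0.trans heq, hm, hD⟩
    · refine ⟨m + 1, fun i => Nat.casesOn i (C 0) D, rfl, hm, fun i hi => ?_⟩
      cases i with
      | zero =>
        change r (D 0) (C 0) ∧ D 0 ≠ C 0
        rw [h0]
        exact ⟨h 0 (by omega), heq⟩
      | succ i => exact hD i (by omega)

end Chains

/-! ### Chains of ideals. -/

section Ideals

variable {A : Type u} [Ring A] {n : ℕ} {H : ℕ → TwoSidedIdeal A}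

theorem IsIdempotentIdealChain.isRightStronglyHeredityChain_iff [IsNoetherianRing Aᵐᵒᵖ]
    (h : IsIdempotentIdealChain n H) : IsRightStronglyHeredityChain n H ↔
      (∀ i < n, RelProj (H i) ⊥) ∧ ∀ i < n, RelJac (H i) (H (i + 1)) :=
  ⟨fun H' => ⟨fun i hi => relProj_bot_iff.2 (H'.proj i hi),
      fun i hi => (relJac_iff _ _).2 (H'.mul_jacobson_mul i hi)⟩,
    fun H' => ⟨h, fun i hi => relProj_bot_iff.1 (H'.1 i hi),
      fun i hi => (relJac_iff _ _).1 (H'.2 i hi)⟩⟩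

theorem IsIdempotentIdealChain.isLeftStronglyHeredityChain_iff [IsNoetherianRing A]
    (h : IsIdempotentIdealChain n H) : IsLeftStronglyHeredityChain n H ↔
      (∀ i < n, RelProj (H i).op ⊥) ∧ ∀ i < n, RelJac (H i) (H (i + 1)) :=
  ⟨fun H' => ⟨fun i hi => relProj_op_bot_iff.2 (H'.proj i hi),
      fun i hi => (relJac_iff _ _).2 (H'.mul_jacobson_mul i hi)⟩,
    fun H' => ⟨h, fun i hi => relProj_op_bot_iff.1 (H'.1 i hi),
      fun i hi => (relJac_iff _ _).1 (H'.2 i hi)⟩⟩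

theorem IsIdempotentIdealChain.isHeredityChain_iff [IsNoetherianRing Aᵐᵒᵖ]
    (h : IsIdempotentIdealChain n H) : IsHeredityChain n H ↔
      (∀ i < n, RelProj (H i) (H (i + 1))) ∧ ∀ i < n, RelJac (H i) (H (i + 1)) := by
  have hN : ∀ I : TwoSidedIdeal A, IsNoetherianRing I.ringCon.Quotientᵐᵒᵖ := fun I =>
    isNoetherianRing_of_surjective Aᵐᵒᵖ _ (RingHom.op I.ringCon.mk') fun x => by
      obtain ⟨a, ha⟩ := RingCon.mk'_surjective I.ringCon x.unop
      exact ⟨MulOpposite.op a, congrArg MulOpposite.op ha⟩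
  constructor
  · intro H'
    refine ⟨fun i hi => ?_, fun i hi => (relJac_iff _ _).2 (H'.heredity i hi).mul_jacobson_mul⟩
    have := hN (H (i + 1))
    rw [← relProj_quotIdeal_iff (h.lt i hi).le, relProj_bot_iff]
    exact (H'.heredity i hi).proj
  · rintro ⟨h1, h2⟩
    refine ⟨h, fun i hi => ⟨(h.idem i hi.le).quot _, ?_, (relJac_iff _ _).1 (h2 i hi)⟩⟩
    have := hN (H (i + 1))
    rw [← relProj_bot_iff, relProj_quotIdeal_iff (h.lt i hi).le]
    exact h1 i hi

theorem isSubcatChain_of_isAdd {C : ℕ → Subcat (ProjCat A)} (h : IsIdempotentIdealChain n H)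
    (hadd : ∀ i ≤ n, (projGenerator A).IsAdd (C i).prop (H i)) : IsSubcatChain n C where
  whole X := by
    rw [(hadd 0 (Nat.zero_le n)).prop_iff, h.whole]
    exact fun _ _ => trivial
  le i hi := (hadd i hi.le).mono (hadd (i + 1) hi) (h.lt i hi).le
  zero X hX := by
    rw [(hadd n le_rfl).prop_iff, h.zero, ProjGenerator.mem_ideal_bot] at hX
    exact (IsZero.iff_id_eq_zero X).2 hX

/-- A subcategory is determined by its trace ideal, so distinct subcategories give strict
inclusions. -/
theorem isIdempotentIdealChain_trace {C : ℕ → Subcat (ProjCat A)} (h : IsSubcatChain n C)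
    (hne : ∀ i < n, C (i + 1) ≠ C i) :
    IsIdempotentIdealChain n fun i => (projGenerator A).trace (C i) := by
  have hadd := fun i => (projGenerator A).isAdd_trace (C i)
  refine ⟨?_, fun i hi => ?_, ?_, fun i _ => (hadd i).isIdempotentIdeal⟩
  · rw [eq_top_iff]
    intro a _
    rw [ProjGenerator.mem_trace_iff]
    exact ⟨_, h.whole _, 𝟙 _, _, Category.id_comp _⟩
  · refine lt_of_le_of_ne ((hadd i).le_of_le (hadd (i + 1)) (h.le i hi)) fun heq => hne i hi ?_
    apply Subcat.ext_of_prop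
    exact le_antisymm (h.le i hi) ((hadd (i + 1)).mono (hadd i) heq.ge)
  · rw [eq_bot_iff]
    intro a ha
    obtain ⟨Z, hZ, g, k, hgk⟩ := (projGenerator A).mem_trace_iff.1 ha
    rw [(h.zero Z hZ).eq_of_src k 0, comp_zero] at hgk
    exact (TwoSidedIdeal.mem_bot A).2 (((projGenerator A).θ.map_eq_zero_iff).1 hgk.symm)

theorem isIdempotentIdealChain_op_iff :
    IsIdempotentIdealChain n (fun i => (H i).op) ↔ IsIdempotentIdealChain n H := by
  have htop : (⊤ : TwoSidedIdeal A).op = ⊤ := eq_top_iff.2 fun _ _ => trivial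
  have hbot : (⊥ : TwoSidedIdeal A).op = ⊥ := TwoSidedIdeal.ext fun x => by
    simp [TwoSidedIdeal.mem_bot]
  have hinj : ∀ {I J : TwoSidedIdeal A}, I.op = J.op → I = J := fun h =>
    TwoSidedIdeal.opOrderIso.injective h
  exact ⟨fun h => ⟨hinj (h.whole.trans htop.symm),
      fun i hi => TwoSidedIdeal.opOrderIso.lt_iff_lt.1 (h.lt i hi),
      hinj (h.zero.trans hbot.symm), fun i hi => isIdempotentIdeal_op_iff.1 (h.idem i hi)⟩,
    fun h => ⟨(congrArg _ h.whole).trans htop,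
      fun i hi => TwoSidedIdeal.opOrderIso.lt_iff_lt.2 (h.lt i hi),
      (congrArg _ h.zero).trans hbot, fun i hi => isIdempotentIdeal_op_iff.2 (h.idem i hi)⟩⟩

end Ideals

/-! ### The equivalences for artin algebras. -/

section ArtinAlgebra

variable (R : Type w) {A : Type u} [CommRing R] [IsArtinianRing R] [Ring A] [Algebra R A]
  [Module.Finite R A] {n : ℕ} {H : ℕ → TwoSidedIdeal A} {C : ℕ → Subcat (ProjCat A)}

include R

theorem tfae_rightStrongly (hH : IsIdempotentIdealChain n H)
    (hadd : ∀ i ≤ n, (projGenerator A).IsAdd (C i).prop (H i)) :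
    List.TFAE
      [IsRightStronglyHeredityChain n H, IsTotalRightRejectiveChain n C,
        IsHeredityChain n H ∧ IsCoreflectiveChain n C] := by
  have : IsArtinianRing Aᵐᵒᵖ := IsArtinianRing.of_finite R Aᵐᵒᵖ
  have hC := isSubcatChain_of_isAdd hH hadd
  rw [hH.isRightStronglyHeredityChain_iff, hC.isTotalRightRejectiveChain_iff,
    hH.isHeredityChain_iff, hC.isCoreflectiveChain_iff]
  exact ProjGenerator.tfae_right hadd hH.whole (fun i hi => (hH.lt i hi).le) hH.zero

theorem tfae_leftStrongly (hH : IsIdempotentIdealChain n H)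
    (hadd : ∀ i ≤ n, (projGenerator A).IsAdd (C i).prop (H i)) :
    List.TFAE
      [IsLeftStronglyHeredityChain n H, IsTotalLeftRejectiveChain n C,
        IsHeredityChain n H ∧ IsReflectiveChain n C] := by
  have : IsArtinianRing Aᵐᵒᵖ := IsArtinianRing.of_finite R Aᵐᵒᵖ
  have : IsArtinianRing A := IsArtinianRing.of_finite R A
  have hC := isSubcatChain_of_isAdd hH hadd
  rw [hH.isLeftStronglyHeredityChain_iff, hC.isTotalLeftRejectiveChain_iff,
    hH.isHeredityChain_iff, hC.isReflectiveChain_iff]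
  -- Symmetry of heredity ideals, available because each `H i` has the form `AeA`.
  have hop : ((∀ i < n, RelProj (H i) (H (i + 1))) ∧ ∀ i < n, RelJac (H i) (H (i + 1))) ↔
      (∀ i < n, RelProj (H i).op (H (i + 1)).op) ∧ ∀ i < n, RelJac (H i) (H (i + 1)) := by
    refine and_congr_left fun hJ => forall₂_congr fun i hi => ?_
    obtain ⟨e, he, heq⟩ := exists_isIdempotentElem_span (hH.idem i hi.le)
    have hle := (hH.lt i hi).le
    have hJi := hJ i hi
    rw [heq] at hle hJi ⊢
    exact ⟨RelProj.op_of_relJac R he hle hJi, RelProj.of_op_of_relJac R he hle hJi⟩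
  rw [hop]
  exact ProjGenerator.tfae_left hadd hH.whole (fun i hi => (hH.lt i hi).le) hH.zero

theorem exists_isAdd (hH : IsIdempotentIdealChain n H) :
    ∃ C : ℕ → Subcat (ProjCat A), ∀ i ≤ n, (projGenerator A).IsAdd (C i).prop (H i) := by
  have : IsArtinianRing A := IsArtinianRing.of_finite R A
  have : ∀ i, ∃ e, i ≤ n → IsIdempotentElem e ∧ H i = TwoSidedIdeal.span {e} := by
    intro i
    by_cases hi : i ≤ n
    · obtain ⟨e, he⟩ := exists_isIdempotentElem_span (hH.idem i hi)
      exact ⟨e, fun _ => he⟩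
    · exact ⟨0, fun h => absurd h hi⟩
  choose e he using this
  exact ⟨fun i => addIdem (e i), fun i hi => (he i hi).2 ▸ isAdd_addIdem (he i hi).1⟩

theorem exists_rightStrongly_iff :
    (∃ (n : ℕ) (H : ℕ → TwoSidedIdeal A), IsRightStronglyHeredityChain n H) ↔
      ∃ (n : ℕ) (C : ℕ → Subcat (ProjCat A)), IsTotalRightRejectiveChain n C := by
  constructor
  · rintro ⟨n, H, hH⟩
    obtain ⟨C, hC⟩ := exists_isAdd R hH.chain
    exact ⟨n, C, ((tfae_rightStrongly R hH.chain hC).out 0 1).1 hH⟩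
  · rintro ⟨n, C, hC⟩
    -- A chain of subcategories may repeat, a chain of ideals may not. All conditions concern
    -- consecutive members, so they survive the removal of repetitions.
    obtain ⟨m, D, h0, hm, hD⟩ := exists_chain_ne
      (fun P Q : Subcat (ProjCat A) => P.prop ≤ Q.prop ∧ P.IsRightRejective ∧
        (P.within Q).IsCosemisimple) n C
      fun i hi => ⟨hC.chain.le i hi, hC.rejective i hi, hC.cosemisimple i hi⟩
    have hchain : IsSubcatChain m D :=
      ⟨h0 ▸ hC.chain.whole, fun i hi => (hD i hi).1.1, hm ▸ hC.chain.zero⟩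
    refine ⟨m, _, ((tfae_rightStrongly R (isIdempotentIdealChain_trace hchain fun i hi =>
      (hD i hi).2) fun i _ => (projGenerator A).isAdd_trace (D i)).out 0 1).2 ?_⟩
    exact ⟨hchain, fun i hi => (hD i hi).1.2.1, fun i hi => (hD i hi).1.2.2⟩

theorem exists_leftStrongly_iff :
    (∃ (n : ℕ) (H : ℕ → TwoSidedIdeal A), IsLeftStronglyHeredityChain n H) ↔
      ∃ (n : ℕ) (C : ℕ → Subcat (ProjCat A)), IsTotalLeftRejectiveChain n C := by
  constructor
  · rintro ⟨n, H, hH⟩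
    obtain ⟨C, hC⟩ := exists_isAdd R hH.chain
    exact ⟨n, C, ((tfae_leftStrongly R hH.chain hC).out 0 1).1 hH⟩
  · rintro ⟨n, C, hC⟩
    obtain ⟨m, D, h0, hm, hD⟩ := exists_chain_ne
      (fun P Q : Subcat (ProjCat A) => P.prop ≤ Q.prop ∧ P.IsLeftRejective ∧
        (P.within Q).IsCosemisimple) n C
      fun i hi => ⟨hC.chain.le i hi, hC.rejective i hi, hC.cosemisimple i hi⟩
    have hchain : IsSubcatChain m D :=
      ⟨h0 ▸ hC.chain.whole, fun i hi => (hD i hi).1.1, hm ▸ hC.chain.zero⟩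
    refine ⟨m, _, ((tfae_leftStrongly R (isIdempotentIdealChain_trace hchain fun i hi =>
      (hD i hi).2) fun i _ => (projGenerator A).isAdd_trace (D i)).out 0 1).2 ?_⟩
    exact ⟨hchain, fun i hi => (hD i hi).1.2.1, fun i hi => (hD i hi).1.2.2⟩

theorem isStronglyQuasiHereditary_iff :
    IsStronglyQuasiHereditary A ↔
      ∃ (n : ℕ) (C : ℕ → Subcat (ProjCat A)), IsRejectiveChain n C := by
  constructor
  · rintro ⟨n, H, -, hr, hl⟩
    obtain ⟨C, hadd⟩ := exists_isAdd R hr.chain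
    have hC := isSubcatChain_of_isAdd hr.chain hadd
    have hr' := hC.isTotalRightRejectiveChain_iff.1
      (((tfae_rightStrongly R hr.chain hadd).out 0 1).1 hr)
    have hl' := hC.isTotalLeftRejectiveChain_iff.1
      (((tfae_leftStrongly R hr.chain hadd).out 0 1).1 hl)
    exact ⟨n, C, hC.isRejectiveChain_iff.2
      ⟨fun i hi => ⟨(hr'.1 i hi).mono le_top, (hl'.1 i hi).mono le_top⟩, hr'.2⟩⟩
  · rintro ⟨n, C, hC⟩
    obtain ⟨m, D, h0, hm, hD⟩ := exists_chain_ne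
      (fun P Q : Subcat (ProjCat A) => P.prop ≤ Q.prop ∧ (P.within Q).IsRejective ∧
        (P.within Q).IsCosemisimple) n C
      fun i hi => ⟨hC.chain.le i hi, hC.rejective i hi, hC.cosemisimple i hi⟩
    have hchain : IsSubcatChain m D :=
      ⟨h0 ▸ hC.chain.whole, fun i hi => (hD i hi).1.1, hm ▸ hC.chain.zero⟩
    have hrej := hchain.isRejectiveChain_iff.1
      ⟨hchain, fun i hi => (hD i hi).1.2.1, fun i hi => (hD i hi).1.2.2⟩
    -- Rejectivity in the preceding member becomes rejectivity in `proj A`. The two sides are proved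
    -- together, since each induction step uses both.
    have htotal : ∀ i < m, RightRejectiveIn (D (i + 1)).prop ⊤ ∧
        LeftRejectiveIn (D (i + 1)).prop ⊤ := by
      intro i hi
      induction i with
      | zero =>
        have htop : (D 0).prop = ⊤ := top_le_iff.1 fun X _ => hchain.whole X
        rw [← htop]
        exact hrej.1 0 hi
      | succ i ih =>
        obtain ⟨h1, h2⟩ := ih (by omega)
        obtain ⟨h3, h4⟩ := hrej.1 (i + 1) hi
        exact ⟨h3.trans h1 h2 (hchain.le _ hi) le_top, h4.trans h2 h1 (hchain.le _ hi) le_top⟩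
    have hH := isIdempotentIdealChain_trace hchain fun i hi => (hD i hi).2
    have hr := tfae_rightStrongly R hH fun i _ => (projGenerator A).isAdd_trace (D i)
    have hl := tfae_leftStrongly R hH fun i _ => (projGenerator A).isAdd_trace (D i)
    have hr' := hchain.isTotalRightRejectiveChain_iff.2 ⟨fun i hi => (htotal i hi).1, hrej.2⟩
    have hl' := hchain.isTotalLeftRejectiveChain_iff.2 ⟨fun i hi => (htotal i hi).2, hrej.2⟩
    have hc := (hr.out 1 2).1 hr'
    exact ⟨m, _, hc.1, (hr.out 1 0).1 hr', (hl.out 1 0).1 hl'⟩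

omit R [CommRing R] [IsArtinianRing R] [Algebra R A] [Module.Finite R A] in
theorem exists_rightStrongly_op_iff [IsNoetherianRing A] :
    (∃ (n : ℕ) (H : ℕ → TwoSidedIdeal Aᵐᵒᵖ), IsRightStronglyHeredityChain n H) ↔
      ∃ (n : ℕ) (H : ℕ → TwoSidedIdeal A), IsLeftStronglyHeredityChain n H := by
  have := isNoetherianRing_of_ringEquiv A (RingEquiv.opOp A)
  constructor
  · rintro ⟨n, H, hH⟩
    have heq : (fun i => (H i).unop.op) = H := funext fun i => rfl
    have hc : IsIdempotentIdealChain n fun i => (H i).unop :=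
      isIdempotentIdealChain_op_iff.1 (heq.symm ▸ hH.chain)
    obtain ⟨h1, h2⟩ := hH.chain.isRightStronglyHeredityChain_iff.1 hH
    exact ⟨n, _, hc.isLeftStronglyHeredityChain_iff.2
      ⟨h1, fun i hi => relJac_op_iff.1 (h2 i hi)⟩⟩
  · rintro ⟨n, H, hH⟩
    obtain ⟨h1, h2⟩ := hH.chain.isLeftStronglyHeredityChain_iff.1 hH
    exact ⟨n, _, (isIdempotentIdealChain_op_iff.2 hH.chain).isRightStronglyHeredityChain_iff.2
      ⟨h1, fun i hi => relJac_op_iff.2 (h2 i hi)⟩⟩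

end ArtinAlgebra

/-! ### Projective covers of simple modules and traces. -/

namespace SimpleSystem

variable {B : Type u} [Ring B] (D : SimpleSystem B)
  {M N : Type u} [AddCommGroup M] [Module B M] [AddCommGroup N] [Module B N]

instance (k : D.I) : IsSimpleModule B (D.S k) := D.simple k

instance (k : D.I) : Module.Projective B (D.P k) := (D.cover k).proj

theorem π_surjective (k : D.I) : Function.Surjective (D.π k) := (D.cover k).surj

theorem isCoatom_ker_π (k : D.I) : IsCoatom (LinearMap.ker (D.π k)) :=
  LinearMap.isCoatom_ker_of_surjective (D.π_surjective k)

/-- `P k` is local: its superfluous maximal submodule `ker π` contains every proper submodule. -/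
theorem le_ker_π_of_ne_top (k : D.I) {U : Submodule B (D.P k)} (hU : U ≠ ⊤) :
    U ≤ LinearMap.ker (D.π k) := by
  by_contra h
  refine hU ((D.cover k).superfluous U ((D.isCoatom_ker_π k).2 _ ?_))
  exact lt_of_le_of_ne le_sup_right fun heq => h (heq ▸ le_sup_left)

theorem ker_le_ker_π {k : D.I} {f : D.P k →ₗ[B] M} (hf : f ≠ 0) :
    LinearMap.ker f ≤ LinearMap.ker (D.π k) :=
  D.le_ker_π_of_ne_top k fun h => hf (LinearMap.ker_eq_top.1 h)

theorem exists_π_ne_zero (k : D.I) : ∃ x, D.π k x ≠ 0 := by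
  have := IsSimpleModule.nontrivial B (D.S k)
  obtain ⟨y, hy⟩ := exists_ne (0 : D.S k)
  obtain ⟨x, rfl⟩ := D.π_surjective k y
  exact ⟨x, hy⟩

theorem exists_span_eq_top (k : D.I) : ∃ x, Submodule.span B {x} = (⊤ : Submodule B (D.P k)) := by
  obtain ⟨x, hx⟩ := D.exists_π_ne_zero k
  refine ⟨x, by_contra fun h => hx ?_⟩
  exact D.le_ker_π_of_ne_top k h (Submodule.mem_span_singleton_self x)

instance (k : D.I) : Module.Finite B (D.P k) := by
  obtain ⟨x, hx⟩ := D.exists_span_eq_top k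
  exact ⟨⟨{x}, by simpa using hx⟩⟩

/-- `P k` is a direct summand of the regular module. -/
theorem exists_retract_P (k : D.I) :
    ∃ (s : D.P k →ₗ[B] B) (r : B →ₗ[B] D.P k), ∀ x, r (s x) = x := by
  obtain ⟨x, hx⟩ := D.exists_span_eq_top k
  have hr : Function.Surjective (LinearMap.toSpanSingleton B (D.P k) x) := by
    rw [← LinearMap.range_eq_top, LinearMap.range_toSpanSingleton, hx]
  obtain ⟨s, hs⟩ := Module.projective_lifting_property _ LinearMap.id hr
  exact ⟨s, LinearMap.toSpanSingleton B (D.P k) x, fun y => congrArg (fun f => f y) hs⟩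

theorem exists_lift_ne_zero {k : D.I} {f : M →ₗ[B] D.S k} (hf : Function.Surjective f) :
    ∃ g : D.P k →ₗ[B] M, f ∘ₗ g = D.π k ∧ g ≠ 0 := by
  obtain ⟨g, hg⟩ := Module.projective_lifting_property f (D.π k) hf
  refine ⟨g, hg, ?_⟩
  rintro rfl
  obtain ⟨x, hx⟩ := D.exists_π_ne_zero k
  exact hx (by rw [← hg]; simp)

/-- A subquotient `S k` lifts to `P k` by projectivity. Conversely, `ker f ≤ ker π` for nonzero `f`,
whence `f(P k) / f(ker π)` is `S k`. -/
theorem isCompositionFactor_iff (k : D.I) :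
    IsCompositionFactor B (D.S k) M ↔ ∃ f : D.P k →ₗ[B] M, f ≠ 0 := by
  constructor
  · rintro ⟨U, V, -, ⟨e⟩⟩
    obtain ⟨g, -, hg⟩ := D.exists_lift_ne_zero
      (f := e.toLinearMap ∘ₗ (U.submoduleOf V).mkQ) (e.surjective.comp (Submodule.mkQ_surjective _))
    refine ⟨V.subtype ∘ₗ g, fun h => hg (LinearMap.ext fun x => Subtype.ext ?_)⟩
    exact congrArg (fun f => f x) h
  · rintro ⟨f, hf⟩
    let V := LinearMap.range f
    let U := (LinearMap.ker (D.π k)).map f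
    let q := (U.submoduleOf V).mkQ ∘ₗ f.rangeRestrict
    have hq : Function.Surjective q :=
      (Submodule.mkQ_surjective _).comp f.surjective_rangeRestrict
    have hker : LinearMap.ker q = LinearMap.ker (D.π k) := by
      ext x
      rw [LinearMap.mem_ker]
      change (U.submoduleOf V).mkQ (f.rangeRestrict x) = 0 ↔ _
      rw [← LinearMap.mem_ker, Submodule.ker_mkQ]
      change f x ∈ (LinearMap.ker (D.π k)).map f ↔ _
      constructor
      · rintro ⟨y, hy, hxy⟩
        have h1 : x - y ∈ LinearMap.ker f := by
          rw [LinearMap.mem_ker, map_sub, hxy, sub_self]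
        simpa using add_mem (D.ker_le_ker_π hf h1) hy
      · exact fun hx => ⟨x, hx, rfl⟩
    refine ⟨U, V, LinearMap.map_le_range, ⟨?_⟩⟩
    exact (q.quotKerEquivOfSurjective hq).symm.trans
      ((Submodule.quotEquivOfEq _ _ hker).trans
        ((D.π k).quotKerEquivOfSurjective (D.π_surjective k)))

variable (M) in
/-- The trace in `M` of the modules `P k`, `k ∈ U`. -/
def trace (U : Set D.I) : Submodule B M :=
  ⨆ a : Σ k : U, D.P k →ₗ[B] M, LinearMap.range a.2

variable {D} {U W : Set D.I}

theorem apply_mem_trace {k : D.I} (hk : k ∈ U) (f : D.P k →ₗ[B] M) (x : D.P k) :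
    f x ∈ D.trace M U :=
  le_iSup (fun a : Σ k : U, D.P k →ₗ[B] M => LinearMap.range a.2) ⟨⟨k, hk⟩, f⟩ ⟨x, rfl⟩

theorem trace_le {L : Submodule B M} :
    D.trace M U ≤ L ↔ ∀ k ∈ U, ∀ (f : D.P k →ₗ[B] M) x, f x ∈ L := by
  constructor
  · exact fun h k hk f x => h (apply_mem_trace hk f x)
  · intro h
    refine iSup_le ?_
    rintro ⟨⟨k, hk⟩, f⟩ _ ⟨x, rfl⟩
    exact h k hk f x

theorem trace_mono (h : U ⊆ W) : D.trace M U ≤ D.trace M W :=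
  trace_le.2 fun _ hk f x => apply_mem_trace (h hk) f x

theorem map_trace_le (g : M →ₗ[B] N) : (D.trace M U).map g ≤ D.trace N U := by
  rw [Submodule.map_le_iff_le_comap, trace_le]
  exact fun k hk f x => apply_mem_trace hk (g ∘ₗ f) x

theorem map_trace_of_surjective {g : M →ₗ[B] N} (hg : Function.Surjective g) :
    (D.trace M U).map g = D.trace N U := by
  refine le_antisymm (map_trace_le g) (trace_le.2 fun k hk f x => ?_)
  obtain ⟨f', rfl⟩ := Module.projective_lifting_property g f hg
  exact ⟨f' x, apply_mem_trace hk f' x, rfl⟩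

theorem map_subtype_trace (L : Submodule B M) (hL : D.trace M U ≤ L) :
    (D.trace L U).map L.subtype = D.trace M U := by
  refine le_antisymm (map_trace_le _) (trace_le.2 fun k hk f x => ?_)
  exact ⟨⟨f x, hL (apply_mem_trace hk f x)⟩,
    apply_mem_trace hk (f.codRestrict L fun x => hL (apply_mem_trace hk f x)) x, rfl⟩

theorem trace_eq_bot : D.trace M U = ⊥ ↔ ∀ k ∈ U, ∀ f : D.P k →ₗ[B] M, f = 0 := by
  rw [← le_bot_iff, trace_le]
  exact forall₂_congr fun k _ => forall_congr' fun f =>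
    ⟨fun h => LinearMap.ext fun x => (Submodule.mem_bot B).1 (h x), fun h x => by simp [h]⟩

theorem trace_P_of_mem {k : D.I} (hk : k ∈ U) : D.trace (D.P k) U = ⊤ :=
  eq_top_iff.2 fun x _ => apply_mem_trace hk LinearMap.id x

/-- A finitely generated module is generated by the `P k`, where `S k` runs over the simple
quotients of the module. -/
theorem trace_eq_top [Module.Finite B M]
    (h : ∀ (k : D.I) (f : M →ₗ[B] D.S k), Function.Surjective f → k ∈ U) : D.trace M U = ⊤ := by
  by_contra hne
  obtain ⟨L, hL, hle⟩ := (eq_top_or_exists_le_coatom (D.trace M U)).resolve_left hne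
  obtain ⟨k, ⟨e⟩⟩ := D.complete (ModuleCat.of B (M ⧸ L)) (isSimpleModule_iff_isCoatom.2 hL)
  let f : M →ₗ[B] D.S k := e.toLinearMap ∘ₗ L.mkQ
  have hf : Function.Surjective f := e.surjective.comp (Submodule.mkQ_surjective L)
  obtain ⟨g, hg, -⟩ := D.exists_lift_ne_zero hf
  obtain ⟨x, hx⟩ := D.exists_π_ne_zero k
  apply hx
  rw [← hg]
  have hgx : g x ∈ L := hle (apply_mem_trace (h k f hf) g x)
  change e (Submodule.Quotient.mk (g x)) = 0
  rw [(Submodule.Quotient.mk_eq_zero L).2 hgx]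
  exact map_zero e

variable (D M) in
theorem trace_univ [Module.Finite B M] : D.trace M Set.univ = ⊤ :=
  trace_eq_top fun _ _ _ => trivial

/-- A finitely generated projective module that is generated by the `P k`, `k ∈ U`, is a direct
summand of a finite direct sum of such modules. -/
theorem exists_decomposition [Module.Finite B M] [Module.Projective B M]
    (h : D.trace M U = ⊤) :
    ∃ (s : Finset (Σ k : U, D.P k →ₗ[B] M)) (p : ∀ a : s, M →ₗ[B] D.P a.1.1),
      ∀ x, ∑ a : s, a.1.2 (p a x) = x := by
  classical
  have hc : IsCompactElement (⊤ : Submodule B M) := (Submodule.fg_iff_compact _).1 Module.Finite.fg_top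
  obtain ⟨s, hs⟩ := CompleteLattice.IsCompactElement.exists_finset_of_le_iSup _ hc
    (fun a : Σ k : U, D.P k →ₗ[B] M => LinearMap.range a.2) h.ge
  let g : (∀ a : s, D.P a.1.1) →ₗ[B] M := ∑ a : s, a.1.2 ∘ₗ LinearMap.proj a
  have hg : ∀ y, g y = ∑ a : s, a.1.2 (y a) := fun y => by simp [g]
  have hsurj : Function.Surjective g := by
    rw [← LinearMap.range_eq_top, ← top_le_iff]
    refine hs.trans (iSup₂_le fun a ha => ?_)
    rintro _ ⟨x, rfl⟩
    refine ⟨Pi.single ⟨a, ha⟩ x, ?_⟩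
    rw [hg, Finset.sum_eq_single (⟨a, ha⟩ : s)]
    · rw [Pi.single_eq_same]
    · intro b _ hb
      rw [Pi.single_eq_of_ne hb, map_zero]
    · simp
  obtain ⟨t, ht⟩ := Module.projective_lifting_property g LinearMap.id hsurj
  refine ⟨s, fun a => LinearMap.proj a ∘ₗ t, fun x => ?_⟩
  exact (hg (t x)).symm.trans (congrArg (fun f => f x) ht)

variable (U) in
/-- The functor `trace`. -/
def traceMap (g : M →ₗ[B] N) : D.trace M U →ₗ[B] D.trace N U :=
  g.restrict fun x hx => map_trace_le g ⟨x, hx, rfl⟩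

/-- The trace is an additive functor, so it turns `M` as a summand of a sum of `P k` into a summand
of the sum of their traces. -/
theorem projective_trace [Module.Finite B M] [Module.Projective B M]
    (h : D.trace M W = ⊤) (hW : ∀ k ∈ W, Module.Projective B (D.trace (D.P k) U)) :
    Module.Projective B (D.trace M U) := by
  classical
  obtain ⟨s, p, hp⟩ := exists_decomposition h
  have (a : s) : Module.Projective B (D.trace (D.P a.1.1) U) := hW _ a.1.1.2
  have : Module.Projective B (∀ a : s, D.trace (D.P a.1.1) U) :=
    Module.Projective.of_equiv (DFinsupp.linearEquivFunOnFintype (R := B))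
  let i : D.trace M U →ₗ[B] (∀ a : s, D.trace (D.P a.1.1) U) :=
    LinearMap.pi fun a => traceMap U (p a)
  let r : (∀ a : s, D.trace (D.P a.1.1) U) →ₗ[B] D.trace M U :=
    ∑ a : s, traceMap U a.1.2 ∘ₗ LinearMap.proj a
  have hr : ∀ y, (r y : M) = ∑ a : s, a.1.2 (y a) := fun y => by
    simp only [r, LinearMap.sum_apply, Submodule.coe_sum]
    rfl
  refine Module.Projective.of_split i r (LinearMap.ext fun x => Subtype.ext ?_)
  exact (hr (i x)).trans (hp x)

/-- Every simple module embeds in the semisimple module `B / rad B`, and nonisomorphic ones lie in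
different isotypic components, of which there are finitely many. -/
theorem finite_I [IsArtinianRing B] : Finite D.I := by
  let M := B ⧸ Module.jacobson B B
  have : IsSemisimpleModule B M :=
    (IsArtinian.isSemisimpleModule_iff_jacobson B M).2 (Module.jacobson_quotient_jacobson B B)
  have hsub : ∀ k : D.I, ∃ L : Submodule B M, Nonempty (L ≃ₗ[B] D.S k) := by
    intro k
    have := IsSimpleModule.nontrivial B (D.S k)
    obtain ⟨x, hx⟩ := exists_ne (0 : D.S k)
    let f := LinearMap.toSpanSingleton B (D.S k) x
    have hf : Function.Surjective f := IsSimpleModule.toSpanSingleton_surjective B hx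
    have hle : Module.jacobson B B ≤ LinearMap.ker f :=
      sInf_le (LinearMap.isCoatom_ker_of_surjective hf)
    let g := (Module.jacobson B B).liftQ f hle
    have hg : Function.Surjective g := fun y => by
      obtain ⟨z, hz⟩ := hf y
      exact ⟨Submodule.Quotient.mk z, hz⟩
    obtain ⟨t, ht⟩ := IsSemisimpleModule.lifting_property g hg LinearMap.id
    have hinj : Function.Injective t :=
      Function.LeftInverse.injective (g := g) fun y => congrArg (fun f => f y) ht
    exact ⟨LinearMap.range t, ⟨(LinearEquiv.ofInjective t hinj).symm⟩⟩
  choose L hL using hsub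
  have hsimple : ∀ k, IsSimpleModule B (L k) := fun k => (hL k).elim fun e =>
    IsSimpleModule.congr e
  let c : D.I → isotypicComponents B M := fun k =>
    ⟨isotypicComponent B M (L k), L k, hsimple k, rfl⟩
  refine Finite.of_injective c fun i j hij => ?_
  have hij' : isotypicComponent B M (L i) = isotypicComponent B M (L j) := congrArg Subtype.val hij
  have hle : L i ≤ isotypicComponent B M (L j) :=
    hij' ▸ Submodule.le_isotypicComponent (L i)
  have := hsimple i
  have := hsimple j
  obtain ⟨e⟩ := isIsotypicOfType_submodule_iff.1 (IsIsotypicOfType.isotypicComponent B M (L j)) _ hle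
  exact D.distinct i j ⟨(hL i).some.symm.trans (e.trans (hL j).some)⟩

end SimpleSystem

/-! ### From a partial order to a chain of trace ideals. -/

namespace SimpleSystem

variable {B : Type u} [Ring B] {D : SimpleSystem B}
  {M N : Type u} [AddCommGroup M] [Module B M] [AddCommGroup N] [Module B N] {U W : Set D.I}

variable (D) in
/-- The trace of the modules `P k`, `k ∈ U`, in the regular module is an ideal. -/
def traceIdeal (U : Set D.I) : TwoSidedIdeal B :=
  TwoSidedIdeal.mk' (D.trace B U) (zero_mem _) add_mem neg_mem
    (fun hy => Submodule.smul_mem _ _ hy)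
    (fun {x y} hx => map_trace_le (LinearMap.toSpanSingleton B B y) ⟨x, hx, rfl⟩)

theorem mem_traceIdeal_iff {x : B} : x ∈ D.traceIdeal U ↔ x ∈ D.trace B U := by
  simp [traceIdeal]

theorem traceIdeal_mono (h : U ⊆ W) : D.traceIdeal U ≤ D.traceIdeal W := fun _ hx =>
  mem_traceIdeal_iff.2 (trace_mono h (mem_traceIdeal_iff.1 hx))

theorem smul_mem_trace {x : B} (hx : x ∈ D.traceIdeal U) (m : M) : x • m ∈ D.trace M U :=
  map_trace_le (LinearMap.toSpanSingleton B M m) ⟨x, mem_traceIdeal_iff.1 hx, rfl⟩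

/-- With `P k` a retract of `B` by `s` and `r`, one has `f p = s p * f (r 1)`, and both factors lie
in the trace. -/
theorem isIdempotentIdeal_traceIdeal : IsIdempotentIdeal (D.traceIdeal U) := by
  apply isIdempotentIdeal_of_le
  intro x hx
  rw [mem_traceIdeal_iff] at hx
  let L : Submodule B B :=
    { AddSubgroup.closure
        {z : B | ∃ x ∈ D.traceIdeal U, ∃ y ∈ D.traceIdeal U, x * y = z} with
      smul_mem' := fun c z hz => by
        induction hz using AddSubgroup.closure_induction with
        | mem z hz =>
          obtain ⟨x, hx, y, hy, rfl⟩ := hz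
          exact AddSubgroup.subset_closure
            ⟨c * x, TwoSidedIdeal.mul_mem_left _ _ _ hx, y, hy, mul_assoc _ _ _⟩
        | zero => rw [smul_zero]; exact AddSubgroup.zero_mem _
        | add a b _ _ ha hb => rw [smul_add]; exact AddSubgroup.add_mem _ ha hb
        | neg a _ ha => rw [smul_neg]; exact AddSubgroup.neg_mem _ ha }
  refine (trace_le (L := L)).2 (fun k hk f p => ?_) hx
  obtain ⟨s, r, hsr⟩ := D.exists_retract_P k
  refine AddSubgroup.subset_closure ⟨s p, mem_traceIdeal_iff.2 (apply_mem_trace hk s p), f (r 1),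
    mem_traceIdeal_iff.2 (apply_mem_trace hk f _), ?_⟩
  conv_rhs => rw [← hsr p]
  rw [← smul_eq_mul, ← map_smul, ← map_smul, smul_eq_mul, mul_one]

/-- `T` is a simple `B/H`-module. If `r • t ≠ 0`, some `b` has `b * r • t = t`, but `1 - b * r` is
invertible modulo `H`. -/
theorem smul_eq_zero_of_relRad {T : Type u} [AddCommGroup T] [Module B T] [IsSimpleModule B T]
    {H : TwoSidedIdeal B} (hH : ∀ x ∈ H, ∀ t : T, x • t = 0) {r : B} (hr : RelRad H r) (t : T) :
    r • t = 0 := by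
  by_contra h
  obtain ⟨b, hb⟩ := IsSimpleModule.toSpanSingleton_surjective B h t
  rw [LinearMap.toSpanSingleton_apply, smul_smul] at hb
  obtain ⟨u, hu, -⟩ := hr b 1
  have h1 := hH _ hu t
  rw [mul_one, sub_smul, mul_smul, sub_smul, hb, one_smul, sub_self, smul_zero, zero_sub,
    neg_eq_zero] at h1
  exact h (by rw [h1, smul_zero])

variable [PartialOrder D.I]

/-- All composition factors of `P i / L` are `S j` with `j ≤ i` exactly when no other `P j` maps
nontrivially to `P i / L`, that is, when `L` contains the trace. Thus the infimum is attained. -/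
theorem K_eq_trace (i : D.I) : D.K i = D.trace (D.P i) {j | ¬ j ≤ i} := by
  have h : ∀ L : Submodule B (D.P i),
      (∀ j, IsCompositionFactor B (D.S j) (D.P i ⧸ L) → j ≤ i) ↔
        D.trace (D.P i) {j | ¬ j ≤ i} ≤ L := by
    intro L
    have hL : D.trace (D.P i) {j | ¬ j ≤ i} ≤ L ↔ D.trace (D.P i ⧸ L) {j | ¬ j ≤ i} = ⊥ := by
      rw [← map_trace_of_surjective L.mkQ_surjective, ← le_bot_iff, Submodule.map_le_iff_le_comap,
        Submodule.comap_bot, Submodule.ker_mkQ]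
    simp only [isCompositionFactor_iff]
    rw [hL, trace_eq_bot]
    constructor
    · intro h j hj f
      by_contra hf
      exact hj (h j ⟨f, hf⟩)
    · rintro h j ⟨f, hf⟩
      by_contra hj
      exact hf (h j hj f)
  exact le_antisymm (sInf_le ((h _).2 le_rfl)) (le_sInf fun L hL => (h L).1 hL)

theorem trace_Δ (i : D.I) : D.trace (D.Δ i) {j | ¬ j ≤ i} = ⊥ := by
  rw [← map_trace_of_surjective (D.K i).mkQ_surjective, ← K_eq_trace, Submodule.mkQ_map_self]

/-- Being generated by the `P j` passes up extensions as these are projective. This is all that the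
construction of the chain uses of the filtrations. -/
theorem trace_eq_top_of_isDeltaFiltered (h : D.IsDeltaFiltered U M) : D.trace M U = ⊤ := by
  obtain ⟨l, F, h0, hl, hF⟩ := h
  have key : ∀ k ≤ l, F (l - k) ≤ D.trace M U := by
    intro k hk
    induction k with
    | zero => simp [hl]
    | succ k ih =>
      have hk' : l - (k + 1) + 1 = l - k := by omega
      have hF' := hF (l - (k + 1)) (by omega)
      rw [hk'] at hF'
      obtain ⟨hle, j, hj, ⟨e⟩⟩ := hF'
      have hΔ : D.trace (D.Δ j) U = ⊤ := by
        rw [← map_trace_of_surjective (D.K j).mkQ_surjective, trace_P_of_mem hj, Submodule.map_top,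
          Submodule.range_mkQ]
      have hq : D.trace (F (l - (k + 1)) ⧸ (F (l - k)).submoduleOf (F (l - (k + 1)))) U = ⊤ := by
        rw [← map_trace_of_surjective e.symm.surjective, hΔ, Submodule.map_top]
        exact LinearMap.range_eq_top.2 e.symm.surjective
      rw [← map_trace_of_surjective (Submodule.mkQ_surjective _)] at hq
      intro x hx
      have hx' : (Submodule.mkQ _ ⟨x, hx⟩ : F (l - (k + 1)) ⧸ (F (l - k)).submoduleOf _) ∈
        Submodule.map _ _ := hq.ge trivial
      obtain ⟨y, hy, hxy⟩ := hx'
      have hsub : (⟨x, hx⟩ : F (l - (k + 1))) - y ∈ (F (l - k)).submoduleOf (F (l - (k + 1))) :=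
        (Submodule.Quotient.eq _).1 hxy.symm
      have h1 : x - y ∈ F (l - k) := hsub
      have h2 : (y : M) ∈ D.trace M U := map_trace_le (Submodule.subtype _) ⟨y, hy, rfl⟩
      simpa using add_mem (ih (by omega) h1) h2
  have := key l le_rfl
  rwa [Nat.sub_self, h0, top_le_iff] at this

variable [IsArtinianRing B]

/-- The modules `trace (P i) U`, `U` an upper set, are projective. -/
theorem projective_trace_P (hU : IsUpperSet U) (hK : ∀ i, Module.Projective B (D.K i))
    (hF : ∀ i, D.trace (D.K i) {j | i < j} = ⊤) (i : D.I) :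
    Module.Projective B (D.trace (D.P i) U) := by
  have := D.finite_I
  -- Descending induction: for `i` outside the upper set `U` the trace lies in `K i`, which is
  -- projective and generated by the `P k` with `k > i`.
  induction i using WellFoundedGT.induction with
  | ind i ih =>
    by_cases hi : i ∈ U
    · rw [trace_P_of_mem hi]
      exact Module.Projective.of_equiv Submodule.topEquiv.symm
    · have hle : D.trace (D.P i) U ≤ D.K i := by
        rw [K_eq_trace]
        exact trace_mono fun j hj hji => hi (hU hji hj)
      have := hK i
      have h : Module.Projective B (D.trace (D.K i) U) :=
        projective_trace (hF i) fun k hk => ih k hk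
      rw [← map_subtype_trace _ hle]
      exact Module.Projective.of_equiv
        (Submodule.equivMapOfInjective _ (D.K i).injective_subtype _)

theorem projective_traceIdeal (hU : IsUpperSet U) (hK : ∀ i, Module.Projective B (D.K i))
    (hF : ∀ i, D.trace (D.K i) {j | i < j} = ⊤) : Module.Projective B (D.traceIdeal U) := by
  have h : Module.Projective B (D.trace B U) :=
    projective_trace (D.trace_univ B) fun k _ => projective_trace_P hU hK hF k
  let e : D.trace B U ≃ₗ[B] D.traceIdeal U :=
    { toFun := fun x => ⟨x, mem_traceIdeal_iff.2 x.2⟩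
      invFun := fun x => ⟨x, mem_traceIdeal_iff.1 x.2⟩
      left_inv := fun _ => rfl
      right_inv := fun _ => rfl
      map_add' := fun _ _ => rfl
      map_smul' := fun _ _ => rfl }
  exact Module.Projective.of_equiv e

omit [IsArtinianRing B] in
-- Only the contribution of `P m` matters, and `K m` is already in the trace of the remaining `P k`.
-- On `Δ m`, a radical element `r` maps into the radical, which `x` annihilates since no `S k` with
-- `k ∈ U` occurs there.
theorem relJac_traceIdeal {m : D.I} (hU : IsUpperSet U) (hm : ∀ k ∈ U, k ≤ m → k = m)
    (hF : D.trace (D.K m) {j | m < j} = ⊤)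
    (hmult : ¬ IsCompositionFactor B (D.S m) (Module.jacobson B (D.Δ m))) (hmU : m ∈ U) :
    RelJac (D.traceIdeal U) (D.traceIdeal (U \ {m})) := by
  have hK : D.K m ≤ D.trace (D.P m) (U \ {m}) := by
    have h : (D.trace (D.K m) {j | m < j}).map (D.K m).subtype = D.K m := by
      rw [hF, Submodule.map_subtype_top]
    rw [← h]
    exact (map_trace_le _).trans (trace_mono fun j hj => ⟨hU (le_of_lt hj) hmU, ne_of_gt hj⟩)
  have hrad : ∀ x ∈ D.traceIdeal U, ∀ z ∈ Module.jacobson B (D.Δ m), x • z = 0 := by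
    intro x hx z hz
    have hbot : D.trace (Module.jacobson B (D.Δ m)) U = ⊥ := by
      rw [trace_eq_bot]
      intro k hk f
      by_contra hf
      have hkm : k ≤ m := by
        by_contra hkm
        apply hf
        have := trace_eq_bot.1 (D.trace_Δ m) k hkm ((Submodule.subtype _) ∘ₗ f)
        exact LinearMap.ext fun y => Subtype.ext (congrArg (fun g => g y) this)
      obtain rfl := hm k hk hkm
      exact hmult ((D.isCompositionFactor_iff k).2 ⟨f, hf⟩)
    have h1 := smul_mem_trace hx (⟨z, hz⟩ : Module.jacobson B (D.Δ m))
    rw [hbot, Submodule.mem_bot] at h1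
    exact congrArg Subtype.val h1
  have hΔ : D.trace (D.Δ m) (U \ {m}) = ⊥ := by
    rw [← le_bot_iff, ← D.trace_Δ m]
    exact trace_mono fun k hk hkm => hk.2 (hm k hk.1 hkm)
  intro x hx y hy r hr
  have hxr : ∀ p : D.P m, (x * r) • p ∈ D.trace (D.P m) (U \ {m}) := by
    intro p
    apply hK
    rw [← (D.K m).ker_mkQ, LinearMap.mem_ker, map_smul, mul_smul]
    refine hrad x hx _ (Submodule.mem_sInf.2 fun L hL => ?_)
    have : IsSimpleModule B (D.Δ m ⧸ L) := isSimpleModule_iff_isCoatom.2 hL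
    rw [← L.ker_mkQ, LinearMap.mem_ker, map_smul]
    refine smul_eq_zero_of_relRad (fun a ha t => ?_) hr _
    have h1 := smul_mem_trace ha t
    rwa [← map_trace_of_surjective L.mkQ_surjective, hΔ, Submodule.map_bot] at h1
  have hyL : ∀ y ∈ D.trace B U, x * r * y ∈ D.trace B (U \ {m}) := by
    intro y hy
    unfold trace at hy
    induction hy using Submodule.iSup_induction' with
    | mem a y hy =>
      obtain ⟨⟨k, hk⟩, f⟩ := a
      obtain ⟨p, rfl⟩ := hy
      by_cases hkm : k = m
      · subst hkm
        change (x * r) • f p ∈ _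
        rw [← map_smul]
        exact map_trace_le f (Submodule.mem_map_of_mem (hxr p))
      · exact Submodule.smul_mem _ (x * r) (apply_mem_trace (U := U \ {m}) ⟨hk, hkm⟩ f p)
    | zero => rw [mul_zero]; exact zero_mem _
    | add a b _ _ ha hb => rw [mul_add]; exact add_mem ha hb
  exact mem_traceIdeal_iff.2 (hyL y (mem_traceIdeal_iff.1 hy))

/-- Minimal elements are removed from the upper set one at a time. Strictness of the inclusions is
not claimed; repetitions are removed afterwards. -/
theorem exists_chain_traceIdeal
    (h : ∀ i : D.I, D.IsDeltaFiltered {j | i < j} (D.K i) ∧ Module.Projective B (D.K i) ∧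
      ¬ IsCompositionFactor B (D.S i) (Module.jacobson B (D.Δ i)))
    (s : Finset D.I) (hs : IsUpperSet (s : Set D.I)) :
    ∃ (n : ℕ) (C : ℕ → TwoSidedIdeal B), C 0 = D.traceIdeal s ∧ C n = ⊥ ∧
      ∀ i < n, C (i + 1) ≤ C i ∧ IsIdempotentIdeal (C i) ∧ Module.Projective B (C i) ∧
        RelJac (C i) (C (i + 1)) := by
  classical
  have hF := fun i => trace_eq_top_of_isDeltaFiltered (h i).1
  induction s using Finset.strongInduction with
  | H s ih =>
    rcases s.eq_empty_or_nonempty with rfl | hne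
    · refine ⟨0, fun _ => D.traceIdeal _, rfl, ?_, fun i hi => absurd hi (Nat.not_lt_zero i)⟩
      rw [eq_bot_iff]
      intro x hx
      rw [mem_traceIdeal_iff] at hx
      have : D.trace B ((∅ : Finset D.I) : Set D.I) = ⊥ := trace_eq_bot.2 (by simp)
      rw [this] at hx
      exact (TwoSidedIdeal.mem_bot B).2 hx
    · obtain ⟨m, hm⟩ := s.exists_minimal hne
      have hm' : ∀ k ∈ (s : Set D.I), k ≤ m → k = m := fun k hk hkm =>
        le_antisymm hkm (hm.2 hk hkm)
      have hcoe : ((s.erase m : Finset D.I) : Set D.I) = (s : Set D.I) \ {m} := by simp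
      have hup : IsUpperSet ((s.erase m : Finset D.I) : Set D.I) := by
        rw [hcoe]
        rintro a b hab ⟨ha, ham⟩
        refine ⟨hs hab ha, ?_⟩
        rintro rfl
        exact ham (hm' a ha hab)
      obtain ⟨n, C, h0, hn, hC⟩ := ih (s.erase m) (Finset.erase_ssubset hm.1) hup
      refine ⟨n + 1, fun i => Nat.casesOn i (D.traceIdeal s) C, rfl, hn, fun i hi => ?_⟩
      cases i with
      | zero =>
        change C 0 ≤ D.traceIdeal s ∧ _ ∧ _ ∧ RelJac (D.traceIdeal s) (C 0)
        rw [h0, hcoe]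
        exact ⟨traceIdeal_mono Set.sdiff_subset, isIdempotentIdeal_traceIdeal,
          projective_traceIdeal hs (fun i => (h i).2.1) hF,
          relJac_traceIdeal hs hm' (hF m) (h m).2.2 hm.1⟩
      | succ i => exact hC i (by omega)

theorem exists_leftStrongly
    (h : ∀ i : D.I, D.IsDeltaFiltered {j | i < j} (D.K i) ∧ Module.Projective B (D.K i) ∧
      ¬ IsCompositionFactor B (D.S i) (Module.jacobson B (D.Δ i))) :
    ∃ (n : ℕ) (H : ℕ → TwoSidedIdeal B), IsLeftStronglyHeredityChain n H := by
  have := D.finite_I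
  have := Fintype.ofFinite D.I
  obtain ⟨n, C, h0, hn, hC⟩ := exists_chain_traceIdeal h Finset.univ (by simp [isUpperSet_univ])
  obtain ⟨m, H, h0', hm, hH⟩ := exists_chain_ne (fun I J : TwoSidedIdeal B => I ≤ J ∧
    IsIdempotentIdeal J ∧ Module.Projective B J ∧ RelJac J I) n C hC
  have htop : H 0 = ⊤ := by
    rw [h0', h0, eq_top_iff]
    intro x _
    rw [mem_traceIdeal_iff, Finset.coe_univ, D.trace_univ B]
    trivial
  refine ⟨m, H, ⟨htop, fun i hi => lt_of_le_of_ne (hH i hi).1.1 (hH i hi).2, hm.trans hn,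
    fun i hi => ?_⟩, fun i hi => (hH i hi).1.2.2.1,
    fun i hi => (relJac_iff _ _).1 (hH i hi).1.2.2.2⟩
  rcases hi.lt_or_eq with hi | rfl
  · exact (hH i hi).1.2.1
  · rw [hm, hn]
    exact isIdempotentIdeal_of_le fun x hx => by
      rw [(TwoSidedIdeal.mem_bot B).1 hx]
      exact AddSubgroup.zero_mem _

end SimpleSystem

/-! ### Existence of projective covers of simple modules. -/

section ProjectiveCover

variable {B : Type u} [Ring B] [IsArtinianRing B]

/-- Take a minimal projective left ideal `N` mapping onto `S`. If `L + ker π = N`, lift `π` to `N →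
L`; by Fitting's lemma the image of a power of the resulting endomorphism of `N` is a direct
summand, and it still maps onto `S`. By minimality it is `N`, so `L = N`. -/
theorem exists_isProjectiveCover (S : Type u) [AddCommGroup S] [Module B S] [IsSimpleModule B S] :
    ∃ (P : ModuleCat.{u} B) (π : P →ₗ[B] S), IsProjectiveCover π := by
  let X : Set (Submodule B B) :=
    {N | Module.Projective B N ∧ ∃ π : N →ₗ[B] S, Function.Surjective π}
  have hne : X.Nonempty := by
    have := IsSimpleModule.nontrivial B S
    obtain ⟨x, hx⟩ := exists_ne (0 : S)
    exact ⟨⊤, Module.Projective.of_equiv Submodule.topEquiv.symm,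
      LinearMap.toSpanSingleton B S x ∘ₗ Submodule.topEquiv.toLinearMap,
      (IsSimpleModule.toSpanSingleton_surjective B hx).comp Submodule.topEquiv.surjective⟩
  obtain ⟨N, ⟨hN, π, hπ⟩, hmin⟩ := WellFounded.has_min (wellFounded_lt (α := Submodule B B)) X hne
  refine ⟨ModuleCat.of B N, π, hN, hπ, fun L hL => ?_⟩
  have hLsurj : Function.Surjective (π ∘ₗ L.subtype) := by
    intro y
    obtain ⟨x, rfl⟩ := hπ y
    obtain ⟨l, hl, z, hz, rfl⟩ := Submodule.mem_sup.1 (hL.ge (Submodule.mem_top (x := x)))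
    refine ⟨⟨l, hl⟩, ?_⟩
    rw [map_add, LinearMap.mem_ker.1 hz, add_zero]
    rfl
  obtain ⟨t, ht⟩ := Module.projective_lifting_property (π ∘ₗ L.subtype) π hLsurj
  let φ : Module.End B N := L.subtype ∘ₗ t
  have hφ : ∀ x, π (φ x) = π x := fun x => congrArg (fun f => f x) ht
  obtain ⟨k, hk, hk0⟩ := (φ.eventually_isCompl_ker_pow_range_pow.and
    (Filter.eventually_gt_atTop 0)).exists
  have hφk : ∀ x, π ((φ ^ k) x) = π x := by
    clear hk hk0
    intro x
    induction k with
    | zero => rfl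
    | succ k ih => rw [pow_succ', Module.End.mul_apply, hφ, ih]
  let R := LinearMap.range (φ ^ k)
  have hproj : Module.Projective B R :=
    Module.Projective.of_split R.subtype (R.projectionOnto _ hk.symm)
      (LinearMap.ext fun x => Submodule.projectionOnto_apply_left hk.symm x)
  have hR : R = ⊤ := by
    by_contra hR
    refine hmin (R.map N.subtype) ⟨?_, ?_⟩ ?_
    · exact Module.Projective.of_equiv (Submodule.equivMapOfInjective _ N.injective_subtype R)
    · refine ⟨π ∘ₗ R.subtype ∘ₗ
        (Submodule.equivMapOfInjective _ N.injective_subtype R).symm.toLinearMap, ?_⟩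
      refine Function.Surjective.comp (g := π ∘ₗ R.subtype) ?_ (LinearEquiv.surjective _)
      intro y
      obtain ⟨x, rfl⟩ := hπ y
      exact ⟨⟨(φ ^ k) x, x, rfl⟩, hφk x⟩
    · have := Submodule.map_strictMono_of_injective N.injective_subtype (lt_top_iff_ne_top.2 hR)
      rwa [Submodule.map_subtype_top] at this
  rw [eq_top_iff, ← hR]
  rintro _ ⟨x, rfl⟩
  obtain ⟨k, rfl⟩ := Nat.exists_eq_succ_of_ne_zero hk0.ne'
  rw [Nat.succ_eq_add_one, pow_succ', Module.End.mul_apply]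
  exact (t _).2

theorem nonempty_simpleSystem : Nonempty (SimpleSystem B) := by
  let X := {m : Ideal B // m.IsMaximal}
  let r : Setoid X :=
    { r := fun m m' => Nonempty ((B ⧸ m.1) ≃ₗ[B] (B ⧸ m'.1))
      iseqv := ⟨fun _ => ⟨LinearEquiv.refl _ _⟩, fun ⟨e⟩ => ⟨e.symm⟩,
        fun ⟨e⟩ ⟨e'⟩ => ⟨e.trans e'⟩⟩ }
  have hsimple : ∀ i : Quotient r, IsSimpleModule B (B ⧸ i.out.1) := fun i =>
    isSimpleModule_iff_isCoatom.2 i.out.2.out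
  choose P π h using fun i : Quotient r => exists_isProjectiveCover (B := B) (B ⧸ i.out.1)
  refine ⟨⟨Quotient r, fun i => ModuleCat.of B (B ⧸ i.out.1), hsimple, ?_, ?_, P, π, h⟩⟩
  · intro i j hij
    rw [← Quotient.out_eq i, ← Quotient.out_eq j]
    exact Quotient.sound hij
  · intro T hT
    obtain ⟨m, hm, ⟨e⟩⟩ := isSimpleModule_iff_quot_maximal.1 hT
    obtain ⟨e'⟩ := Quotient.exact (Quotient.out_eq (Quotient.mk r (⟨m, hm⟩ : X)))
    exact ⟨Quotient.mk r ⟨m, hm⟩, ⟨e.trans e'.symm⟩⟩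

end ProjectiveCover

/-! ### Submodules `IM` for an idempotent ideal `I`. -/

section IdealSMul

variable {B : Type u} [Ring B] {I : TwoSidedIdeal B} {M N : Type u} [AddCommGroup M] [Module B M]
  [AddCommGroup N] [Module B N]

theorem IsIdempotentIdeal.smul_smul (hI : IsIdempotentIdeal I) (L : Submodule B M) :
    I.asIdeal • I.asIdeal • L = I.asIdeal • L := by
  refine le_antisymm Submodule.smul_le_right (Submodule.smul_le.2 fun x hx m hm => ?_)
  have hx' := hI.mem_closure (TwoSidedIdeal.mem_asIdeal.1 hx)
  clear hx
  induction hx' using AddSubgroup.closure_induction with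
  | mem z hz =>
    obtain ⟨a, ha, b, hb, rfl⟩ := hz
    rw [mul_smul]
    exact Submodule.smul_mem_smul (TwoSidedIdeal.mem_asIdeal.2 ha)
      (Submodule.smul_mem_smul (TwoSidedIdeal.mem_asIdeal.2 hb) hm)
  | zero => rw [zero_smul]; exact zero_mem _
  | add a b _ _ ha hb => rw [add_smul]; exact add_mem ha hb
  | neg a _ ha => rw [neg_smul]; exact neg_mem ha

theorem smul_top_eq_of_surjective {g : M →ₗ[B] N} (hg : Function.Surjective g)
    (h : I.asIdeal • (⊤ : Submodule B M) = ⊤) : I.asIdeal • (⊤ : Submodule B N) = ⊤ := by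
  have := congrArg (Submodule.map g) h
  rwa [Submodule.map_smul'', Submodule.map_top, LinearMap.range_eq_top.2 hg] at this

theorem smul_top_coe_iff {L : Submodule B M} :
    I.asIdeal • (⊤ : Submodule B L) = ⊤ ↔ I.asIdeal • L = L := by
  rw [← (Submodule.map_injective_of_injective L.injective_subtype).eq_iff, Submodule.map_smul'',
    Submodule.map_subtype_top]

end IdealSMul

namespace SimpleSystem

variable {B : Type u} [Ring B] {D : SimpleSystem B} {I I' : TwoSidedIdeal B}
  {M N : Type u} [AddCommGroup M] [Module B M] [AddCommGroup N] [Module B N]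

/-- As `I` is idempotent, `I • L = L` for `L = I • M`, and this passes to every simple quotient `S
k` of `L`. Hence `I • P k` is not inside `ker π`, so it is all of `P k`. -/
theorem trace_eq_smul_top [IsNoetherianRing B] [Module.Finite B M] (hI : IsIdempotentIdeal I) :
    D.trace M {k | I.asIdeal • (⊤ : Submodule B (D.P k)) = ⊤} = I.asIdeal • ⊤ := by
  apply le_antisymm
  · refine trace_le.2 fun k hk f x => ?_
    have hx : x ∈ I.asIdeal • (⊤ : Submodule B (D.P k)) := by rw [hk]; trivial
    have h1 := Submodule.mem_map_of_mem (f := f) hx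
    rw [Submodule.map_smul''] at h1
    exact Submodule.smul_mono le_rfl le_top h1
  · set L : Submodule B M := I.asIdeal • ⊤ with hL
    have hLL : I.asIdeal • (⊤ : Submodule B L) = ⊤ := smul_top_coe_iff.2 (hI.smul_smul ⊤)
    have h : D.trace L {k | I.asIdeal • (⊤ : Submodule B (D.P k)) = ⊤} = ⊤ := by
      refine trace_eq_top fun k f hf => ?_
      have hS := smul_top_eq_of_surjective hf hLL
      by_contra hk
      have h1 := Submodule.map_mono (f := D.π k) (D.le_ker_π_of_ne_top k hk)
      rw [Submodule.map_smul'', Submodule.map_top, LinearMap.range_eq_top.2 (D.π_surjective k), hS,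
        LinearMap.le_ker_iff_map.1 le_rfl] at h1
      obtain ⟨x, hx⟩ := D.exists_π_ne_zero k
      exact hx ((Submodule.mem_bot B).1 (h1 trivial))
    intro x hx
    exact map_trace_le L.subtype ⟨⟨x, hx⟩, h.ge trivial, rfl⟩

/-- The retraction of `B` onto `P k` gives `z = s z • r 1` with `s z` in the radical for `z` in `ker
π`. As `r 1 ∈ I • P k`, the product `h • z` lies in `IJI • P k`. -/
theorem smul_ker_π_le (hJ : RelJac I I') (k : D.I)
    (hk : I.asIdeal • (⊤ : Submodule B (D.P k)) = ⊤) :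
    I.asIdeal • LinearMap.ker (D.π k) ≤ I'.asIdeal • ⊤ := by
  obtain ⟨s, r, hsr⟩ := D.exists_retract_P k
  refine Submodule.smul_le.2 fun h hh z hz => ?_
  have hs : s z ∈ Ring.jacobson B := by
    refine Submodule.mem_sInf.2 fun L hL => ?_
    by_contra hsz
    have hne : L.mkQ ∘ₗ s ≠ 0 := fun h0 => hsz (by
      have := congrArg (fun f => f z) h0
      rwa [← L.ker_mkQ])
    have hcoatom : IsCoatom (LinearMap.ker (L.mkQ ∘ₗ s)) := by
      have : IsSimpleModule B (B ⧸ L) := isSimpleModule_iff_isCoatom.2 hL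
      exact LinearMap.isCoatom_ker_of_surjective (LinearMap.surjective_of_ne_zero hne)
    have heq : LinearMap.ker (L.mkQ ∘ₗ s) = LinearMap.ker (D.π k) := by
      by_contra hn
      exact (D.isCoatom_ker_π k).1 (hcoatom.2 _ (lt_of_le_of_ne (D.ker_le_ker_π hne) hn))
    rw [← heq, LinearMap.mem_ker] at hz
    exact hsz (by rw [← L.ker_mkQ]; exact hz)
  have hrad : RelRad I' (s z) := fun a b => by
    obtain ⟨⟨w, w', h1, h2⟩, hw⟩ := (mem_jacobson_iff_forall_isUnit (s z)).1 hs a b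
    change w = _ at hw
    rw [← hw]
    exact ⟨w', by rw [h2, sub_self]; exact I'.zero_mem, by rw [h1, sub_self]; exact I'.zero_mem⟩
  have hz' : z = s z • r 1 := by rw [← map_smul, smul_eq_mul, mul_one, hsr]
  have hr : r 1 ∈ I.asIdeal • (⊤ : Submodule B (D.P k)) := hk.ge trivial
  rw [hz', smul_smul]
  generalize r 1 = q at hr
  induction hr using Submodule.smul_induction_on' with
  | smul y hy p hp =>
    rw [smul_smul]
    exact Submodule.smul_mem_smul (TwoSidedIdeal.mem_asIdeal.2
      (hJ h (TwoSidedIdeal.mem_asIdeal.1 hh) y (TwoSidedIdeal.mem_asIdeal.1 hy) _ hrad)) trivial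
  | add p hp q hq h1 h2 => rw [smul_add]; exact add_mem h1 h2

theorem projective_smul_top (hI : Module.Projective B I) (k : D.I) :
    Module.Projective B (I.asIdeal • (⊤ : Submodule B (D.P k)) : Submodule B (D.P k)) := by
  obtain ⟨s, r, hsr⟩ := D.exists_retract_P k
  have hs : ∀ x ∈ I.asIdeal • (⊤ : Submodule B (D.P k)), s x ∈ I := by
    intro x hx
    induction hx using Submodule.smul_induction_on' with
    | smul y hy p hp =>
      rw [map_smul]
      exact I.mul_mem_right _ _ (TwoSidedIdeal.mem_asIdeal.1 hy)
    | add p hp q hq h1 h2 => rw [map_add]; exact I.add_mem h1 h2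
  have hr : ∀ x ∈ I, r x ∈ I.asIdeal • (⊤ : Submodule B (D.P k)) := by
    intro x hx
    have : r x = x • r 1 := by rw [← map_smul, smul_eq_mul, mul_one]
    rw [this]
    exact Submodule.smul_mem_smul (TwoSidedIdeal.mem_asIdeal.2 hx) trivial
  let i : (I.asIdeal • (⊤ : Submodule B (D.P k)) : Submodule B (D.P k)) →ₗ[B] I :=
    { toFun := fun x => ⟨s x, hs x x.2⟩
      map_add' := fun x y => Subtype.ext (map_add s _ _)
      map_smul' := fun c x => Subtype.ext (map_smul s c _) }
  let q : I →ₗ[B] (I.asIdeal • (⊤ : Submodule B (D.P k)) : Submodule B (D.P k)) :=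
    { toFun := fun x => ⟨r x, hr x x.2⟩
      map_add' := fun x y => Subtype.ext (map_add r _ _)
      map_smul' := fun c x => Subtype.ext (map_smul r c _) }
  exact Module.Projective.of_split i q (LinearMap.ext fun x => Subtype.ext (hsr x))

theorem apply_mem_ker_π {i j : D.I} (hij : j ≠ i) (f : D.P j →ₗ[B] D.P i) (x : D.P j) :
    D.π i (f x) = 0 := by
  by_contra hx
  have hne : D.π i ∘ₗ f ≠ 0 := fun h => hx (congrArg (fun g => g x) h)
  have hsurj := LinearMap.surjective_of_ne_zero hne
  have heq : LinearMap.ker (D.π i ∘ₗ f) = LinearMap.ker (D.π j) := by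
    by_contra hn
    exact (D.isCoatom_ker_π j).1 ((LinearMap.isCoatom_ker_of_surjective hsurj).2 _
      (lt_of_le_of_ne (D.ker_le_ker_π hne) hn))
  exact hij (D.distinct j i ⟨((D.π j).quotKerEquivOfSurjective (D.π_surjective j)).symm.trans
    ((Submodule.quotEquivOfEq _ _ heq.symm).trans
      ((D.π i ∘ₗ f).quotKerEquivOfSurjective hsurj))⟩)

end SimpleSystem

/-! ### From a strongly heredity chain to a partial order. -/

namespace SimpleSystem

variable {B : Type u} [Ring B] {n : ℕ} {H : ℕ → TwoSidedIdeal B}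

/-- `lam k` is the position of the first ideal of the chain `H` that annihilates `S k`. -/
structure IsLevel (D : SimpleSystem B) (n : ℕ) (H : ℕ → TwoSidedIdeal B) (lam : D.I → ℕ) :
    Prop where
  pos : ∀ k, 0 < lam k
  le : ∀ k, lam k ≤ n
  lt_iff : ∀ k, ∀ m ≤ n, m < lam k ↔ (H m).asIdeal • (⊤ : Submodule B (D.P k)) = ⊤

theorem exists_isLevel (D : SimpleSystem B) (hH : IsIdempotentIdealChain n H) :
    ∃ lam, D.IsLevel n H lam := by
  classical
  have hn : ∀ k, (H n).asIdeal • (⊤ : Submodule B (D.P k)) ≠ ⊤ := by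
    intro k h
    rw [hH.zero] at h
    have hle : (⊥ : TwoSidedIdeal B).asIdeal • (⊤ : Submodule B (D.P k)) ≤ ⊥ :=
      Submodule.smul_le.2 fun x hx m _ => by
        rw [(TwoSidedIdeal.mem_bot B).1 (TwoSidedIdeal.mem_asIdeal.1 hx), zero_smul]
        exact zero_mem _
    obtain ⟨x, hx⟩ := D.exists_π_ne_zero k
    have h0 : x = 0 := (Submodule.mem_bot B).1 (hle (h.ge trivial))
    exact hx (by rw [h0, map_zero])
  have hex : ∀ k, ∃ m, (H m).asIdeal • (⊤ : Submodule B (D.P k)) ≠ ⊤ := fun k => ⟨n, hn k⟩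
  refine ⟨fun k => Nat.find (hex k), fun k => ?_, fun k => Nat.find_min' _ (hn k),
    fun k m hm => ⟨fun h => not_not.1 (Nat.find_min (hex k) h), fun h => ?_⟩⟩
  · rw [Nat.find_pos, not_not, hH.whole, eq_top_iff]
    intro x _
    rw [← one_smul B x]
    exact Submodule.smul_mem_smul trivial trivial
  · by_contra hlt
    refine Nat.find_spec (hex k) (top_le_iff.1 (h.ge.trans ?_))
    refine Submodule.smul_mono_left fun x hx => ?_
    exact ProjGenerator.le_of_forall_succ_le (fun i hi => (hH.lt i hi).le) (not_lt.1 hlt) hm hx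

variable {D : SimpleSystem B} {lam : D.I → ℕ}

/-- The partial order in which `j` lies below `i` if it has a smaller level. -/
@[reducible]
def levelOrder (lam : D.I → ℕ) : PartialOrder D.I where
  le j i := j = i ∨ lam j < lam i
  le_refl i := Or.inl rfl
  le_trans := by
    rintro a b c (rfl | hab) (rfl | hbc)
    · exact Or.inl rfl
    · exact Or.inr hbc
    · exact Or.inr hab
    · exact Or.inr (hab.trans hbc)
  le_antisymm := by
    rintro a b (rfl | hab) (h | hba)
    · rfl
    · rfl
    · exact h.symm
    · exact absurd hab hba.asymm

variable [PartialOrder D.I]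

theorem lt_iff_of_le_iff (hle : ∀ j i : D.I, j ≤ i ↔ j = i ∨ lam j < lam i) {j i : D.I} :
    j < i ↔ lam j < lam i := by
  rw [lt_iff_le_not_ge, hle, hle]
  constructor
  · rintro ⟨rfl | h, h'⟩
    · exact absurd (Or.inl rfl) h'
    · exact h
  · intro h
    refine ⟨Or.inr h, ?_⟩
    rintro (rfl | h')
    · exact lt_irrefl _ h
    · exact lt_asymm h h'

variable [IsArtinianRing B]

/-- If `j` is not below `i`, either its level is larger and the image of `P j` lies in `H (lam i) •
P i`, or the levels agree with `j ≠ i`. In the latter case the image lies in `ker π` and is stable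
under `H (lam i - 1)`, so `smul_ker_π_le` applies. -/
theorem K_eq_smul_top (hH : IsLeftStronglyHeredityChain n H) (hlam : D.IsLevel n H lam)
    (hle : ∀ j i : D.I, j ≤ i ↔ j = i ∨ lam j < lam i) (i : D.I) :
    D.K i = (H (lam i)).asIdeal • ⊤ := by
  have hidem := hH.chain.idem (lam i) (hlam.le i)
  rw [K_eq_trace]
  apply le_antisymm
  · refine trace_le.2 fun j hj f x => ?_
    rw [Set.mem_ofPred_eq, hle, not_or, not_lt] at hj
    rcases hj.2.lt_or_eq with hlt | heq
    · rw [← trace_eq_smul_top (D := D) hidem]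
      exact apply_mem_trace ((hlam.lt_iff j _ (hlam.le i)).1 hlt) f x
    · have hm : lam i - 1 + 1 = lam i := Nat.sub_add_cancel (hlam.pos i)
      have hn : lam i - 1 < n := by have := hlam.le i; omega
      have hJ := (relJac_iff _ _).2 (hH.mul_jacobson_mul (lam i - 1) hn)
      rw [hm] at hJ
      have htop : ∀ k, lam k = lam i →
          (H (lam i - 1)).asIdeal • (⊤ : Submodule B (D.P k)) = ⊤ := fun k hk =>
        (hlam.lt_iff k _ hn.le).1 (by rw [hk]; omega)
      refine smul_ker_π_le hJ i (htop i rfl) ?_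
      have hx := Submodule.mem_map_of_mem (f := f) ((htop j heq.symm).ge (Submodule.mem_top (x := x)))
      rw [Submodule.map_smul'', Submodule.map_top] at hx
      refine Submodule.smul_mono le_rfl ?_ hx
      rintro _ ⟨y, rfl⟩
      exact apply_mem_ker_π hj.1 f y
  · rw [← trace_eq_smul_top (D := D) hidem]
    refine trace_mono fun j hj => ?_
    have h := (hlam.lt_iff j _ (hlam.le i)).2 hj
    rw [Set.mem_ofPred_eq, hle]
    rintro (rfl | h')
    · exact lt_irrefl _ h
    · exact lt_asymm h h'

theorem projective_K (hH : IsLeftStronglyHeredityChain n H) (hlam : D.IsLevel n H lam)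
    (hle : ∀ j i : D.I, j ≤ i ↔ j = i ∨ lam j < lam i) (i : D.I) :
    Module.Projective B (D.K i) := by
  rw [K_eq_smul_top hH hlam hle]
  apply projective_smul_top
  rcases (hlam.le i).lt_or_eq with h | h
  · exact hH.proj _ h
  · rw [h, hH.chain.zero]
    have : Subsingleton (⊥ : TwoSidedIdeal B) := ⟨fun x y => Subtype.ext
      (((TwoSidedIdeal.mem_bot B).1 x.2).trans ((TwoSidedIdeal.mem_bot B).1 y.2).symm)⟩
    infer_instance

theorem K_ne_top (hH : IsLeftStronglyHeredityChain n H) (hlam : D.IsLevel n H lam)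
    (hle : ∀ j i : D.I, j ≤ i ↔ j = i ∨ lam j < lam i) (i : D.I) : D.K i ≠ ⊤ := by
  rw [K_eq_smul_top hH hlam hle]
  exact fun h => lt_irrefl _ ((hlam.lt_iff i _ (hlam.le i)).2 h)

/-- A map from `P i` to the radical of `Δ i` lands in the image of `ker π`. Since `P i = H (lam i -
1) • P i`, it even lands in the image of `H (lam i - 1) • ker π`, which is contained in `K i`. -/
theorem not_isCompositionFactor_jacobson (hH : IsLeftStronglyHeredityChain n H)
    (hlam : D.IsLevel n H lam) (hle : ∀ j i : D.I, j ≤ i ↔ j = i ∨ lam j < lam i) (i : D.I) :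
    ¬ IsCompositionFactor B (D.S i) (Module.jacobson B (D.Δ i)) := by
  rw [isCompositionFactor_iff]
  rintro ⟨f, hf⟩
  have hm : lam i - 1 + 1 = lam i := Nat.sub_add_cancel (hlam.pos i)
  have hn : lam i - 1 < n := by have := hlam.le i; omega
  have hJ := (relJac_iff _ _).2 (hH.mul_jacobson_mul (lam i - 1) hn)
  rw [hm] at hJ
  have htop := (hlam.lt_iff i _ hn.le).1 (by omega)
  have hker := smul_ker_π_le hJ i htop
  rw [← K_eq_smul_top hH hlam hle] at hker
  have hjac : Module.jacobson B (D.Δ i) ≤ (LinearMap.ker (D.π i)).map (D.K i).mkQ := by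
    let g := (D.K i).liftQ (D.π i) (D.le_ker_π_of_ne_top i (K_ne_top hH hlam hle i))
    have hg : Function.Surjective g := fun y => by
      obtain ⟨x, rfl⟩ := D.π_surjective i y
      exact ⟨(D.K i).mkQ x, rfl⟩
    intro z hz
    have hz' := Submodule.mem_sInf.1 hz _ (LinearMap.isCoatom_ker_of_surjective hg)
    obtain ⟨x, rfl⟩ := (D.K i).mkQ_surjective z
    exact ⟨x, hz', rfl⟩
  refine hf (LinearMap.ext fun x => Subtype.ext ?_)
  have hx := Submodule.mem_map_of_mem (f := Submodule.subtype _ ∘ₗ f)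
    (htop.ge (Submodule.mem_top (x := x)))
  rw [Submodule.map_smul'', Submodule.map_top] at hx
  have h1 : LinearMap.range (Submodule.subtype _ ∘ₗ f) ≤
      (LinearMap.ker (D.π i)).map (D.K i).mkQ := by
    rintro _ ⟨y, rfl⟩
    exact hjac (f y).2
  have h2 := Submodule.smul_mono le_rfl h1 hx
  rw [← Submodule.map_smul''] at h2
  obtain ⟨y, hy, hxy⟩ := h2
  change ((f x : Module.jacobson B (D.Δ i)) : D.Δ i) = 0
  rw [show ((f x : Module.jacobson B (D.Δ i)) : D.Δ i) = (D.K i).mkQ y from hxy.symm,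
    ← LinearMap.mem_ker, Submodule.ker_mkQ]
  exact hker hy

/-- The kernel of `Q → Δ j`, for a projective module `Q` with an epimorphism to `P j`. -/
theorem projective_comap_K (hH : IsLeftStronglyHeredityChain n H) (hlam : D.IsLevel n H lam)
    (hle : ∀ j i : D.I, j ≤ i ↔ j = i ∨ lam j < lam i) {j : D.I}
    {Q : Type u} [AddCommGroup Q] [Module B Q] [Module.Projective B Q] (g : Q →ₗ[B] D.P j)
    (hg : Function.Surjective g) {m : ℕ} (hm : m < lam j)
    (htop : (H m).asIdeal • (⊤ : Submodule B Q) = ⊤) :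
    Module.Projective B ((D.K j).comap g) ∧
      (H m).asIdeal • (D.K j).comap g = (D.K j).comap g := by
  -- The section splits `Q` as `σ(P j) ⊕ ker g`, and the preimage of `K j` as `σ(K j) ⊕ ker g`.
  obtain ⟨σ, hσ⟩ := Module.projective_lifting_property g LinearMap.id hg
  have hσ' : ∀ x, g (σ x) = x := fun x => congrArg (fun f => f x) hσ
  have hφ : ∀ y, g (y - σ (g y)) = 0 := fun y => by rw [map_sub, hσ', sub_self]
  constructor
  · have := projective_K hH hlam hle j
    let i : (D.K j).comap g →ₗ[B] D.K j × Q :=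
      (g.restrict fun x hx => hx).prod (Submodule.subtype _)
    let r : D.K j × Q →ₗ[B] (D.K j).comap g :=
      LinearMap.codRestrict _ (σ ∘ₗ (D.K j).subtype ∘ₗ LinearMap.fst B _ _ +
        (LinearMap.id - σ ∘ₗ g) ∘ₗ LinearMap.snd B _ _) fun x => by
          change g (σ (x.1 : D.P j) + (x.2 - σ (g x.2))) ∈ D.K j
          rw [map_add, hφ, hσ', add_zero]
          exact x.1.2
    refine Module.Projective.of_split i r (LinearMap.ext fun x => Subtype.ext ?_)
    change σ (g x) + ((x : Q) - σ (g x)) = x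
    abel
  · refine le_antisymm Submodule.smul_le_right fun x hx => ?_
    have hx' : x = σ (g x) + (x - σ (g x)) := by abel
    rw [hx']
    refine add_mem ?_ ?_
    · have h1 : g x ∈ (H (lam j)).asIdeal • D.K j := by
        rw [K_eq_smul_top hH hlam hle, (hH.chain.idem _ (hlam.le j)).smul_smul,
          ← K_eq_smul_top hH hlam hle]
        exact hx
      have h2 : (H (lam j)).asIdeal ≤ (H m).asIdeal := fun y hy =>
        ProjGenerator.le_of_forall_succ_le (fun i hi => (hH.chain.lt i hi).le) hm.le (hlam.le j) hy
      have h3 := Submodule.mem_map_of_mem (f := σ) (Submodule.smul_mono h2 le_rfl h1)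
      rw [Submodule.map_smul''] at h3
      refine Submodule.smul_mono le_rfl ?_ h3
      rintro _ ⟨y, hy, rfl⟩
      rw [Submodule.mem_comap, hσ']
      exact hy
    · have h3 := Submodule.mem_map_of_mem (f := LinearMap.id - σ ∘ₗ g)
        (htop.ge (Submodule.mem_top (x := x)))
      rw [Submodule.map_smul''] at h3
      refine Submodule.smul_mono le_rfl ?_ h3
      rintro _ ⟨y, -, rfl⟩
      change g (y - σ (g y)) ∈ D.K j
      rw [hφ]
      exact zero_mem _

/-- A simple quotient `S j` of `Q` lifts to an epimorphism `Q → P j`, and `H m • Q = Q` forces `m <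
lam j`. The kernel of `Q → Δ j` inherits the hypotheses on `Q` by `projective_comap_K`; the descent
ends because `M` is artinian. -/
theorem exists_filtration (hH : IsLeftStronglyHeredityChain n H) (hlam : D.IsLevel n H lam)
    (hle : ∀ j i : D.I, j ≤ i ↔ j = i ∨ lam j < lam i) {m : ℕ} (hm : m ≤ n)
    {M : Type u} [AddCommGroup M] [Module B M] [Module.Finite B M] (Q : Submodule B M)
    (hQ : Module.Projective B Q) (htop : (H m).asIdeal • Q = Q) :
    ∃ (l : ℕ) (F : ℕ → Submodule B M), F 0 = Q ∧ F l = ⊥ ∧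
      ∀ k < l, F (k + 1) ≤ F k ∧
        ∃ j, m < lam j ∧ Nonempty ((F k ⧸ (F (k + 1)).submoduleOf (F k)) ≃ₗ[B] D.Δ j) := by
  induction Q using WellFoundedLT.induction with
  | ind Q ih =>
    by_cases hbot : Q = ⊥
    · exact ⟨0, fun _ => Q, rfl, hbot, fun k hk => absurd hk (Nat.not_lt_zero k)⟩
    have hne : (⊥ : Submodule B Q) ≠ ⊤ := fun h => hbot (by
      have := congrArg (Submodule.map Q.subtype) h
      rwa [Submodule.map_bot, Submodule.map_subtype_top, eq_comm] at this)
    obtain ⟨L, hL, -⟩ := (eq_top_or_exists_le_coatom (⊥ : Submodule B Q)).resolve_left hne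
    obtain ⟨j, ⟨e⟩⟩ := D.complete (ModuleCat.of B (Q ⧸ L)) (isSimpleModule_iff_isCoatom.2 hL)
    have hf : Function.Surjective (e.toLinearMap ∘ₗ L.mkQ : Q →ₗ[B] D.S j) :=
      e.surjective.comp L.mkQ_surjective
    obtain ⟨g, hg⟩ := Module.projective_lifting_property (D.π j)
      (e.toLinearMap ∘ₗ L.mkQ : Q →ₗ[B] D.S j) (D.π_surjective j)
    have hgsurj : Function.Surjective g := by
      rw [← LinearMap.range_eq_top]
      by_contra hr
      have h1 := D.le_ker_π_of_ne_top j hr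
      obtain ⟨x, hx⟩ := D.exists_π_ne_zero j
      obtain ⟨y, hy⟩ := hf (D.π j x)
      rw [← hg] at hy
      exact hx (hy.symm.trans (h1 ⟨y, rfl⟩))
    have htop' := smul_top_coe_iff.2 htop
    have hmj : m < lam j := (hlam.lt_iff j m hm).2 (smul_top_eq_of_surjective hgsurj htop')
    obtain ⟨hproj, hsmul⟩ := projective_comap_K hH hlam hle g hgsurj hmj htop'
    have hinj := Submodule.map_injective_of_injective Q.injective_subtype
    have hlt : ((D.K j).comap g).map Q.subtype < Q := by
      refine lt_of_le_of_ne (Submodule.map_subtype_le _ _) fun h => K_ne_top hH hlam hle j ?_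
      have h1 : (D.K j).comap g = ⊤ := hinj (by rw [h, Submodule.map_subtype_top])
      rw [← Submodule.map_comap_eq_of_surjective hgsurj (D.K j), h1, Submodule.map_top,
        LinearMap.range_eq_top.2 hgsurj]
    obtain ⟨l, F, h0, hl, hF⟩ := ih _ hlt
      (Module.Projective.of_equiv (Submodule.equivMapOfInjective _ Q.injective_subtype _))
      (by rw [← Submodule.map_smul'', hsmul])
    refine ⟨l + 1, fun k => Nat.casesOn k Q F, rfl, hl, fun k hk => ?_⟩
    cases k with
    | zero =>
      change F 0 ≤ Q ∧ ∃ j, m < lam j ∧ Nonempty ((Q ⧸ (F 0).submoduleOf Q) ≃ₗ[B] D.Δ j)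
      rw [h0]
      refine ⟨hlt.le, j, hmj, ⟨?_⟩⟩
      have hker : (((D.K j).comap g).map Q.subtype).submoduleOf Q =
          LinearMap.ker ((D.K j).mkQ ∘ₗ g) := by
        rw [Submodule.submoduleOf, Submodule.comap_map_eq_of_injective Q.injective_subtype,
          LinearMap.ker_comp, Submodule.ker_mkQ]
      exact (Submodule.quotEquivOfEq _ _ hker).trans
        (LinearMap.quotKerEquivOfSurjective _ ((D.K j).mkQ_surjective.comp hgsurj))
    | succ k => exact hF k (by omega)

end SimpleSystem

/-! ### Strongly quasi-hereditary algebras and chains of ideals. -/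

section QuasiHereditary

theorem exists_simpleSystem_of_leftStrongly {B : Type u} [Ring B] [IsArtinianRing B] {n : ℕ}
    {H : ℕ → TwoSidedIdeal B} (hH : IsLeftStronglyHeredityChain n H) :
    ∃ (D : SimpleSystem B) (_ : PartialOrder D.I), ∀ i : D.I,
      D.IsDeltaFiltered {j | i < j} (D.K i) ∧ Module.Projective B (D.K i) ∧
        ¬ IsCompositionFactor B (D.S i) (Module.jacobson B (D.Δ i)) := by
  obtain ⟨D⟩ := nonempty_simpleSystem (B := B)
  obtain ⟨lam, hlam⟩ := D.exists_isLevel hH.chain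
  let _ := SimpleSystem.levelOrder lam
  have hle : ∀ j i : D.I, j ≤ i ↔ j = i ∨ lam j < lam i := fun _ _ => Iff.rfl
  refine ⟨D, _, fun i => ⟨?_, SimpleSystem.projective_K hH hlam hle i,
    SimpleSystem.not_isCompositionFactor_jacobson hH hlam hle i⟩⟩
  have := SimpleSystem.projective_K hH hlam hle i
  have hK := SimpleSystem.K_eq_smul_top hH hlam hle i
  obtain ⟨l, F, h0, hl, hF⟩ := SimpleSystem.exists_filtration hH hlam hle (hlam.le i)
    (⊤ : Submodule B (D.K i)) (Module.Projective.of_equiv Submodule.topEquiv.symm)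
    (smul_top_coe_iff.2 (by rw [hK, (hH.chain.idem _ (hlam.le i)).smul_smul]))
  refine ⟨l, F, h0, hl, fun k hk => ?_⟩
  obtain ⟨h1, j, hj, he⟩ := hF k hk
  exact ⟨h1, j, (SimpleSystem.lt_iff_of_le_iff hle).2 hj, he⟩

theorem exists_leftStrongly_op_iff {A : Type u} [Ring A] :
    (∃ (n : ℕ) (H : ℕ → TwoSidedIdeal Aᵐᵒᵖ), IsLeftStronglyHeredityChain n H) ↔
      ∃ (n : ℕ) (H : ℕ → TwoSidedIdeal A), IsRightStronglyHeredityChain n H := by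
  let e : ∀ I : TwoSidedIdeal A, I ≃ₗ[Aᵐᵒᵖ] I.op := fun I =>
    { toFun := fun x => ⟨MulOpposite.op x, by simp⟩
      invFun := fun x => ⟨x.1.unop, TwoSidedIdeal.mem_op_iff.1 x.2⟩
      left_inv := fun _ => rfl
      right_inv := fun _ => rfl
      map_add' := fun _ _ => rfl
      map_smul' := fun _ _ => rfl }
  have key : ∀ (n : ℕ) (H : ℕ → TwoSidedIdeal A),
      IsLeftStronglyHeredityChain n (fun i => (H i).op) ↔ IsRightStronglyHeredityChain n H := by
    intro n H
    exact ⟨fun h => ⟨isIdempotentIdealChain_op_iff.1 h.chain,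
        fun i hi => by
          have := h.proj i hi
          exact Module.Projective.of_equiv (e (H i)).symm,
        fun i hi => (relJac_iff _ _).1 (relJac_op_iff.1
          ((relJac_iff _ _).2 (h.mul_jacobson_mul i hi)))⟩,
      fun h => ⟨isIdempotentIdealChain_op_iff.2 h.chain,
        fun i hi => by
          have := h.proj i hi
          exact Module.Projective.of_equiv (e (H i)),
        fun i hi => (relJac_iff _ _).1 (relJac_op_iff.2
          ((relJac_iff _ _).2 (h.mul_jacobson_mul i hi)))⟩⟩
  exact ⟨fun ⟨n, H, hH⟩ => ⟨n, fun i => (H i).unop, (key n fun i => (H i).unop).1 hH⟩,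
    fun ⟨n, H, hH⟩ => ⟨n, fun i => (H i).op, (key n H).2 hH⟩⟩

theorem isRightStronglyQuasiHereditary_iff {A : Type u} [Ring A] [IsArtinianRing Aᵐᵒᵖ] :
    IsRightStronglyQuasiHereditary A ↔
      ∃ (n : ℕ) (H : ℕ → TwoSidedIdeal A), IsRightStronglyHeredityChain n H := by
  rw [← exists_leftStrongly_op_iff]
  constructor
  · rintro ⟨D, _, h⟩
    exact SimpleSystem.exists_leftStrongly h
  · rintro ⟨n, H, hH⟩
    exact exists_simpleSystem_of_leftStrongly hH

end QuasiHereditary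

end StronglyQH

theorem theorem1p2 (R A : Type*) [CommRing R] [IsArtinianRing R] [Ring A]
    [Algebra R A] [Module.Finite R A] :
    (∀ (n : ℕ) (H : ℕ → TwoSidedIdeal A) (e : ℕ → A),
      IsIdempotentIdealChain n H →
      (∀ i ≤ n, IsIdempotentElem (e i) ∧ H i = TwoSidedIdeal.span {e i}) →
      List.TFAE
        [IsRightStronglyHeredityChain n H,
          IsTotalRightRejectiveChain n (fun i => addIdem (e i)),
          IsHeredityChain n H ∧ IsCoreflectiveChain n (fun i => addIdem (e i))] ∧
      List.TFAE
        [IsLeftStronglyHeredityChain n H,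
          IsTotalLeftRejectiveChain n (fun i => addIdem (e i)),
          IsHeredityChain n H ∧ IsReflectiveChain n (fun i => addIdem (e i))]) ∧
    (IsStronglyQuasiHereditary A ↔
      ∃ (n : ℕ) (C : ℕ → Subcat (ProjCat A)), IsRejectiveChain n C) ∧
    (IsRightStronglyQuasiHereditary A ↔
      ∃ (n : ℕ) (C : ℕ → Subcat (ProjCat A)), IsTotalRightRejectiveChain n C) ∧
    (IsLeftStronglyQuasiHereditary A ↔
      ∃ (n : ℕ) (C : ℕ → Subcat (ProjCat A)), IsTotalLeftRejectiveChain n C) := by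
  have : IsArtinianRing A := IsArtinianRing.of_finite R A
  have : IsArtinianRing Aᵐᵒᵖ := IsArtinianRing.of_finite R Aᵐᵒᵖ
  have : IsArtinianRing Aᵐᵒᵖᵐᵒᵖ := IsArtinianRing.of_finite R Aᵐᵒᵖᵐᵒᵖ
  refine ⟨fun n H e hH he => ?_, isStronglyQuasiHereditary_iff R, ?_, ?_⟩
  · have hadd : ∀ i ≤ n, (projGenerator A).IsAdd (addIdem (e i)).prop (H i) := fun i hi =>
      (he i hi).2 ▸ isAdd_addIdem (he i hi).1
    exact ⟨tfae_rightStrongly R hH hadd, tfae_leftStrongly R hH hadd⟩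
  · rw [isRightStronglyQuasiHereditary_iff, exists_rightStrongly_iff R]
  · rw [IsLeftStronglyQuasiHereditary, isRightStronglyQuasiHereditary_iff,
      exists_rightStrongly_op_iff, exists_leftStrongly_iff R]
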